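/- **Models.** Let $G=(V,E)$ be a finite simple graph, $n=|V|\ge 1$, $m=|E|$. A *hardcore model* on $G$ has fields $\lambda\in\mathbb R_{\ge0}^V$ and gives a configuration $\sigma\in\{\pm\}^V$ the weight $w(\sigma)=\prod_{v:\sigma_v=+}\lambda_v$ if $\{v:\sigma_v=+\}$ is an independent set, and $w(\sigma)=0$ otherwise. An *Ising model* on $G$ has a symmetric matrix $J\in\mathbb R^{V\times V}$ with $J_{uv}\ne0$ only if $\{u,v\}\in E$, and fields $h\in(\mathbb R\cup\{\pm\infty\})^V$, and gives $\sigma$ the weight $w(\sigma)=\exp\big(\tfrac12\langle\sigma,J\sigma\rangle+\langle\sigma,h\rangle\big)$, where a vertex with $h_v=\pm\infty$ is pinned: it contributes to the weight the factor $1$ if $\sigma_v$ has the sign of $h_v$ and the factor $0$ otherwise, in place of $e^{\sigma_vh_v}$. In both cases $Z=\sum_\sigma w(\sigma)$, and the Gibbs distribution is $\mu=w/Z$. A distribution $\mu$ on $\{\pm\}^V$ is *$b$-marginally bounded* if for every $\Lambda\subseteq V$, every $\sigma\in\{\pm\}^\Lambda$ of positive probability, every $v\in V$ and $c\in\{\pm\}$,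 the conditional marginal satisfies $\mu_v^\sigma(c)\ge b$ whenever $\mu_v^\sigma(c)>0$. **Oracles.** Let $T^{\mathsf{sp}}_G,T^{\mathsf{ct}}_G:(0,1)\to\mathbb N$ be non-increasing. A *sampling oracle* for $\mu$ with cost $T^{\mathsf{sp}}_G$ returns, for any $\delta\in(0,1)$, a fresh independent random $X\in\{\pm\}^V$ in time $T^{\mathsf{sp}}_G(\delta)$, whose law has TV-distance at most $\delta$ from $\mu$. An *approximate counting oracle* with cost $T^{\mathsf{ct}}_G$ returns, for any $\delta\in(0,1)$, a fresh independent random real $\hat Z$ in time $T^{\mathsf{ct}}_G(\delta)$ with $\Pr[(1-\delta)Z\le\hat Z\le(1+\delta)Z]\ge 0.99$. As usual, $T^{\mathsf{sp}}_G\ge n+m$ is assumed (the oracle has to read the graph). **Theorem.** There are a randomized algorithm $\mathcal A$ (one program, in the real RAM model with unit-cost real arithmetic, comparison and exponential) and constants $c\in(0,1]$, $k\in\mathbb N$ such that for every $0<b<1$ there is a constant $C_b>0$ with the following property. Let the input be $G$, an error bound $0<\epsilon<1$, and the parameters of two hardcore models on $G$ or of two Ising models on $G$, with Gibbs distributions $\mu$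 and $\nu$. If $\mu,\nu$ are both $b$-marginally bounded and both systems admit sampling and approximate counting oracles with costs $T^{\mathsf{sp}}_G,T^{\mathsf{ct}}_G$, then $\mathcal A$, which may call these oracles and is not given $b$, outputs $\hat d$ with $$\Pr\big[(1-\epsilon)\,d_{\mathrm{TV}}(\mu,\nu)\le\hat d\le(1+\epsilon)\,d_{\mathrm{TV}}(\mu,\nu)\big]\ \ge\ \tfrac23$$ in time at most $$C_b\left(\frac{N^2}{\epsilon^2}\,T^{\mathsf{sp}}_G\!\left(c\,b^k\,\frac{\epsilon^2}{N^2}\right)+T^{\mathsf{ct}}_G\!\left(c\,b^k\,\frac{\epsilon}{N}\right)\right),$$ where $N=n$ for hardcore models and $N=n+m$ for Ising models. -/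

import Mathlib

open MeasureTheory
open scoped NNReal

noncomputable section

namespace TVSpin

/-! ### Spin systems on the vertex set `{0, …, n-1}` -/

/-- Configurations in `{±}^V`; `true` is the spin `+1` and `false` is the spin `-1`. -/
abbrev Config (n : ℕ) : Type := Fin n → Bool

/-- The numerical value of a spin. -/
def spin (c : Bool) : ℝ := if c then 1 else -1

/-- The partition function of a weight function. -/
def partition {n : ℕ} (w : Config n → ℝ) : ℝ := ∑ σ, w σ

/-- The Gibbs distribution of a weight function. -/
def gibbs {n : ℕ} (w : Config n → ℝ) (σ : Config n) : ℝ := w σ / partition w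

/-- Total variation distance of two distributions on configurations. -/
def tvDist {n : ℕ} (p q : Config n → ℝ) : ℝ := (1 / 2) * ∑ σ, |p σ - q σ|

open Classical in
/-- The probability of an event. -/
def prob {n : ℕ} (p : Config n → ℝ) (A : Config n → Prop) : ℝ :=
  ∑ τ, if A τ then p τ else 0

/-- `τ` extends the partial configuration on `Λ` given by the restriction of `σ` to `Λ`. -/
def Extends {n : ℕ} (Λ : Finset (Fin n)) (σ τ : Config n) : Prop := ∀ u ∈ Λ, τ u = σ u

/-- The marginal at `v` of the distribution conditional on the partial configuration
`σ` restricted to `Λ`, evaluated at the spin `c`. -/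
def condMarginal {n : ℕ} (p : Config n → ℝ) (Λ : Finset (Fin n)) (σ : Config n)
    (v : Fin n) (c : Bool) : ℝ :=
  prob p (fun τ => Extends Λ σ τ ∧ τ v = c) / prob p (Extends Λ σ)

/-- `b`-marginal boundedness: for every feasible partial configuration, every conditional
marginal probability that is positive is at least `b`. -/
def MarginallyBounded {n : ℕ} (b : ℝ) (p : Config n → ℝ) : Prop :=
  ∀ (Λ : Finset (Fin n)) (σ : Config n), 0 < prob p (Extends Λ σ) →
    ∀ (v : Fin n) (c : Bool), 0 < condMarginal p Λ σ v c → b ≤ condMarginal p Λ σ v c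

open Classical in
/-- Weight of a configuration in the hardcore model `(G, lam)`. -/
def hardcoreWeight {n : ℕ} (G : SimpleGraph (Fin n)) (lam : Fin n → ℝ≥0) (σ : Config n) : ℝ :=
  if G.IsIndepSet {v | σ v = true} then ∏ v, (if σ v = true then (lam v : ℝ) else 1) else 0

/-- Parameters `(J, h)` of an Ising model on `G`; the external fields may be infinite. -/
structure IsingModel {n : ℕ} (G : SimpleGraph (Fin n)) where
  J : Matrix (Fin n) (Fin n) ℝ
  symm : J.IsSymm
  supp : ∀ u v, J u v ≠ 0 → G.Adj u v
  h : Fin n → EReal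

open Classical in
/-- Weight `exp (⟨σ, J σ⟩ / 2 + ⟨σ, h⟩)` of a configuration in an Ising model. An infinite
field pins its vertex: it contributes the factor `1` if the spin has the sign of the field and
the factor `0` otherwise (`EReal.toReal` sends both infinities to `0`). -/
def isingWeight {n : ℕ} {G : SimpleGraph (Fin n)} (I : IsingModel G) (σ : Config n) : ℝ :=
  if ∀ v, (I.h v = ⊤ → σ v = true) ∧ (I.h v = ⊥ → σ v = false) then
    Real.exp ((1 / 2) * ∑ u, ∑ v, I.J u v * spin (σ u) * spin (σ v)
      + ∑ v, spin (σ v) * (I.h v).toReal)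
  else 0

/-- The two spin systems of an instance. -/
inductive Side : Type
  | mu
  | nu

/-- A pair of hardcore models, or a pair of Ising models, on the same graph `G`. -/
inductive ModelPair {n : ℕ} (G : SimpleGraph (Fin n)) : Type
  | hardcore (lam : Side → Fin n → ℝ≥0)
  | ising (I : Side → IsingModel G)

/-- The weight function of each of the two systems. -/
def ModelPair.weight {n : ℕ} {G : SimpleGraph (Fin n)} : ModelPair G → Side → Config n → ℝ
  | .hardcore lam, s => hardcoreWeight G (lam s)
  | .ising I, s => isingWeight (I s)

/-- The number of edges. -/
def numEdges {n : ℕ} (G : SimpleGraph (Fin n)) : ℕ := G.edgeSet.ncard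

/-- The size parameter `N`: `n` for hardcore models and `n + m` for Ising models. -/
def ModelPair.size {n : ℕ} {G : SimpleGraph (Fin n)} : ModelPair G → ℕ
  | .hardcore _ => n
  | .ising _ => n + numEdges G

/-! ### Sampling and approximate counting oracles -/

/-- The answer distributions of the oracles of the two systems, as a function of the error
parameter. Only error parameters in `(0, 1)` can be queried. -/
structure Oracles (n : ℕ) where
  sample : Side → ℝ → ProbabilityMeasure (Config n)
  count : Side → ℝ → ProbabilityMeasure ℝ

/-- Correctness of a sampling oracle for the distribution `p`. -/
def IsSamplingOracle {n : ℕ} (p : Config n → ℝ) (law : ℝ → ProbabilityMeasure (Config n)) :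
    Prop :=
  ∀ δ ∈ Set.Ioo (0 : ℝ) 1, tvDist (fun σ => (law δ : Measure (Config n)).real {σ}) p ≤ δ

/-- Correctness of an approximate counting oracle for the partition function `Z`. -/
def IsCountingOracle (Z : ℝ) (law : ℝ → ProbabilityMeasure ℝ) : Prop :=
  ∀ δ ∈ Set.Ioo (0 : ℝ) 1,
    0.99 ≤ (law δ : Measure ℝ).real (Set.Icc ((1 - δ) * Z) ((1 + δ) * Z))

/-! ### Randomized oracle programs for a real RAM

The memory consists of registers and arrays for natural numbers (indices) and for real numbers.
One elementary operation costs one unit of time. On indices there are addition and truncated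
subtraction; on reals there are the field operations, `exp` and comparison. There is no
rounding and no conversion from reals to indices. -/

structure State : Type where
  nat : ℕ → ℕ
  real : ℕ → ℝ
  natArr : ℕ → ℕ → ℕ
  realArr : ℕ → ℕ → ℝ
  /-- Number of random draws (coins and oracle calls) made so far. -/
  calls : ℕ

def State.setNat (s : State) (i x : ℕ) : State := { s with nat := Function.update s.nat i x }

def State.setReal (s : State) (i : ℕ) (x : ℝ) : State :=
  { s with real := Function.update s.real i x }

def State.setNatArr (s : State) (a k x : ℕ) : State :=
  { s with natArr := Function.update s.natArr a (Function.update (s.natArr a) k x) }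

def State.setRealArr (s : State) (a k : ℕ) (x : ℝ) : State :=
  { s with realArr := Function.update s.realArr a (Function.update (s.realArr a) k x) }

def State.nextCall (s : State) : State := { s with calls := s.calls + 1 }

/-- Store a configuration in the entries `0, …, n-1` of the index array `a`
(`1` for the spin `+1` and `0` for the spin `-1`). -/
def State.setConfig {n : ℕ} (s : State) (a : ℕ) (σ : Config n) : State :=
  { s with
    natArr := Function.update s.natArr a
      (fun v => if hv : v < n then (σ ⟨v, hv⟩).toNat else s.natArr a v) }

/-- Elementary operations; the first argument names the target. -/
inductive Instr : Type
  | natConst (i x : ℕ)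
  | natCopy (i j : ℕ)
  | natAdd (i j k : ℕ)
  | natSub (i j k : ℕ)
  /-- Register `i` receives entry number `nat j` of the index array `a`. -/
  | natLoad (i a j : ℕ)
  /-- Entry number `nat j` of the index array `a` receives register `i`. -/
  | natStore (a j i : ℕ)
  | realConst (i : ℕ) (q : ℚ)
  | realCopy (i j : ℕ)
  /-- Conversion of an index to a real number. -/
  | realCast (i j : ℕ)
  | realAdd (i j k : ℕ)
  | realSub (i j k : ℕ)
  | realMul (i j k : ℕ)
  /-- Division, with result `0` if the divisor is `0`. -/
  | realDiv (i j k : ℕ)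
  | realExp (i j : ℕ)
  | realLoad (i a j : ℕ)
  | realStore (a j i : ℕ)

def Instr.apply : Instr → State → State
  | .natConst i x, s => s.setNat i x
  | .natCopy i j, s => s.setNat i (s.nat j)
  | .natAdd i j k, s => s.setNat i (s.nat j + s.nat k)
  | .natSub i j k, s => s.setNat i (s.nat j - s.nat k)
  | .natLoad i a j, s => s.setNat i (s.natArr a (s.nat j))
  | .natStore a j i, s => s.setNatArr a (s.nat j) (s.nat i)
  | .realConst i q, s => s.setReal i (q : ℝ)
  | .realCopy i j, s => s.setReal i (s.real j)
  | .realCast i j, s => s.setReal i (s.nat j : ℝ)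
  | .realAdd i j k, s => s.setReal i (s.real j + s.real k)
  | .realSub i j k, s => s.setReal i (s.real j - s.real k)
  | .realMul i j k, s => s.setReal i (s.real j * s.real k)
  | .realDiv i j k, s => s.setReal i (s.real j / s.real k)
  | .realExp i j, s => s.setReal i (Real.exp (s.real j))
  | .realLoad i a j, s => s.setReal i (s.realArr a (s.nat j))
  | .realStore a j i, s => s.setRealArr a (s.nat j) (s.real i)

/-- Tests on two registers. -/
inductive Test : Type
  | natLE (i j : ℕ)
  | natLT (i j : ℕ)
  | realLE (i j : ℕ)
  | realLT (i j : ℕ)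

def Test.holds : Test → State → Prop
  | .natLE i j, s => s.nat i ≤ s.nat j
  | .natLT i j, s => s.nat i < s.nat j
  | .realLE i j, s => s.real i ≤ s.real j
  | .realLT i j, s => s.real i < s.real j

/-- Programs. A program is a finite object that knows neither the graph nor its size. -/
inductive Prog : Type
  | op (i : Instr)
  /-- Index register `i` receives a fair random bit. -/
  | coin (i : ℕ)
  /-- Call the sampling oracle of system `s` with the error parameter in real register `e`
  and write the sample to index array `a`. -/
  | sample (s : Side) (e a : ℕ)
  /-- Call the counting oracle of system `s` with the error parameter in real register `e`
  and write the answer to real register `i`. -/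
  | count (s : Side) (e i : ℕ)
  | seq (p q : Prog)
  | branch (t : Test) (p q : Prog)
  | loop (t : Test) (p : Prog)

/-- All the random answers: the coins, the samples and the counts. If the draw number `i` is a
call to an oracle, the answer is the entry indexed by `i`, the system and the error parameter. -/
abbrev Tape (n : ℕ) : Type :=
  (ℕ → Bool) × ((ℕ × Side × ℝ → Config n) × (ℕ × Side × ℝ → ℝ))

/-- The law of the tape: all entries are independent, coins are fair, and the answers to oracle
queries follow the laws of the oracles. -/
def Oracles.tapeLaw {n : ℕ} (O : Oracles n) : Measure (Tape n) :=
  (Measure.infinitePi fun _ : ℕ => (PMF.uniformOfFintype Bool).toMeasure).prod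
    ((Measure.infinitePi fun x : ℕ × Side × ℝ => (O.sample x.2.1 x.2.2 : Measure (Config n))).prod
      (Measure.infinitePi fun x : ℕ × Side × ℝ => (O.count x.2.1 x.2.2 : Measure ℝ)))

/-- `Exec Tsp Tct ω P s t s'`: with the random answers `ω`, the program `P` started in the
state `s` halts after time `t` in the state `s'`. A call to an oracle with error parameter `δ`
is charged `Tsp δ + 1` or `Tct δ + 1`; if `δ` is not in `(0, 1)`, the program gets stuck. -/
inductive Exec {n : ℕ} (Tsp Tct : ℝ → ℕ) (ω : Tape n) : Prog → State → ℕ → State → Prop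
  | op (i : Instr) (s : State) : Exec Tsp Tct ω (.op i) s 1 (i.apply s)
  | coin (i : ℕ) (s : State) :
      Exec Tsp Tct ω (.coin i) s 1 (s.setNat i (ω.1 s.calls).toNat).nextCall
  | sample (x : Side) (e a : ℕ) (s : State) (he : s.real e ∈ Set.Ioo (0 : ℝ) 1) :
      Exec Tsp Tct ω (.sample x e a) s (Tsp (s.real e) + 1)
        (s.setConfig a (ω.2.1 (s.calls, x, s.real e))).nextCall
  | count (x : Side) (e i : ℕ) (s : State) (he : s.real e ∈ Set.Ioo (0 : ℝ) 1) :
      Exec Tsp Tct ω (.count x e i) s (Tct (s.real e) + 1)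
        (s.setReal i (ω.2.2 (s.calls, x, s.real e))).nextCall
  | seq {p q : Prog} {s₁ s₂ s₃ : State} {t₁ t₂ : ℕ} :
      Exec Tsp Tct ω p s₁ t₁ s₂ → Exec Tsp Tct ω q s₂ t₂ s₃ →
      Exec Tsp Tct ω (.seq p q) s₁ (t₁ + t₂) s₃
  | branch_true {c : Test} {p q : Prog} {s s' : State} {t : ℕ} :
      c.holds s → Exec Tsp Tct ω p s t s' → Exec Tsp Tct ω (.branch c p q) s (t + 1) s'
  | branch_false {c : Test} {p q : Prog} {s s' : State} {t : ℕ} :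
      ¬ c.holds s → Exec Tsp Tct ω q s t s' → Exec Tsp Tct ω (.branch c p q) s (t + 1) s'
  | loop_false {c : Test} {p : Prog} {s : State} :
      ¬ c.holds s → Exec Tsp Tct ω (.loop c p) s 1 s
  | loop_true {c : Test} {p : Prog} {s₁ s₂ s₃ : State} {t₁ t₂ : ℕ} :
      c.holds s₁ → Exec Tsp Tct ω p s₁ t₁ s₂ → Exec Tsp Tct ω (.loop c p) s₂ t₂ s₃ →
      Exec Tsp Tct ω (.loop c p) s₁ (t₁ + t₂ + 1) s₃

/-! ### Input and output -/

open Classical in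
/-- The edges `(u, v)` with `u < v`, in lexicographic order. -/
def edgeList {n : ℕ} (G : SimpleGraph (Fin n)) : List (Fin n × Fin n) :=
  ((List.finRange n) ×ˢ (List.finRange n)).filter fun p => p.1 < p.2 ∧ G.Adj p.1 p.2

/-- An array of indices with the given entries, followed by zeros. -/
def natVec {n : ℕ} (f : Fin n → ℕ) (v : ℕ) : ℕ := if hv : v < n then f ⟨v, hv⟩ else 0

/-- An array of reals with the given entries, followed by zeros. -/
def realVec {n : ℕ} (f : Fin n → ℝ) (v : ℕ) : ℝ := if hv : v < n then f ⟨v, hv⟩ else 0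

/-- An array indexed by the edge list, followed by zeros. -/
def edgeVec {n : ℕ} {α : Type} [Zero α] (G : SimpleGraph (Fin n)) (f : Fin n → Fin n → α)
    (k : ℕ) : α :=
  ((edgeList G)[k]?).elim 0 fun p => f p.1 p.2

open Classical in
/-- The mark that tells finite fields (`0`) from `+∞` (`1`) and `-∞` (`2`). -/
def fieldMark (x : EReal) : ℕ := if x = ⊤ then 1 else if x = ⊥ then 2 else 0

/-- The initial state. Index registers `0, 1, 2` hold `n`, `m` and the kind of the models
(`0` hardcore, `1` Ising); real register `0` holds the error bound; index arrays `0, 1` hold the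
ends of the edges. For hardcore models, real arrays `0, 1` hold the fields. For Ising models, real
arrays `0, 1` hold the fields (`0` if infinite), index arrays `2, 3` their marks, and real arrays
`2, 3` the interactions along the edges. Everything else is `0`. -/
def ModelPair.input {n : ℕ} {G : SimpleGraph (Fin n)} (M : ModelPair G) (ε : ℝ) : State where
  nat
    | 0 => n
    | 1 => numEdges G
    | 2 => match M with
      | .hardcore _ => 0
      | .ising _ => 1
    | _ => 0
  real
    | 0 => ε
    | _ => 0
  natArr
    | 0 => edgeVec G fun u _ => (u : ℕ)
    | 1 => edgeVec G fun _ v => (v : ℕ)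
    | 2 => match M with
      | .hardcore _ => 0
      | .ising I => natVec fun v => fieldMark ((I .mu).h v)
    | 3 => match M with
      | .hardcore _ => 0
      | .ising I => natVec fun v => fieldMark ((I .nu).h v)
    | _ => 0
  realArr
    | 0 => match M with
      | .hardcore lam => realVec fun v => (lam .mu v : ℝ)
      | .ising I => realVec fun v => ((I .mu).h v).toReal
    | 1 => match M with
      | .hardcore lam => realVec fun v => (lam .nu v : ℝ)
      | .ising I => realVec fun v => ((I .nu).h v).toReal
    | 2 => match M with
      | .hardcore _ => 0
      | .ising I => edgeVec G (I .mu).J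
    | 3 => match M with
      | .hardcore _ => 0
      | .ising I => edgeVec G (I .nu).J
    | _ => 0
  calls := 0

/-- The output of a halted program is real register `0`. -/
def State.output (s : State) : ℝ := s.real 0

/-- Total variation distance of the two Gibbs distributions of an instance. -/
def ModelPair.tv {n : ℕ} {G : SimpleGraph (Fin n)} (M : ModelPair G) : ℝ :=
  tvDist (gibbs (M.weight .mu)) (gibbs (M.weight .nu))

/-- With the random answers `ω`, the program halts on the instance within time `B`. -/
def HaltsWithin {n : ℕ} {G : SimpleGraph (Fin n)} (P : Prog) (M : ModelPair G) (ε : ℝ)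
    (Tsp Tct : ℝ → ℕ) (ω : Tape n) (B : ℝ) : Prop :=
  ∃ (t : ℕ) (s : State), Exec Tsp Tct ω P (M.input ε) t s ∧ (t : ℝ) ≤ B

/-- With the random answers `ω`, the program halts on the instance with an output of relative
error at most `ε`. -/
def Succeeds {n : ℕ} {G : SimpleGraph (Fin n)} (P : Prog) (M : ModelPair G) (ε : ℝ)
    (Tsp Tct : ℝ → ℕ) (ω : Tape n) : Prop :=
  ∃ (t : ℕ) (s : State), Exec Tsp Tct ω P (M.input ε) t s ∧
    (1 - ε) * M.tv ≤ s.output ∧ s.output ≤ (1 + ε) * M.tv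

end TVSpin

end

noncomputable section

namespace TVSpin

/-! ### Total variation distance -/

theorem tvDist_comm {n : ℕ} (p q : Config n → ℝ) : tvDist p q = tvDist q p := by
  simp only [tvDist, abs_sub_comm]

theorem tvDist_nonneg {n : ℕ} (p q : Config n → ℝ) : 0 ≤ tvDist p q := by
  unfold tvDist; positivity

theorem abs_sum_sub_le_tvDist {n : ℕ} {p q : Config n → ℝ} (hpq : ∑ σ, p σ = ∑ σ, q σ)
    {f : Config n → ℝ} {c a : ℝ} (hf : ∀ σ, |f σ - c| ≤ a) :
    |∑ σ, p σ * f σ - ∑ σ, q σ * f σ| ≤ 2 * a * tvDist p q := by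
  have h1 : ∑ σ, p σ * f σ - ∑ σ, q σ * f σ = ∑ σ, (p σ - q σ) * (f σ - c) := by
    have h2 : ∑ σ, (p σ - q σ) * (f σ - c) =
        (∑ σ, p σ * f σ - ∑ σ, q σ * f σ) - (∑ σ, p σ - ∑ σ, q σ) * c := by
      simp only [sub_mul, mul_sub, Finset.sum_sub_distrib, Finset.sum_mul]
    rw [h2, hpq]; ring
  rw [h1]
  calc _ ≤ ∑ σ, |p σ - q σ| * a := (Finset.abs_sum_le_sum_abs _ _).trans
        (Finset.sum_le_sum fun σ _ => by
          rw [abs_mul]; exact mul_le_mul_of_nonneg_left (hf σ) (abs_nonneg _))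
    _ = _ := by rw [← Finset.sum_mul, tvDist]; ring

open Classical in
theorem prob_eq_sum {n : ℕ} (p : Config n → ℝ) (A : Config n → Prop) :
    prob p A = ∑ σ, p σ * (if A σ then 1 else 0) := by
  simp [prob]

theorem abs_prob_sub_le_tvDist {n : ℕ} {p q : Config n → ℝ} (hpq : ∑ σ, p σ = ∑ σ, q σ)
    (A : Config n → Prop) : |prob p A - prob q A| ≤ tvDist p q := by
  classical
  have := abs_sum_sub_le_tvDist hpq (f := fun σ => if A σ then 1 else 0) (c := 1 / 2) (a := 1 / 2)
    (fun σ => by split <;> norm_num [abs_of_pos, abs_of_neg])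
  rw [prob_eq_sum, prob_eq_sum]
  simpa using this

theorem tvDist_eq_sum_max {n : ℕ} {p q : Config n → ℝ} (hpq : ∑ σ, p σ = ∑ σ, q σ) :
    tvDist p q = ∑ σ, max 0 (p σ - q σ) := by
  have h : ∀ x : ℝ, max 0 x = (1 / 2) * |x| + (1 / 2) * x := by
    intro x
    rcases le_total 0 x with hx | hx
    · rw [max_eq_right hx, abs_of_nonneg hx]; ring
    · rw [max_eq_left hx, abs_of_nonpos hx]; ring
  simp only [h, Finset.sum_add_distrib, ← Finset.mul_sum, Finset.sum_sub_distrib, hpq, sub_self,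
    tvDist]
  ring

theorem sum_gibbs {n : ℕ} {w : Config n → ℝ} (hZ : 0 < partition w) : ∑ σ, gibbs w σ = 1 := by
  simp only [gibbs, ← Finset.sum_div]
  exact div_self hZ.ne'

theorem gibbs_nonneg {n : ℕ} {w : Config n → ℝ} (hw : ∀ σ, 0 ≤ w σ) (σ : Config n) :
    0 ≤ gibbs w σ :=
  div_nonneg (hw σ) (Finset.sum_nonneg fun σ _ => hw σ)

/-! ### Deviations of empirical means -/

section Deviation

variable {ι Ω : Type} [MeasurableSpace Ω]

theorem infinitePi_mean_dev_le {ν : ι → Measure Ω} [∀ i, IsProbabilityMeasure (ν i)]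
    {idx : ℕ → ι} (hidx : Function.Injective idx) {l : Measure Ω} {K : ℕ}
    (hl : ∀ i, ν (idx i) = l) {f : Ω → ℝ} (hf : Measurable f) {c a t : ℝ}
    (hfa : ∀ x, |f x - c| ≤ a) (ht : 0 < t) (hK : 0 < K) :
    Measure.infinitePi ν {ω | t ≤ |(∑ i ∈ Finset.range K, f (ω (idx i))) / K - ∫ x, f x ∂l|} ≤
      ENNReal.ofReal (a ^ 2 / (K * t ^ 2)) := by
  classical
  have : IsProbabilityMeasure l := hl 0 ▸ inferInstance
  have hab : ∀ x, f x ∈ Set.Icc (c - a) (c + a) := fun x => by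
    have := abs_le.1 (hfa x); constructor <;> linarith
  have hmem : ∀ i, MemLp (fun ω : ι → Ω => f (ω (idx i))) 2 (Measure.infinitePi ν) := fun i =>
    memLp_of_bounded (a := c - a) (b := c + a) (Filter.Eventually.of_forall fun ω => hab _)
      (hf.comp (measurable_pi_apply _)).aestronglyMeasurable 2
  have hint : ∀ i, ∫ ω, f (ω (idx i)) ∂(Measure.infinitePi ν) = ∫ x, f x ∂l := fun i => by
    rw [← hl i, ← (measurePreserving_eval_infinitePi ν (idx i)).map_eq, integral_map
      (measurable_pi_apply _).aemeasurable hf.aestronglyMeasurable]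
  have hvar : ∀ i, ProbabilityTheory.variance (fun ω : ι → Ω => f (ω (idx i)))
      (Measure.infinitePi ν) ≤ a ^ 2 := fun i => by
    refine (ProbabilityTheory.variance_le_sq_of_bounded (a := c - a) (b := c + a)
      (Filter.Eventually.of_forall fun ω => hab _)
      (hf.comp (measurable_pi_apply _)).aemeasurable).trans (le_of_eq ?_)
    ring
  have hind : ProbabilityTheory.iIndepFun (fun i (ω : ι → Ω) => f (ω i))
      (Measure.infinitePi ν) :=
    ProbabilityTheory.iIndepFun_infinitePi (fun i => hf)
  set S : (ι → Ω) → ℝ := ∑ i ∈ Finset.range K, fun ω => f (ω (idx i)) with hS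
  have hSm : MemLp S 2 (Measure.infinitePi ν) := memLp_finsetSum' _ fun i _ => hmem i
  have hSv : ProbabilityTheory.variance S (Measure.infinitePi ν) ≤ K * a ^ 2 := by
    rw [hS, ProbabilityTheory.IndepFun.variance_sum (fun i _ => hmem i)
      (fun i _ j _ hij => hind.indepFun (hidx.ne hij))]
    simpa using Finset.sum_le_card_nsmul (Finset.range K) _ (a ^ 2) fun i _ => hvar i
  have hSi : ∫ ω, S ω ∂(Measure.infinitePi ν) = K * ∫ x, f x ∂l := by
    simp only [hS, Finset.sum_apply]
    rw [integral_finsetSum _ fun i _ => (hmem i).integrable (by norm_num)]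
    simp [hint]
  have hK' : (0 : ℝ) < K := by exact_mod_cast hK
  have hch := ProbabilityTheory.meas_ge_le_variance_div_sq hSm (c := K * t) (by positivity)
  rw [hSi] at hch
  refine (measure_mono fun ω hω => ?_).trans (hch.trans (ENNReal.ofReal_le_ofReal ?_))
  · have h1 : S ω - K * ∫ x, f x ∂l =
        K * ((∑ i ∈ Finset.range K, f (ω (idx i))) / K - ∫ x, f x ∂l) := by
      simp only [hS, Finset.sum_apply]; field_simp
    simp only [Set.mem_ofPred_eq] at hω ⊢
    rw [h1, abs_mul, abs_of_pos hK']
    exact mul_le_mul_of_nonneg_left hω hK'.le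
  · calc _ ≤ K * a ^ 2 / (K * t) ^ 2 := by gcongr
      _ = _ := by field_simp

theorem infinitePi_exists_notMem_le {ν : ι → Measure Ω} [∀ i, IsProbabilityMeasure (ν i)]
    {idx : ℕ → ι} {l : Measure Ω} (K : ℕ) (hl : ∀ i, ν (idx i) = l) {S : Set Ω}
    (hS : MeasurableSet S) :
    Measure.infinitePi ν {ω | ∃ i < K, ω (idx i) ∉ S} ≤ K * l Sᶜ := by
  have h1 : {ω : ι → Ω | ∃ i < K, ω (idx i) ∉ S} =
      ⋃ i ∈ Finset.range K, (fun ω => ω (idx i)) ⁻¹' Sᶜ := by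
    ext ω; simp
  rw [h1]
  refine (measure_biUnion_finset_le _ _).trans ?_
  have h2 : ∀ i ∈ Finset.range K, Measure.infinitePi ν ((fun ω => ω (idx i)) ⁻¹' Sᶜ) = l Sᶜ :=
    fun i _ => by
      rw [← hl i, ← (measurePreserving_eval_infinitePi ν (idx i)).map_eq,
        Measure.map_apply (measurable_pi_apply _) hS.compl]
  rw [Finset.sum_congr rfl h2]
  simp

end Deviation

/-! ### The estimator -/

/-- The contribution of a sample with normalized likelihood ratio `x`. -/
def deficit (x : ℝ) : ℝ := max 0 (1 - x)

theorem deficit_nonneg (x : ℝ) : 0 ≤ deficit x := le_max_left _ _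

theorem abs_deficit_sub_le (x y : ℝ) : |deficit x - deficit y| ≤ |x - y| := by
  have := abs_max_sub_max_le_abs (1 - x) (1 - y) 0
  simp only [deficit, max_comm (0 : ℝ)]
  refine this.trans (le_of_eq ?_)
  rw [abs_sub_comm]; congr 1; ring

theorem abs_deficit_div_sub_le {x q t : ℝ} (hx : 0 ≤ x) (hq : 0 < q) (h1 : q ≤ 1 + t)
    (h2 : 1 ≤ q * (1 + t)) : |deficit (x / q) - deficit x| ≤ t := by
  have ht : 0 ≤ t := by nlinarith
  have hxq : x / q * q = x := div_mul_cancel₀ _ hq.ne'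
  have hy : 0 ≤ x / q := by positivity
  set y := x / q
  simp only [deficit]
  rw [abs_le]
  constructor
  · rcases le_total 1 x with h | h
    · rw [max_eq_left (by linarith : 1 - x ≤ 0)]
      have := le_max_left 0 (1 - y); linarith
    · rw [max_eq_right (by linarith : 0 ≤ 1 - x)]
      have := le_max_right 0 (1 - y); nlinarith
  · rcases le_total 1 y with h | h
    · rw [max_eq_left (by linarith : 1 - y ≤ 0)]
      have := le_max_left 0 (1 - x); linarith
    · rw [max_eq_right (by linarith : 0 ≤ 1 - y)]
      have := le_max_right 0 (1 - x); nlinarith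

section Tape

variable {n : ℕ} (O : Oracles n)

theorem tapeLaw_samples_le (B : Set (ℕ × Side × ℝ → Config n)) :
    O.tapeLaw {ω | ω.2.1 ∈ B} ≤
      Measure.infinitePi (fun x : ℕ × Side × ℝ => (O.sample x.2.1 x.2.2 : Measure (Config n))) B := by
  have : {ω : Tape n | ω.2.1 ∈ B} = Set.univ ×ˢ (B ×ˢ Set.univ) := by ext; simp
  rw [this, Oracles.tapeLaw, Measure.prod_prod, Measure.prod_prod]
  simp

theorem tapeLaw_counts_le (B : Set (ℕ × Side × ℝ → ℝ)) :
    O.tapeLaw {ω | ω.2.2 ∈ B} ≤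
      Measure.infinitePi (fun x : ℕ × Side × ℝ => (O.count x.2.1 x.2.2 : Measure ℝ)) B := by
  have : {ω : Tape n | ω.2.2 ∈ B} = Set.univ ×ˢ (Set.univ ×ˢ B) := by ext; simp
  rw [this, Oracles.tapeLaw, Measure.prod_prod, Measure.prod_prod]
  simp

theorem tapeLaw_count_fail_le {Z : ℝ} {x : Side} (hO : IsCountingOracle Z (O.count x)) {δ : ℝ}
    (hδ : δ ∈ Set.Ioo (0 : ℝ) 1) (i : ℕ) :
    O.tapeLaw {ω | ω.2.2 (i, x, δ) ∉ Set.Icc ((1 - δ) * Z) ((1 + δ) * Z)} ≤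
      ENNReal.ofReal (1 / 100) := by
  refine (tapeLaw_counts_le O {g | g (i, x, δ) ∉ Set.Icc ((1 - δ) * Z) ((1 + δ) * Z)}).trans ?_
  have hm : MeasurableSet (Set.Icc ((1 - δ) * Z) ((1 + δ) * Z)) := measurableSet_Icc
  have h1 := (measurePreserving_eval_infinitePi
    (fun x : ℕ × Side × ℝ => (O.count x.2.1 x.2.2 : Measure ℝ)) (i, x, δ)).measure_preimage
    hm.compl.nullMeasurableSet
  refine (le_of_eq h1).trans ?_
  rw [← ofReal_measureReal, measureReal_compl hm]
  have := hO δ hδ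
  apply ENNReal.ofReal_le_ofReal
  simp only [probReal_univ]
  norm_num at this ⊢
  linarith

/-- The `i`-th sample of a run that makes only calls to the sampling oracle of `mu`. -/
def Tape.sampleAt (ω : Tape n) (δ : ℝ) (i : ℕ) : Config n := ω.2.1 (i, .mu, δ)

/-- The empirical mean of `f` over the first `K` samples. -/
def Tape.mean (ω : Tape n) (δ : ℝ) (K : ℕ) (f : Config n → ℝ) : ℝ :=
  (∑ i ∈ Finset.range K, f (ω.sampleAt δ i)) / K

variable {O} {w : Config n → ℝ} {δ : ℝ} {K : ℕ}

theorem tapeLaw_mean_dev_le (hZ : 0 < partition w)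
    (hO : IsSamplingOracle (gibbs w) (O.sample .mu)) (hδ : δ ∈ Set.Ioo (0 : ℝ) 1) (hK : 0 < K)
    {f : Config n → ℝ} {c a t : ℝ} (hf : ∀ σ, |f σ - c| ≤ a) (ht : 0 < t)
    (hat : 2 * a * δ ≤ t) :
    O.tapeLaw {ω | ¬ |ω.mean δ K f - ∑ σ, gibbs w σ * f σ| ≤ 2 * t} ≤
      ENNReal.ofReal (a ^ 2 / (K * t ^ 2)) := by
  have hinj : Function.Injective (fun i : ℕ => (i, Side.mu, δ)) := fun i j h => by
    simpa using h
  have h1 := infinitePi_mean_dev_le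
    (ν := fun x : ℕ × Side × ℝ => (O.sample x.2.1 x.2.2 : Measure (Config n)))
    hinj (l := (O.sample .mu δ : Measure (Config n))) (fun i => rfl) (f := f)
    (measurable_of_finite f) hf ht hK
  refine le_trans (measure_mono fun ω hω => ?_) ((tapeLaw_samples_le O _).trans h1)
  have hbias : |∫ x, f x ∂(O.sample .mu δ : Measure (Config n)) - ∑ σ, gibbs w σ * f σ| ≤ t := by
    rw [integral_fintype (.of_finite)]
    have h2 := abs_sum_sub_le_tvDist (q := gibbs w)
      (p := fun σ => (O.sample .mu δ : Measure (Config n)).real {σ}) (by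
        rw [sum_gibbs hZ, sum_measureReal_singleton]; simp) hf
    have ha : 0 ≤ a := (abs_nonneg _).trans (hf fun _ => true)
    simp only [smul_eq_mul]
    exact h2.trans ((mul_le_mul_of_nonneg_left (hO δ hδ) (by positivity)).trans hat)
  by_contra hcon
  apply hω
  have hcon' : |ω.mean δ K f - ∫ x, f x ∂(O.sample .mu δ : Measure (Config n))| < t := by
    simpa [Tape.mean, Tape.sampleAt] using hcon
  calc _ ≤ _ := abs_sub_le _ (∫ x, f x ∂(O.sample .mu δ : Measure (Config n))) _
    _ ≤ 2 * t := by linarith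

theorem tapeLaw_sample_support_le (hZ : 0 < partition w)
    (hO : IsSamplingOracle (gibbs w) (O.sample .mu)) (hδ : δ ∈ Set.Ioo (0 : ℝ) 1) (K : ℕ) :
    O.tapeLaw {ω | ∃ i < K, w (ω.sampleAt δ i) = 0} ≤ ENNReal.ofReal (K * δ) := by
  classical
  have h1 := infinitePi_exists_notMem_le
    (ν := fun x : ℕ × Side × ℝ => (O.sample x.2.1 x.2.2 : Measure (Config n)))
    (idx := fun i : ℕ => (i, Side.mu, δ))
    (l := (O.sample .mu δ : Measure (Config n))) K (fun i => rfl) (S := {σ | w σ ≠ 0})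
    (Set.toFinite _).measurableSet
  refine le_trans (measure_mono fun ω hω => ?_) ((tapeLaw_samples_le O _).trans (h1.trans ?_))
  · simpa [Tape.sampleAt] using hω
  · set p : Config n → ℝ := fun σ => (O.sample .mu δ : Measure (Config n)).real {σ} with hp
    have hpq : ∑ σ, p σ = ∑ σ, gibbs w σ := by
      rw [sum_gibbs hZ, sum_measureReal_singleton]; simp
    have h2 := abs_prob_sub_le_tvDist hpq (fun σ => w σ = 0)
    have h3 : prob (gibbs w) (fun σ => w σ = 0) = 0 := by
      refine Finset.sum_eq_zero fun σ _ => ?_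
      split
      · simp [gibbs, *]
      · rfl
    have h4 : (O.sample .mu δ : Measure (Config n)).real {σ | w σ ≠ 0}ᶜ =
        prob p (fun σ => w σ = 0) := by
      have : ({σ | w σ ≠ 0}ᶜ : Set (Config n)) =
          ((Finset.univ.filter fun σ => w σ = 0 : Finset (Config n)) : Set (Config n)) := by
        ext; simp
      rw [this, ← sum_measureReal_singleton, prob, Finset.sum_filter]
    rw [h3, sub_zero, ← h4] at h2
    have h5 := (le_abs_self _).trans (h2.trans (hO δ hδ))
    rw [ENNReal.ofReal_mul (by positivity), ENNReal.ofReal_natCast, ← ofReal_measureReal]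
    gcongr

end Tape

/-! ### Analysis of the estimator -/

/-- The number of samples (before rounding). -/
def sampleSize (N ε β : ℝ) : ℝ := 65536 * N ^ 2 / (ε ^ 2 * β ^ 2)

/-- The error parameter of the samples. -/
def sampleErr (N ε β : ℝ) : ℝ := ε ^ 2 * β ^ 2 / (4194304 * N ^ 2)

/-- The error parameter of the counts. -/
def countErr (N ε β : ℝ) : ℝ := ε * β / (64 * N)

section

variable {N ε β : ℝ}

theorem one_le_sampleSize (hN : 1 ≤ N) (h0 : 0 < ε) (h1 : ε < 1) (hβ : 0 < β) (hβ1 : β ≤ 1) :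
    1 ≤ sampleSize N ε β := by
  rw [sampleSize, le_div_iff₀ (by positivity)]
  nlinarith [mul_le_one₀ (pow_le_one₀ (n := 2) h0.le h1.le) (by positivity)
    (pow_le_one₀ (n := 2) hβ.le hβ1)]

theorem sampleErr_mem (hN : 1 ≤ N) (h0 : 0 < ε) (h1 : ε < 1) (hβ : 0 < β) (hβ1 : β ≤ 1) :
    sampleErr N ε β ∈ Set.Ioo (0 : ℝ) 1 := by
  refine ⟨by unfold sampleErr; positivity, ?_⟩
  rw [sampleErr, div_lt_one (by positivity)]
  nlinarith [mul_le_one₀ (pow_le_one₀ (n := 2) h0.le h1.le) (by positivity)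
    (pow_le_one₀ (n := 2) hβ.le hβ1)]

theorem countErr_mem (hN : 1 ≤ N) (h0 : 0 < ε) (h1 : ε < 1) (hβ : 0 < β) (hβ1 : β ≤ 1) :
    countErr N ε β ∈ Set.Ioo (0 : ℝ) 1 := by
  refine ⟨by unfold countErr; positivity, ?_⟩
  rw [countErr, div_lt_one (by positivity)]
  nlinarith [mul_le_one₀ h1.le hβ.le hβ1]

theorem ceil_sampleSize_le (hN : 1 ≤ N) (h0 : 0 < ε) (h1 : ε < 1) (hβ : 0 < β) (hβ1 : β ≤ 1) :
    (⌈sampleSize N ε β⌉₊ : ℝ) ≤ 2 * sampleSize N ε β := by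
  have h := one_le_sampleSize hN h0 h1 hβ hβ1
  linarith [Nat.ceil_lt_add_one (zero_le_one.trans h)]

variable {n : ℕ} {O : Oracles n} {w w' : Config n → ℝ}

theorem tapeLaw_mean_dev_le_of_bound (hZ : 0 < partition w)
    (hO : IsSamplingOracle (gibbs w) (O.sample .mu)) (hN : 1 ≤ N) (h0 : 0 < ε) (h1 : ε < 1)
    (hβ : 0 < β) (hβ1 : β ≤ 1) {η : ℝ} (hη : 0 ≤ η) {f : Config n → ℝ} {c a : ℝ}
    (hf : ∀ σ, |f σ - c| ≤ a) (ha : a * β ≤ 8 * N * η) :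
    O.tapeLaw {ω | ¬ |ω.mean (sampleErr N ε β) ⌈sampleSize N ε β⌉₊ f - ∑ σ, gibbs w σ * f σ| ≤
      ε * η / 2} ≤ ENNReal.ofReal (1 / 64) := by
  have hT := one_le_sampleSize hN h0 h1 hβ hβ1
  have hK : 0 < ⌈sampleSize N ε β⌉₊ := Nat.ceil_pos.2 (by linarith)
  have ha0 : 0 ≤ a := (abs_nonneg _).trans (hf fun _ => true)
  rcases hη.eq_or_lt with rfl | hη
  · have ha' : a = 0 := by nlinarith
    have hfc : ∀ σ, f σ = c := fun σ => by
      have := hf σ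
      rw [ha'] at this
      linarith [abs_nonpos_iff.1 this]
    have hK' : (⌈sampleSize N ε β⌉₊ : ℝ) ≠ 0 := by exact_mod_cast hK.ne'
    have : {ω : Tape n | ¬ |ω.mean (sampleErr N ε β) ⌈sampleSize N ε β⌉₊ f -
        ∑ σ, gibbs w σ * f σ| ≤ ε * 0 / 2} = ∅ := by
      ext ω
      simp [Tape.mean, hfc, ← Finset.sum_mul, sum_gibbs hZ, hK']
    rw [this]; simp
  · have haη : a ≤ 8 * N * η / β := by rw [le_div_iff₀ hβ]; exact ha
    have hε1 : ε * β ≤ 1 := mul_le_one₀ h1.le hβ.le hβ1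
    have key := tapeLaw_mean_dev_le hZ hO (sampleErr_mem hN h0 h1 hβ hβ1) hK hf
      (t := ε * η / 4) (by positivity) (by
        calc 2 * a * sampleErr N ε β ≤ 2 * (8 * N * η / β) * sampleErr N ε β := by
              have := (sampleErr_mem hN h0 h1 hβ hβ1).1
              gcongr
          _ = (ε * β) * (ε * η / 4) * (1 / (65536 * N)) := by unfold sampleErr; field_simp; norm_num
          _ ≤ 1 * (ε * η / 4) * 1 := by
              have : 1 / (65536 * N) ≤ 1 := by rw [div_le_one (by positivity)]; linarith
              gcongr
          _ = _ := by ring)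
    rw [show 2 * (ε * η / 4) = ε * η / 2 by ring] at key
    refine key.trans (ENNReal.ofReal_le_ofReal ?_)
    calc a ^ 2 / (⌈sampleSize N ε β⌉₊ * (ε * η / 4) ^ 2)
        ≤ (8 * N * η / β) ^ 2 / (sampleSize N ε β * (ε * η / 4) ^ 2) := by
          have := Nat.le_ceil (sampleSize N ε β)
          gcongr
      _ = 1 / 64 := by unfold sampleSize; field_simp; norm_num

open Classical in
/-- The normalized likelihood ratio, with value `1` outside of the support. -/
def normRatio (w w' : Config n → ℝ) (σ : Config n) : ℝ :=
  if w σ = 0 then 1 else w' σ / w σ * (partition w / partition w')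

theorem sum_gibbs_mul_deficit (hw : ∀ σ, 0 ≤ w σ) (hw' : ∀ σ, 0 ≤ w' σ) (hZ : 0 < partition w)
    (hZ' : 0 < partition w') :
    ∑ σ, gibbs w σ * deficit (normRatio w w' σ) = tvDist (gibbs w) (gibbs w') := by
  rw [tvDist_eq_sum_max (by rw [sum_gibbs hZ, sum_gibbs hZ'])]
  refine Finset.sum_congr rfl fun σ _ => ?_
  by_cases h : w σ = 0
  · have := gibbs_nonneg hw' σ
    simp [gibbs, h] at this ⊢
    linarith
  · have h1 : gibbs w' σ = gibbs w σ * normRatio w w' σ := by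
      simp only [gibbs, normRatio, h, if_false]
      have := hZ.ne'; field_simp
    rw [h1, deficit, mul_max_of_nonneg _ _ (gibbs_nonneg hw σ)]
    simp [mul_sub]

theorem sum_gibbs_mul_normRatio (hZ : 0 < partition w) (hZ' : 0 < partition w')
    (hs : ∀ σ, w σ = 0 → w' σ = 0) : ∑ σ, gibbs w σ * normRatio w w' σ = 1 := by
  rw [← sum_gibbs hZ']
  refine Finset.sum_congr rfl fun σ _ => ?_
  by_cases h : w σ = 0
  · simp [gibbs, h, hs σ h]
  · simp only [gibbs, normRatio, h, if_false]
    have := hZ.ne'; field_simp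

theorem mean_congr {ω : Tape n} {δ : ℝ} {K : ℕ} {f g : Config n → ℝ}
    (h : ∀ i < K, f (ω.sampleAt δ i) = g (ω.sampleAt δ i)) : ω.mean δ K f = ω.mean δ K g := by
  unfold Tape.mean
  rw [Finset.sum_congr rfl fun i hi => h i (Finset.mem_range.1 hi)]

theorem mean_const_mul {ω : Tape n} {δ : ℝ} {K : ℕ} (f : Config n → ℝ) (c : ℝ) :
    ω.mean δ K (fun σ => c * f σ) = c * ω.mean δ K f := by
  simp only [Tape.mean, ← Finset.mul_sum, mul_div_assoc]

theorem abs_mean_sub_le {ω : Tape n} {δ : ℝ} {K : ℕ} {f g h : Config n → ℝ}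
    (hfg : ∀ σ, |f σ - g σ| ≤ h σ) : |ω.mean δ K f - ω.mean δ K g| ≤ ω.mean δ K h := by
  unfold Tape.mean
  rw [← sub_div, abs_div, abs_of_nonneg (Nat.cast_nonneg K : (0 : ℝ) ≤ K), ← Finset.sum_sub_distrib]
  gcongr
  exact (Finset.abs_sum_le_sum_abs _ _).trans (Finset.sum_le_sum fun i _ => hfg _)

/-- The estimate from the first `K` samples, if `R` is the estimated ratio of the partition
functions. -/
def Tape.estimate (ω : Tape n) (δ : ℝ) (K : ℕ) (ρ : Config n → ℝ) (R : ℝ) : ℝ :=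
  ω.mean δ K fun σ => deficit (ρ σ / R)

theorem estimate_eq {ω : Tape n} {δ : ℝ} {K : ℕ} {ρ : Config n → ℝ} (hZ : 0 < partition w)
    (hZ' : 0 < partition w') (hρ : ∀ σ, w σ ≠ 0 → ρ σ = w' σ / w σ)
    (hω : ∀ i < K, w (ω.sampleAt δ i) ≠ 0) (q : ℝ) :
    ω.estimate δ K ρ (q * (partition w' / partition w)) =
      ω.mean δ K fun σ => deficit (normRatio w w' σ / q) := by
  refine mean_congr fun i hi => ?_
  rw [hρ _ (hω i hi), normRatio, if_neg (hω i hi)]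
  congr 1
  have := hZ.ne'
  have := hZ'.ne'
  field_simp

theorem tapeLaw_sample_support_le_of_bound (hZ : 0 < partition w)
    (hO : IsSamplingOracle (gibbs w) (O.sample .mu)) (hN : 1 ≤ N) (h0 : 0 < ε) (h1 : ε < 1)
    (hβ : 0 < β) (hβ1 : β ≤ 1) :
    O.tapeLaw {ω | ∃ i < ⌈sampleSize N ε β⌉₊, w (ω.sampleAt (sampleErr N ε β) i) = 0} ≤
      ENNReal.ofReal (1 / 32) := by
  have hδ := sampleErr_mem hN h0 h1 hβ hβ1
  refine (tapeLaw_sample_support_le hZ hO hδ _).trans (ENNReal.ofReal_le_ofReal ?_)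
  calc _ ≤ 2 * sampleSize N ε β * sampleErr N ε β := by
        have := ceil_sampleSize_le hN h0 h1 hβ hβ1
        have := hδ.1
        gcongr
    _ = 1 / 32 := by unfold sampleSize sampleErr; field_simp; norm_num

theorem tapeLaw_estimate_close_le {κ C₀ : ℝ} {ρ : Config n → ℝ} (hw : ∀ σ, 0 ≤ w σ)
    (hw' : ∀ σ, 0 ≤ w' σ) (hZ : 0 < partition w) (hZ' : 0 < partition w')
    (hO : IsSamplingOracle (gibbs w) (O.sample .mu))
    (hN : 1 ≤ N) (h0 : 0 < ε) (h1 : ε < 1) (hβ : 0 < β) (hβ1 : β ≤ 1)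
    (hρ : ∀ σ, w σ ≠ 0 → ρ σ = w' σ / w σ)
    (hs : ∀ σ, w σ = 0 → w' σ = 0) (hC : 0 < C₀) (hκ : κ ≤ 1 / 4)
    (hwκ : ∀ σ, w σ ≠ 0 → |w' σ / w σ / C₀ - 1| ≤ 2 * κ)
    (hη : κ * β ≤ N * tvDist (gibbs w) (gibbs w')) :
    O.tapeLaw {ω | ¬ |ω.estimate (sampleErr N ε β) ⌈sampleSize N ε β⌉₊ ρ
        (ω.mean (sampleErr N ε β) ⌈sampleSize N ε β⌉₊ ρ) - tvDist (gibbs w) (gibbs w')| ≤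
        ε * tvDist (gibbs w) (gibbs w')} ≤ 1 / 3 := by
  set η := tvDist (gibbs w) (gibbs w')
  have hη0 : 0 ≤ η := tvDist_nonneg _ _
  set f := normRatio w w' with hf
  set R := partition w' / partition w with hR
  have hRpos : 0 < R := by positivity
  have hκ0 : 0 ≤ κ := by
    obtain ⟨σ, _, hσ⟩ := Finset.exists_ne_zero_of_sum_ne_zero hZ.ne'
    linarith [(abs_nonneg _).trans (hwκ σ hσ)]
  have hRC : |R / C₀ - 1| ≤ 2 * κ := by
    have e1 : R / C₀ - 1 = ∑ σ, gibbs w σ * (if w σ = 0 then 0 else w' σ / w σ / C₀ - 1) := by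
      have e2 : R / C₀ - 1 = ∑ σ, (w' σ / (partition w * C₀) - gibbs w σ) := by
        rw [Finset.sum_sub_distrib, sum_gibbs hZ, ← Finset.sum_div, hR, div_div]; rfl
      rw [e2]
      refine Finset.sum_congr rfl fun σ _ => ?_
      split
      · simp [gibbs, *]
      · simp only [gibbs]; have := hZ.ne'; field_simp
    rw [e1]
    calc _ ≤ ∑ σ, gibbs w σ * (2 * κ) := (Finset.abs_sum_le_sum_abs _ _).trans
          (Finset.sum_le_sum fun σ _ => by
            rw [abs_mul, abs_of_nonneg (gibbs_nonneg hw σ)]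
            refine mul_le_mul_of_nonneg_left ?_ (gibbs_nonneg hw σ)
            split
            · simpa using hκ0
            · exact hwκ σ ‹_›)
      _ = 2 * κ := by rw [← Finset.sum_mul, sum_gibbs hZ, one_mul]
  have hfx : ∀ σ, w σ ≠ 0 → f σ * (R / C₀) = w' σ / w σ / C₀ := fun σ hσ => by
    simp only [hf, normRatio, hσ, if_false, hR]
    have := hZ.ne'; have := hZ'.ne'; field_simp
  have hRC2 : 1 / 2 ≤ R / C₀ := by have := (abs_le.1 hRC).1; linarith
  have hfκ : ∀ σ, |f σ - 1| ≤ 8 * κ := fun σ => by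
    by_cases hσ : w σ = 0
    · simp [hf, normRatio, hσ, hκ0]
    · have e1 := abs_le.1 (hwκ σ hσ)
      have e2 := abs_le.1 hRC
      rw [← hfx σ hσ] at e1
      rw [abs_le]
      constructor
      · by_contra hc; push Not at hc; nlinarith
      · by_contra hc; push Not at hc; nlinarith
  have hfpos : ∀ σ, 0 < f σ := fun σ => by
    by_cases hσ : w σ = 0
    · simp [hf, normRatio, hσ]
    · have e1 := abs_le.1 (hwκ σ hσ)
      rw [← hfx σ hσ] at e1
      exact pos_of_mul_pos_left (by linarith) (by linarith : 0 ≤ R / C₀)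
  have hdκ : ∀ σ, |deficit (f σ) - 0| ≤ 8 * κ := fun σ => by
    have e1 : deficit 1 = 0 := by simp [deficit]
    rw [← e1]
    exact (abs_deficit_sub_le _ _).trans (hfκ σ)
  have hb1 := tapeLaw_mean_dev_le_of_bound hZ hO hN h0 h1 hβ hβ1 hη0 hfκ (by linarith)
  have hb2 := tapeLaw_mean_dev_le_of_bound hZ hO hN h0 h1 hβ hβ1 hη0 hdκ (by linarith)
  have hb3 := tapeLaw_sample_support_le_of_bound (O := O) hZ hO hN h0 h1 hβ hβ1
  rw [sum_gibbs_mul_normRatio hZ hZ' hs] at hb1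
  rw [sum_gibbs_mul_deficit hw hw' hZ hZ'] at hb2
  set δ := sampleErr N ε β
  have hK : 0 < ⌈sampleSize N ε β⌉₊ :=
    Nat.ceil_pos.2 (by linarith [one_le_sampleSize hN h0 h1 hβ hβ1])
  set K := ⌈sampleSize N ε β⌉₊
  have hsub : {ω : Tape n | ¬ |ω.estimate δ K ρ (ω.mean δ K ρ) - η| ≤ ε * η} ⊆
      {ω | ∃ i < K, w (ω.sampleAt δ i) = 0} ∪ ({ω | ¬ |ω.mean δ K f - 1| ≤ ε * η / 2} ∪
        {ω | ¬ |ω.mean δ K (fun σ => deficit (f σ)) - η| ≤ ε * η / 2}) := by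
    intro ω hω
    by_contra hcon
    simp only [Set.mem_union, Set.mem_ofPred_eq, not_or, not_not, not_exists, not_and] at hcon
    obtain ⟨hg1, hg2, hg3⟩ := hcon
    apply hω
    have hq : ω.mean δ K ρ = ω.mean δ K f * R := by
      rw [mul_comm, ← mean_const_mul]
      refine mean_congr fun i hi => ?_
      have hσ := hg1 i hi
      rw [hρ _ hσ]
      simp only [hf, normRatio, hσ, if_false, hR]
      have := hZ.ne'; have := hZ'.ne'; field_simp
    rw [hq, estimate_eq hZ hZ' hρ hg1]
    set q := ω.mean δ K f with hqd
    have hqpos : 0 < q := div_pos (Finset.sum_pos (fun i _ => hfpos _) ⟨0, by simpa using hK⟩)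
      (by exact_mod_cast hK)
    have e3 : |ω.mean δ K (fun σ => deficit (f σ / q)) - ω.mean δ K (fun σ => deficit (f σ))| ≤
        |q - 1| := by
      refine (abs_mean_sub_le (h := fun σ => |1 / q - 1| * f σ) fun σ => ?_).trans ?_
      · refine (abs_deficit_sub_le _ _).trans (le_of_eq ?_)
        rw [← abs_of_pos (hfpos σ), ← abs_mul, abs_of_pos (hfpos σ)]
        congr 1; ring
      · rw [mean_const_mul, ← hqd]
        nth_rewrite 2 [← abs_of_pos hqpos]
        rw [← abs_mul, abs_sub_comm]
        refine le_of_eq (congrArg _ ?_)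
        field_simp
    calc _ ≤ _ := abs_sub_le _ (ω.mean δ K (fun σ => deficit (f σ))) _
      _ ≤ ε * η / 2 + ε * η / 2 := add_le_add (e3.trans hg2) hg3
      _ = _ := by ring
  refine (measure_mono hsub).trans ((measure_union_le _ _).trans
    ((add_le_add hb3 ((measure_union_le _ _).trans (add_le_add hb1 hb2))).trans ?_))
  rw [← ENNReal.ofReal_add (by norm_num) (by norm_num),
    ← ENNReal.ofReal_add (by norm_num) (by norm_num),
    show (1 / 3 : ENNReal) = ENNReal.ofReal (1 / 3) by
      rw [ENNReal.ofReal_div_of_pos (by norm_num)]; simp]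
  exact ENNReal.ofReal_le_ofReal (by norm_num)

theorem tapeLaw_estimate_far_le {ρ : Config n → ℝ} (hw : ∀ σ, 0 ≤ w σ)
    (hw' : ∀ σ, 0 ≤ w' σ) (hZ : 0 < partition w) (hZ' : 0 < partition w')
    (hO : IsSamplingOracle (gibbs w) (O.sample .mu))
    (hOc : IsCountingOracle (partition w) (O.count .mu))
    (hOc' : IsCountingOracle (partition w') (O.count .nu))
    (hN : 1 ≤ N) (h0 : 0 < ε) (h1 : ε < 1) (hβ : 0 < β) (hβ1 : β ≤ 1)
    (hρ : ∀ σ, w σ ≠ 0 → ρ σ = w' σ / w σ)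
    (hη : β ≤ 4 * (N * tvDist (gibbs w) (gibbs w'))) (i j : ℕ) :
    O.tapeLaw {ω | ¬ |ω.estimate (sampleErr N ε β) ⌈sampleSize N ε β⌉₊ ρ
        (ω.2.2 (j, .nu, countErr N ε β) / ω.2.2 (i, .mu, countErr N ε β)) -
        tvDist (gibbs w) (gibbs w')| ≤ ε * tvDist (gibbs w) (gibbs w')} ≤ 1 / 3 := by
  set η := tvDist (gibbs w) (gibbs w')
  have hη0 : 0 ≤ η := tvDist_nonneg _ _
  set f := normRatio w w' with hf
  set R := partition w' / partition w with hR
  have hRpos : 0 < R := by positivity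
  have hfpos : ∀ σ, 0 ≤ f σ := fun σ => by
    simp only [hf, normRatio]
    split
    · norm_num
    · have := hw σ; have := hw' σ; positivity
  have hdκ : ∀ σ, |deficit (f σ) - 0| ≤ 1 := fun σ => by
    rw [sub_zero, abs_of_nonneg (deficit_nonneg _)]
    exact max_le zero_le_one (by linarith [hfpos σ])
  have hδ' := countErr_mem hN h0 h1 hβ hβ1
  have hb1 := tapeLaw_count_fail_le O hOc hδ' i
  have hb1' := tapeLaw_count_fail_le O hOc' hδ' j
  have hb2 := tapeLaw_mean_dev_le_of_bound hZ hO hN h0 h1 hβ hβ1 hη0 hdκ (by nlinarith)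
  have hb3 := tapeLaw_sample_support_le_of_bound (O := O) hZ hO hN h0 h1 hβ hβ1
  rw [sum_gibbs_mul_deficit hw hw' hZ hZ'] at hb2
  have hδη : countErr N ε β ≤ ε * η / 16 := by
    rw [countErr, div_le_iff₀ (by positivity)]
    nlinarith
  have hη1 : countErr N ε β ≤ 1 / 64 := by
    rw [countErr, div_le_iff₀ (by positivity)]
    nlinarith [mul_le_one₀ h1.le hβ.le hβ1]
  set δ := sampleErr N ε β
  set δ' := countErr N ε β
  have hK : 0 < ⌈sampleSize N ε β⌉₊ :=
    Nat.ceil_pos.2 (by linarith [one_le_sampleSize hN h0 h1 hβ hβ1])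
  set K := ⌈sampleSize N ε β⌉₊
  have hsub : {ω : Tape n | ¬ |ω.estimate δ K ρ (ω.2.2 (j, .nu, δ') / ω.2.2 (i, .mu, δ')) - η| ≤
        ε * η} ⊆
      {ω | ∃ i < K, w (ω.sampleAt δ i) = 0} ∪
        ({ω | ¬ |ω.mean δ K (fun σ => deficit (f σ)) - η| ≤ ε * η / 2} ∪
        ({ω | ω.2.2 (i, .mu, δ') ∉ Set.Icc ((1 - δ') * partition w) ((1 + δ') * partition w)} ∪
        {ω | ω.2.2 (j, .nu, δ') ∉
          Set.Icc ((1 - δ') * partition w') ((1 + δ') * partition w')})) := by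
    intro ω hω
    by_contra hcon
    simp only [Set.mem_union, Set.mem_ofPred_eq, not_or, not_not, not_exists, not_and] at hcon
    obtain ⟨hg1, hg2, hg3, hg4⟩ := hcon
    apply hω
    set x := ω.2.2 (i, .mu, δ')
    set y := ω.2.2 (j, .nu, δ')
    have hx : 0 < x := lt_of_lt_of_le (mul_pos (by linarith) hZ) hg3.1
    have hy : 0 < y := lt_of_lt_of_le (mul_pos (by linarith) hZ') hg4.1
    set q := y / x / R with hq
    have hqpos : 0 < q := by positivity
    have hq' : q = (y / partition w') / (x / partition w) := by
      rw [hq, hR]; field_simp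
    have hx1 : 1 - δ' ≤ x / partition w := (le_div_iff₀ hZ).2 hg3.1
    have hx2 : x / partition w ≤ 1 + δ' := (div_le_iff₀ hZ).2 hg3.2
    have hy1 : 1 - δ' ≤ y / partition w' := (le_div_iff₀ hZ').2 hg4.1
    have hy2 : y / partition w' ≤ 1 + δ' := (div_le_iff₀ hZ').2 hg4.2
    have hxx : 0 < x / partition w := by positivity
    have hd0 := hδ'.1
    have e1 : q ≤ 1 + ε * η / 2 := by
      rw [hq', div_le_iff₀ hxx]
      nlinarith
    have e2 : 1 ≤ q * (1 + ε * η / 2) := by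
      rw [hq', div_mul_eq_mul_div, le_div_iff₀ hxx]
      nlinarith
    rw [show y / x = q * R by rw [hq]; field_simp, estimate_eq hZ hZ' hρ hg1]
    have e3 : |ω.mean δ K (fun σ => deficit (f σ / q)) - ω.mean δ K (fun σ => deficit (f σ))| ≤
        ε * η / 2 := by
      refine (abs_mean_sub_le (h := fun _ => ε * η / 2) fun σ =>
        abs_deficit_div_sub_le (hfpos σ) hqpos e1 e2).trans (le_of_eq ?_)
      have : (K : ℝ) ≠ 0 := by exact_mod_cast hK.ne'
      simp only [Tape.mean, Finset.sum_const, Finset.card_range, nsmul_eq_mul]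
      field_simp
    calc _ ≤ _ := abs_sub_le _ (ω.mean δ K (fun σ => deficit (f σ))) _
      _ ≤ ε * η / 2 + ε * η / 2 := add_le_add e3 hg2
      _ = _ := by ring
  refine (measure_mono hsub).trans ((measure_union_le _ _).trans
    ((add_le_add hb3 ((measure_union_le _ _).trans (add_le_add hb2
      ((measure_union_le _ _).trans (add_le_add hb1 hb1'))))).trans ?_))
  rw [← ENNReal.ofReal_add (by norm_num) (by norm_num),
    ← ENNReal.ofReal_add (by norm_num) (by norm_num),
    ← ENNReal.ofReal_add (by norm_num) (by norm_num),
    show (1 / 3 : ENNReal) = ENNReal.ofReal (1 / 3) by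
      rw [ENNReal.ofReal_div_of_pos (by norm_num)]; simp]
  exact ENNReal.ofReal_le_ofReal (by norm_num)

end

/-! ### Comparison of the conditional marginals of two distributions -/

theorem sum_eq_half_sum_update {n : ℕ} (v : Fin n) (h : Config n → ℝ) :
    ∑ σ, h σ = (1 / 2) * ∑ σ : Config n,
      (h (Function.update σ v true) + h (Function.update σ v false)) := by
  have hinv : Function.Involutive (fun σ : Config n => Function.update σ v (!σ v)) := fun σ => by
    simp
  have h1 : ∑ σ, h σ = ∑ σ : Config n, h (Function.update σ v (!σ v)) :=
    (Equiv.sum_comp hinv.toPerm h).symm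
  have h2 : ∀ σ : Config n, h (Function.update σ v true) + h (Function.update σ v false) =
      h σ + h (Function.update σ v (!σ v)) := fun σ => by
    have : Function.update σ v (σ v) = σ := Function.update_eq_self v σ
    cases hc : σ v <;> rw [hc] at this <;> simp [this, add_comm]
  simp only [h2, Finset.sum_add_distrib, ← h1]
  ring

/-- `p` is the conditional probability of `+` at `v` given the other spins. -/
structure IsCondProb {n : ℕ} (w : Config n → ℝ) (v : Fin n) (p : Config n → ℝ) : Prop where
  nonneg : ∀ σ, 0 ≤ p σ
  le_one : ∀ σ, p σ ≤ 1
  update : ∀ σ c, p (Function.update σ v c) = p σ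
  balance : ∀ σ, w (Function.update σ v true) * (1 - p σ) = w (Function.update σ v false) * p σ

theorem IsCondProb.sum_eq_zero {n : ℕ} {w : Config n → ℝ} {v : Fin n} {p : Config n → ℝ}
    (h : IsCondProb w v p) {g : Config n → ℝ} (hg : ∀ σ c, g (Function.update σ v c) = g σ) :
    ∑ σ, w σ * (g σ * ((if σ v = true then 1 else 0) - p σ)) = 0 := by
  rw [sum_eq_half_sum_update v]
  rw [Finset.sum_eq_zero, mul_zero]
  intro σ _
  simp only [Function.update_self, hg, h.update, if_true, Bool.false_eq_true, if_false]
  linear_combination g σ * h.balance σ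

theorem sum_gibbs_abs_sub_le {n : ℕ} {w w' : Config n → ℝ} {v : Fin n} {p p' : Config n → ℝ}
    (hZ : 0 < partition w) (hZ' : 0 < partition w') (h : IsCondProb w v p)
    (h' : IsCondProb w' v p') :
    ∑ σ, gibbs w' σ * |p' σ - p σ| ≤ 2 * tvDist (gibbs w) (gibbs w') := by
  classical
  set g : Config n → ℝ := fun σ => if p σ ≤ p' σ then 1 else -1 with hg
  have hgu : ∀ σ c, g (Function.update σ v c) = g σ := fun σ c => by
    simp only [hg, h.update, h'.update]
  have h1 : ∑ σ, gibbs w σ * (g σ * ((if σ v = true then 1 else 0) - p σ)) = 0 := by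
    have := h.sum_eq_zero hgu
    simp only [gibbs, div_mul_eq_mul_div, ← Finset.sum_div, this, zero_div]
  have h2 : ∑ σ, gibbs w' σ * (g σ * ((if σ v = true then 1 else 0) - p σ)) =
      ∑ σ, gibbs w' σ * |p' σ - p σ| := by
    have h3 : ∑ σ, gibbs w' σ * (g σ * ((if σ v = true then 1 else 0) - p' σ)) = 0 := by
      have := h'.sum_eq_zero hgu
      simp only [gibbs, div_mul_eq_mul_div, ← Finset.sum_div, this, zero_div]
    refine (sub_zero _).symm.trans ((congrArg _ h3.symm).trans ?_)
    rw [← Finset.sum_sub_distrib]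
    refine Finset.sum_congr rfl fun σ _ => ?_
    rw [← mul_sub, ← mul_sub]
    congr 1
    simp only [hg]
    split
    · rw [abs_of_nonneg (by linarith)]; ring
    · rw [abs_of_neg (by linarith)]; ring
  have h4 := abs_sum_sub_le_tvDist (p := gibbs w) (q := gibbs w') (c := 0) (a := 1)
    (f := fun σ => g σ * ((if σ v = true then 1 else 0) - p σ))
    (by rw [sum_gibbs hZ, sum_gibbs hZ'])
    (fun σ => by
      rw [sub_zero, abs_mul]
      have e1 : |g σ| = 1 := by simp only [hg]; split <;> simp
      have := h.nonneg σ
      have := h.le_one σ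
      rw [e1, one_mul, abs_le]
      split <;> constructor <;> linarith)
  rw [h1, h2, zero_sub, abs_neg] at h4
  linarith [le_abs_self (∑ σ, gibbs w' σ * |p' σ - p σ|)]

/-! ### The hardcore model -/

section Hardcore

variable {n : ℕ} {G : SimpleGraph (Fin n)} (lam : Fin n → ℝ≥0)

theorem hardcoreWeight_nonneg (σ : Config n) : 0 ≤ hardcoreWeight G lam σ := by
  unfold hardcoreWeight
  split
  · exact Finset.prod_nonneg fun v _ => by split <;> simp
  · exact le_rfl

theorem hardcoreWeight_empty : hardcoreWeight G lam (fun _ => false) = 1 := by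
  simp [hardcoreWeight, SimpleGraph.IsIndepSet]

theorem hardcore_partition_pos : 0 < partition (hardcoreWeight G lam) := by
  refine Finset.sum_pos' (fun σ _ => hardcoreWeight_nonneg lam σ) ⟨fun _ => false,
    Finset.mem_univ _, ?_⟩
  rw [hardcoreWeight_empty]; exact one_pos

theorem isIndepSet_iff (σ : Config n) :
    G.IsIndepSet {v | σ v = true} ↔ ∀ u v, G.Adj u v → σ u = true → σ v = true → False := by
  constructor
  · intro h u v huv hu hv
    exact h hu hv huv.ne huv
  · intro h u hu v hv _ huv
    exact h u v huv hu hv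

theorem hardcoreWeight_eq_zero {σ : Config n} {u v : Fin n} (huv : G.Adj u v) (hu : σ u = true)
    (hv : σ v = true) : hardcoreWeight G lam σ = 0 := by
  unfold hardcoreWeight
  rw [if_neg]
  rw [isIndepSet_iff]
  exact fun h => h u v huv hu hv

theorem hardcoreWeight_eq_zero_of_field {σ : Config n} {u : Fin n} (hu : σ u = true)
    (h : lam u = 0) : hardcoreWeight G lam σ = 0 := by
  unfold hardcoreWeight
  split
  · exact Finset.prod_eq_zero (Finset.mem_univ u) (by simp [hu, h])
  · rfl

theorem hardcoreWeight_update_true {σ : Config n} {v : Fin n}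
    (h : ∀ u, G.Adj v u → σ u = false) :
    hardcoreWeight G lam (Function.update σ v true) =
      lam v * hardcoreWeight G lam (Function.update σ v false) := by
  classical
  have h1 : G.IsIndepSet {u | Function.update σ v true u = true} ↔
      G.IsIndepSet {u | Function.update σ v false u = true} := by
    simp only [isIndepSet_iff]
    constructor
    · intro hi u x hux hu hx
      have huv : u ≠ v := by rintro rfl; simp at hu
      have hxv : x ≠ v := by rintro rfl; simp at hx
      exact hi u x hux (by simpa [huv] using hu) (by simpa [hxv] using hx)
    · intro hi u x hux hu hx
      by_cases huv : u = v
      · subst huv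
        have := h x hux
        simp [hux.ne', this] at hx
      · by_cases hxv : x = v
        · subst hxv
          have := h u hux.symm
          simp [huv, this] at hu
        · exact hi u x hux (by simpa [huv] using hu) (by simpa [hxv] using hx)
  unfold hardcoreWeight
  by_cases hi : G.IsIndepSet {u | Function.update σ v true u = true}
  · rw [if_pos hi, if_pos (h1.1 hi), ← Finset.mul_prod_erase _ _ (Finset.mem_univ v),
      ← Finset.mul_prod_erase _ _ (Finset.mem_univ v)]
    simp only [Function.update_self, if_true, Bool.false_eq_true, if_false, one_mul]
    congr 1
    refine Finset.prod_congr rfl fun u hu => ?_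
    have : u ≠ v := (Finset.mem_erase.1 hu).1
    simp [this]
  · rw [if_neg hi, if_neg (fun h2 => hi (h1.2 h2)), mul_zero]

open Classical in
/-- The conditional probability of `+` at `v`. -/
def hardcoreCond (G : SimpleGraph (Fin n)) (lam : Fin n → ℝ≥0) (v : Fin n) (σ : Config n) : ℝ :=
  if ∀ u, G.Adj v u → σ u = false then (lam v : ℝ) / (1 + lam v) else 0

theorem isCondProb_hardcore (v : Fin n) :
    IsCondProb (hardcoreWeight G lam) v (hardcoreCond G lam v) where
  nonneg σ := by unfold hardcoreCond; split <;> positivity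
  le_one σ := by
    unfold hardcoreCond; split
    · rw [div_le_one (by positivity)]; linarith
    · exact zero_le_one
  update σ c := by
    classical
    unfold hardcoreCond
    have : (∀ u, G.Adj v u → Function.update σ v c u = false) ↔
        ∀ u, G.Adj v u → σ u = false :=
      forall₂_congr fun u hu => by simp [hu.ne']
    exact if_congr this rfl rfl
  balance σ := by
    unfold hardcoreCond
    split
    · rename_i h
      rw [hardcoreWeight_update_true lam h]
      have : (1 : ℝ) + lam v ≠ 0 := by positivity
      field_simp
      ring
    · rename_i h
      push Not at h
      obtain ⟨u, hu, hσ⟩ := h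
      rw [hardcoreWeight_eq_zero lam hu (by simp) (by simpa [hu.ne'] using hσ)]
      simp

/-- The vertices in the closed neighbourhood of `v` with a positive field. -/
def IsFree (G : SimpleGraph (Fin n)) (lam : Fin n → ℝ≥0) (v u : Fin n) : Prop :=
  0 < lam u ∧ (u = v ∨ G.Adj v u)

open Classical in
/-- The partition function of the closed neighbourhood of `v`. -/
def localPartition (G : SimpleGraph (Fin n)) (lam : Fin n → ℝ≥0) (v : Fin n) : ℝ :=
  ∑ σ : Config n, if ∀ u, σ u = true → IsFree G lam v u then hardcoreWeight G lam σ else 0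

/-- The configuration with the single `+` at `v`. -/
def singleConfig (v : Fin n) : Config n := fun u => decide (u = v)

theorem hardcoreWeight_single (v : Fin n) : hardcoreWeight G lam (singleConfig v) = lam v := by
  classical
  unfold hardcoreWeight
  rw [if_pos]
  · rw [← Finset.mul_prod_erase _ _ (Finset.mem_univ v), Finset.prod_eq_one]
    · simp [singleConfig]
    · intro u hu
      simp [singleConfig, (Finset.mem_erase.1 hu).1]
  · rw [isIndepSet_iff]
    intro u x hux hu hx
    simp only [singleConfig, decide_eq_true_eq] at hu hx
    exact hux.ne (hu.trans hx.symm)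

theorem singleConfig_injective : Function.Injective (singleConfig (n := n)) := fun u v h => by
  have := congrFun h u
  simpa [singleConfig] using this

theorem one_le_localPartition (v : Fin n) : 1 ≤ localPartition G lam v := by
  classical
  unfold localPartition
  refine le_trans ?_ (Finset.single_le_sum (fun σ _ => ?_) (Finset.mem_univ (fun _ => false)))
  · simp [hardcoreWeight_empty]
  · split
    · exact hardcoreWeight_nonneg lam σ
    · exact le_rfl

open Classical in
theorem sum_free_le_localPartition (v : Fin n) :
    ∑ u with IsFree G lam v u, (lam u : ℝ) ≤ localPartition G lam v := by
  unfold localPartition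
  calc ∑ u with IsFree G lam v u, (lam u : ℝ) =
      ∑ σ ∈ (Finset.univ.filter (IsFree G lam v)).image singleConfig,
        (if ∀ u, σ u = true → IsFree G lam v u then hardcoreWeight G lam σ else 0) := by
        rw [Finset.sum_image fun _ _ _ _ h => singleConfig_injective h]
        refine Finset.sum_congr rfl fun u hu => ?_
        rw [hardcoreWeight_single, if_pos]
        intro x hx
        simp only [singleConfig, decide_eq_true_eq] at hx
        rw [hx]
        exact (Finset.mem_filter.1 hu).2
    _ ≤ _ := Finset.sum_le_univ_sum_of_nonneg fun σ => by
        split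
        · exact hardcoreWeight_nonneg lam σ
        · exact le_rfl

open Classical in
theorem localPartition_eq (v : Fin n) : localPartition G lam v =
    ∑ σ : Config n, if ∀ u, σ u = true → (u = v ∨ G.Adj v u) then hardcoreWeight G lam σ else 0 := by
  unfold localPartition
  refine Finset.sum_congr rfl fun σ _ => ?_
  by_cases h0 : ∃ u, σ u = true ∧ lam u = 0
  · obtain ⟨u, hu, h⟩ := h0
    simp [hardcoreWeight_eq_zero_of_field lam hu h]
  · push Not at h0
    congr 1
    refine propext (forall₂_congr fun u hu => ?_)
    simp [IsFree, pos_iff_ne_zero.2 (h0 u hu)]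

theorem prob_gibbs {w : Config n → ℝ} (A : Config n → Prop) :
    prob (gibbs w) A = prob w A / partition w := by
  classical
  unfold prob
  rw [Finset.sum_div]
  refine Finset.sum_congr rfl fun σ _ => ?_
  split
  · rfl
  · simp

theorem condMarginal_gibbs {w : Config n → ℝ} (hZ : 0 < partition w) (L : Finset (Fin n))
    (σ : Config n) (v : Fin n) (c : Bool) : condMarginal (gibbs w) L σ v c =
      prob w (fun τ => Extends L σ τ ∧ τ v = c) / prob w (Extends L σ) := by
  unfold condMarginal
  rw [prob_gibbs, prob_gibbs, div_div_div_cancel_right₀ hZ.ne']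

variable {lam} in
theorem le_div_localPartition {b : ℝ} (h : MarginallyBounded b (gibbs (hardcoreWeight G lam)))
    {v : Fin n} (hv : 0 < lam v) : b ≤ lam v / localPartition G lam v := by
  classical
  have hZ := hardcore_partition_pos (G := G) lam
  have hY : 0 < localPartition G lam v := one_pos.trans_le (one_le_localPartition lam v)
  set L : Finset (Fin n) := Finset.univ.filter fun u => ¬ (u = v ∨ G.Adj v u) with hL
  have hext : ∀ τ : Config n, Extends L (fun _ => false) τ ↔
      ∀ u, τ u = true → (u = v ∨ G.Adj v u) := fun τ => by
    simp only [Extends, hL, Finset.mem_filter, Finset.mem_univ, true_and]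
    refine forall_congr' fun u => ?_
    cases τ u <;> simp [or_iff_not_imp_left]
  have h1 : prob (hardcoreWeight G lam) (Extends L fun _ => false) = localPartition G lam v := by
    rw [localPartition_eq, prob]
    exact Finset.sum_congr rfl fun τ _ => by simp only [hext]
  have h2 : prob (hardcoreWeight G lam) (fun τ => Extends L (fun _ => false) τ ∧ τ v = true) =
      lam v := by
    rw [prob, Finset.sum_eq_single (singleConfig v)]
    · rw [if_pos, hardcoreWeight_single]
      rw [hext]
      refine ⟨fun u hu => ?_, by simp [singleConfig]⟩
      left; simpa [singleConfig] using hu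
    · intro τ _ hτ
      split
      · rename_i hh
        obtain ⟨h3, h4⟩ := hh
        rw [hext] at h3
        obtain ⟨u, hu⟩ : ∃ u, τ u ≠ singleConfig v u := by
          by_contra hc; push Not at hc; exact hτ (funext hc)
        have huv : u ≠ v := by
          rintro rfl; simp [singleConfig, h4] at hu
        have hτu : τ u = true := by simpa [singleConfig, huv] using hu
        exact hardcoreWeight_eq_zero lam ((h3 u hτu).resolve_left huv) h4 hτu
      · rfl
    · simp
  have h3 := h L (fun _ => false) (by rw [prob_gibbs, h1]; positivity) v true
  rw [condMarginal_gibbs hZ, h1, h2] at h3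
  exact h3 (by positivity)

/-- The conditional probabilities at `v` given all other spins. -/
theorem le_of_marginallyBounded {w : Config n → ℝ} {b : ℝ} (hZ : 0 < partition w)
    (h : MarginallyBounded b (gibbs w)) (σ : Config n) (v : Fin n) (c : Bool)
    (hw : ∀ σ, 0 ≤ w σ) (hc : 0 < w (Function.update σ v c)) :
    b ≤ w (Function.update σ v c) /
      (w (Function.update σ v true) + w (Function.update σ v false)) := by
  classical
  have hext : ∀ τ : Config n, Extends (Finset.univ.erase v) σ τ ↔
      ∃ c, τ = Function.update σ v c := fun τ => by
    constructor
    · intro h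
      refine ⟨τ v, funext fun u => ?_⟩
      by_cases huv : u = v
      · subst huv; simp
      · simp [huv, h u (by simp [huv])]
    · rintro ⟨c, rfl⟩ u hu
      simp [(Finset.mem_erase.1 hu).1]
  have hne : Function.update σ v true ≠ Function.update σ v false := fun h => by
    have := congrFun h v
    simp at this
  have h1 : prob w (Extends (Finset.univ.erase v) σ) =
      w (Function.update σ v true) + w (Function.update σ v false) := by
    rw [prob, ← Finset.sum_pair hne, ← Finset.sum_filter]
    refine Finset.sum_congr ?_ fun _ _ => rfl
    ext τ
    simp only [Finset.mem_filter, Finset.mem_univ, true_and, hext, Finset.mem_insert,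
      Finset.mem_singleton]
    constructor
    · rintro ⟨c, rfl⟩; cases c <;> simp
    · rintro (h | h)
      · exact ⟨_, h⟩
      · exact ⟨_, h⟩
  have h2 : prob w (fun τ => Extends (Finset.univ.erase v) σ τ ∧ τ v = c) =
      w (Function.update σ v c) := by
    rw [prob, Finset.sum_eq_single (Function.update σ v c)]
    · rw [if_pos]; exact ⟨(hext _).2 ⟨c, rfl⟩, by simp⟩
    · intro τ _ hτ
      rw [if_neg]
      rintro ⟨h3, h4⟩
      obtain ⟨c', rfl⟩ := (hext _).1 h3
      simp at h4
      exact hτ (by rw [h4])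
    · simp
  have hpos : 0 < w (Function.update σ v true) + w (Function.update σ v false) := by
    have := hw (Function.update σ v true)
    have := hw (Function.update σ v false)
    cases c <;> linarith
  have h3 := h (Finset.univ.erase v) σ (by rw [prob_gibbs, h1]; positivity) v c
  rw [condMarginal_gibbs hZ, h1, h2] at h3
  exact h3 (by positivity)

variable {lam} in
theorem le_one_div_one_add {b : ℝ} (h : MarginallyBounded b (gibbs (hardcoreWeight G lam)))
    (v : Fin n) : b ≤ 1 / (1 + lam v) := by
  have h0 : Function.update (fun _ : Fin n => false) v false = fun _ => false := by simp
  have h1 := le_of_marginallyBounded (hardcore_partition_pos (G := G) lam) h (fun _ => false) v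
    false (hardcoreWeight_nonneg lam) (by rw [h0, hardcoreWeight_empty]; exact one_pos)
  rw [hardcoreWeight_update_true lam (fun _ _ => rfl), h0, hardcoreWeight_empty] at h1
  simpa [add_comm] using h1

open Classical in
variable {lam} in
theorem card_free_le {b : ℝ} (hb : 0 < b)
    (h : MarginallyBounded b (gibbs (hardcoreWeight G lam))) {v : Fin n} (hv : 0 < lam v) :
    ((Finset.univ.filter (IsFree G lam v)).card : ℝ) ≤ 1 / b ^ 3 := by
  have hY : 0 < localPartition G lam v := one_pos.trans_le (one_le_localPartition lam v)
  have h1 : ∀ u ∈ Finset.univ.filter (IsFree G lam v), b ≤ (lam u : ℝ) := fun u hu =>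
    (le_div_localPartition h (Finset.mem_filter.1 hu).2.1).trans
      (div_le_self (by positivity) (one_le_localPartition lam u))
  have h2 := (Finset.card_nsmul_le_sum _ _ _ h1).trans (sum_free_le_localPartition lam v)
  have h3 : localPartition G lam v * b ≤ lam v := by
    have := le_div_localPartition h hv
    rwa [le_div_iff₀ hY, mul_comm] at this
  have h4 : lam v * b ≤ 1 := by
    have := le_one_div_one_add h v
    rw [le_div_iff₀ (by positivity)] at this
    nlinarith
  rw [nsmul_eq_mul] at h2
  rw [le_div_iff₀ (by positivity)]
  calc _ = ((Finset.univ.filter (IsFree G lam v)).card * b) * b * b := by ring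
    _ ≤ localPartition G lam v * b * b := by gcongr
    _ ≤ lam v * b := by gcongr
    _ ≤ 1 := h4

open Classical in
theorem div_localPartition_le_sum (v : Fin n) :
    (lam v : ℝ) / localPartition G lam v ≤
      ∑ σ, gibbs (hardcoreWeight G lam) σ * (if σ v = true then 1 else 0) := by
  have hZ := hardcore_partition_pos (G := G) lam
  have hY : 0 < localPartition G lam v := one_pos.trans_le (one_le_localPartition lam v)
  set w := hardcoreWeight G lam with hw
  have hw0 : ∀ σ, 0 ≤ w σ := hardcoreWeight_nonneg lam
  set C : Config n → ℝ := fun σ => if ∀ u, u = v ∨ G.Adj v u → σ u = false then w σ else 0 with hC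
  have hC0 : ∀ σ, 0 ≤ C σ := fun σ => by
    simp only [hC]; split
    · exact hw0 σ
    · exact le_rfl
  set A : Config n → ℝ := fun σ => if ∀ u, σ u = true → (u = v ∨ G.Adj v u) then w σ else 0
    with hA
  have hA0 : ∀ σ, 0 ≤ A σ := fun σ => by
    simp only [hA]; split
    · exact hw0 σ
    · exact le_rfl
  have hsplit : partition w ≤ localPartition G lam v * ∑ σ, C σ := by
    let i : Config n → Config n × Config n := fun σ =>
      (fun u => σ u && decide (u = v ∨ G.Adj v u), fun u => σ u && !decide (u = v ∨ G.Adj v u))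
    have hi : Function.Injective i := fun σ τ h => by
      funext u
      have e1 := congrFun (congrArg Prod.fst h) u
      have e2 := congrFun (congrArg Prod.snd h) u
      by_cases hu : u = v ∨ G.Adj v u
      · simpa [i, hu] using e1
      · simpa [i, hu] using e2
    have h1 : ∀ σ, w σ ≤ A (i σ).1 * C (i σ).2 := fun σ => by
      have e1 : A (i σ).1 = w (i σ).1 := by
        simp only [hA]; rw [if_pos]; intro u hu; simp [i] at hu; exact hu.2
      have e2 : C (i σ).2 = w (i σ).2 := by
        simp only [hC]; rw [if_pos]; intro u hu; simp [i, hu]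
      rw [e1, e2]
      by_cases hind : G.IsIndepSet {u | σ u = true}
      · have hind' := (isIndepSet_iff σ).1 hind
        have e3 : G.IsIndepSet {u | (i σ).1 u = true} := by
          rw [isIndepSet_iff]
          intro u x hux hu hx
          simp only [i, Bool.and_eq_true] at hu hx
          exact hind' u x hux hu.1 hx.1
        have e4 : G.IsIndepSet {u | (i σ).2 u = true} := by
          rw [isIndepSet_iff]
          intro u x hux hu hx
          simp only [i, Bool.and_eq_true] at hu hx
          exact hind' u x hux hu.1 hx.1
        simp only [hw, hardcoreWeight]
        rw [if_pos hind, if_pos e3, if_pos e4, ← Finset.prod_mul_distrib]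
        refine le_of_eq (Finset.prod_congr rfl fun u _ => ?_)
        by_cases hu : u = v ∨ G.Adj v u <;> cases hσ : σ u <;> simp [i, hu, hσ]
      · have : w σ = 0 := by simp only [hw, hardcoreWeight]; rw [if_neg hind]
        rw [this]
        exact mul_nonneg (hw0 _) (hw0 _)
    calc partition w ≤ ∑ σ, A (i σ).1 * C (i σ).2 := Finset.sum_le_sum fun σ _ => h1 σ
      _ = ∑ x ∈ (Finset.univ.image i : Finset (Config n × Config n)), A x.1 * C x.2 := by
          rw [Finset.sum_image fun _ _ _ _ h => hi h]
      _ ≤ ∑ x : Config n × Config n, A x.1 * C x.2 := Finset.sum_le_univ_sum_of_nonneg fun x => mul_nonneg (hA0 _) (hC0 _)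
      _ = _ := by rw [localPartition_eq, Finset.sum_mul_sum, ← Finset.sum_product']; rfl
  have hocc : lam v * ∑ σ, C σ ≤ ∑ σ, w σ * (if σ v = true then 1 else 0) := by
    rw [sum_eq_half_sum_update v C, sum_eq_half_sum_update v fun σ => w σ * _, mul_left_comm]
    refine mul_le_mul_of_nonneg_left ?_ (by norm_num)
    rw [Finset.mul_sum]
    refine Finset.sum_le_sum fun σ _ => ?_
    have e1 : C (Function.update σ v true) = 0 := by
      simp only [hC]; rw [if_neg]; intro hh; have := hh v (Or.inl rfl); simp at this
    simp only [e1, Function.update_self, if_true, Bool.false_eq_true, if_false, mul_one, mul_zero,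
      add_zero, zero_add]
    simp only [hC]
    split
    · rename_i hh
      refine le_of_eq (hardcoreWeight_update_true lam fun u hu => ?_).symm
      have := hh u (Or.inr hu)
      rwa [Function.update_of_ne hu.ne'] at this
    · rw [mul_zero]; exact hw0 _
  have hsum : ∑ σ, gibbs w σ * (if σ v = true then (1 : ℝ) else 0) =
      (∑ σ, w σ * (if σ v = true then 1 else 0)) / partition w := by
    simp only [gibbs, div_mul_eq_mul_div, ← Finset.sum_div]
  rw [hsum, div_le_div_iff₀ hY hZ]
  calc (lam v : ℝ) * partition w ≤ lam v * (localPartition G lam v * ∑ σ, C σ) := by gcongr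
    _ = (lam v * ∑ σ, C σ) * localPartition G lam v := by ring
    _ ≤ _ := by gcongr

open Classical in
theorem sum_occ_mul_le (lam lam' : Fin n → ℝ≥0) (v : Fin n) :
    (∑ σ, gibbs (hardcoreWeight G lam') σ * (if σ v = true then 1 else 0)) *
        |(lam' v : ℝ) / (1 + lam' v) - lam v / (1 + lam v)| ≤
      2 * tvDist (gibbs (hardcoreWeight G lam)) (gibbs (hardcoreWeight G lam')) := by
  refine le_trans ?_ (sum_gibbs_abs_sub_le (hardcore_partition_pos lam)
    (hardcore_partition_pos lam') (isCondProb_hardcore lam v) (isCondProb_hardcore lam' v))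
  rw [Finset.sum_mul]
  refine Finset.sum_le_sum fun σ _ => ?_
  by_cases h : hardcoreWeight G lam' σ = 0
  · simp [gibbs, h]
  · rw [mul_assoc]
    refine mul_le_mul_of_nonneg_left ?_ (gibbs_nonneg (hardcoreWeight_nonneg lam') σ)
    by_cases hv : σ v = true
    · have : ∀ u, G.Adj v u → σ u = false := fun u hu => by
        by_contra hc
        exact h (hardcoreWeight_eq_zero lam' hu hv (by simpa using hc))
      unfold hardcoreCond
      rw [if_pos this, if_pos this, if_pos hv, one_mul]
    · rw [if_neg hv, zero_mul]
      exact abs_nonneg _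

open Classical in
/-- The distance of two fields. -/
def fieldDist (x y : ℝ≥0) : ℝ := if x = 0 then (if y = 0 then 0 else 1) else |(y : ℝ) / x - 1|

theorem fieldDist_nonneg (x y : ℝ≥0) : 0 ≤ fieldDist x y := by
  unfold fieldDist; split
  · split <;> norm_num
  · exact abs_nonneg _

theorem fieldDist_mul_le {lam lam' : Fin n → ℝ≥0} {b : ℝ} (hb : 0 < b) (hb1 : b ≤ 1)
    (h : ∀ v, 0 < lam v → b ≤ lam v / localPartition G lam v)
    (h' : ∀ v, 0 < lam' v → b ≤ lam' v / localPartition G lam' v)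
    (h1 : ∀ v, b ≤ 1 / (1 + lam v)) (h1' : ∀ v, b ≤ 1 / (1 + lam' v)) (v : Fin n) :
    b ^ 4 * fieldDist (lam v) (lam' v) ≤
      2 * tvDist (gibbs (hardcoreWeight G lam)) (gibbs (hardcoreWeight G lam')) := by
  unfold fieldDist
  split
  · rename_i h0
    split
    · simp only [mul_zero]
      have := tvDist_nonneg (gibbs (hardcoreWeight G lam)) (gibbs (hardcoreWeight G lam'))
      linarith
    · rename_i h0'
      have hpos : 0 < lam' v := pos_iff_ne_zero.2 h0'
      refine le_trans ?_ (sum_occ_mul_le lam lam' v)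
      have e1 := (h' v hpos).trans (div_localPartition_le_sum lam' v)
      have e2 : b ≤ lam' v :=
        (h' v hpos).trans (div_le_self (by positivity) (one_le_localPartition lam' v))
      have e3 := h1' v
      have e4 : (lam' v : ℝ) / (1 + lam' v) = lam' v * (1 / (1 + lam' v)) := by ring
      rw [h0]
      simp only [NNReal.coe_zero, zero_div, sub_zero]
      rw [e4, abs_of_nonneg (by positivity)]
      calc b ^ 4 * 1 ≤ b ^ 3 * 1 := by
            gcongr ?_ * 1; exact pow_le_pow_of_le_one hb.le hb1 (by norm_num)
        _ = b * (b * b) := by ring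
        _ ≤ _ := mul_le_mul e1 (by gcongr) (by positivity) (hb.le.trans e1)
  · rename_i h0
    have hpos : 0 < lam v := pos_iff_ne_zero.2 h0
    rw [tvDist_comm]
    refine le_trans ?_ (sum_occ_mul_le lam' lam v)
    have e1 := (h v hpos).trans (div_localPartition_le_sum lam v)
    have e2 : b ≤ lam v :=
      (h v hpos).trans (div_le_self (by positivity) (one_le_localPartition lam v))
    have e3 := h1 v
    have e3' := h1' v
    have hpos' : (0 : ℝ) < lam v := hpos
    have e4 : (lam v : ℝ) / (1 + lam v) - lam' v / (1 + lam' v) =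
        -(lam v * (1 / (1 + lam v)) * (1 / (1 + lam' v)) * (lam' v / lam v - 1)) := by
      have : (1 : ℝ) + lam v ≠ 0 := by positivity
      have : (1 : ℝ) + lam' v ≠ 0 := by positivity
      field_simp
      ring
    rw [e4, abs_neg, abs_mul, abs_of_nonneg (a := _ * (1 / (1 + (lam' v : ℝ)))) (by positivity),
      ← mul_assoc]
    gcongr
    calc b ^ 4 = b * (b * b * b) := by ring
      _ ≤ _ := mul_le_mul e1 (by gcongr) (by positivity) (hb.le.trans e1)

end Hardcore

section

variable {n : ℕ} {G : SimpleGraph (Fin n)} {lam lam' : Fin n → ℝ≥0}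

theorem hardcore_ratio_eq {σ : Config n} (h : hardcoreWeight G lam σ ≠ 0) :
    ∏ v, (if σ v = true then (lam' v : ℝ) / lam v else 1) =
      hardcoreWeight G lam' σ / hardcoreWeight G lam σ := by
  unfold hardcoreWeight at h ⊢
  split at h
  · rename_i hi
    rw [if_pos hi, if_pos hi, ← Finset.prod_div_distrib]
    refine Finset.prod_congr rfl fun v _ => ?_
    split <;> simp
  · simp at h

theorem hardcore_ratio_close {κ : ℝ} (hκ : ∑ v, fieldDist (lam v) (lam' v) = κ) (h4 : κ ≤ 1 / 4) :
    (∀ σ, hardcoreWeight G lam σ = 0 → hardcoreWeight G lam' σ = 0) ∧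
      ∀ σ, hardcoreWeight G lam σ ≠ 0 →
        |hardcoreWeight G lam' σ / hardcoreWeight G lam σ / 1 - 1| ≤ 2 * κ := by
  have hle : ∀ v, fieldDist (lam v) (lam' v) ≤ 1 / 4 := fun v =>
    (Finset.single_le_sum (fun v _ => fieldDist_nonneg _ _) (Finset.mem_univ v)).trans
      (hκ.le.trans h4)
  have hz : ∀ v, lam v = 0 → lam' v = 0 := fun v hv => by
    have := hle v
    by_contra hc
    rw [fieldDist, if_pos hv, if_neg hc] at this
    norm_num at this
  refine ⟨fun σ hσ => ?_, fun σ hσ => ?_⟩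
  · unfold hardcoreWeight at hσ ⊢
    split at hσ
    · rename_i hi
      rw [if_pos hi]
      obtain ⟨v, _, hv⟩ := Finset.prod_eq_zero_iff.1 hσ
      refine Finset.prod_eq_zero (Finset.mem_univ v) ?_
      split at hv
      · rename_i h1
        rw [if_pos h1, hz v (by exact_mod_cast hv)]; rfl
      · simp at hv
    · rename_i hi
      rw [if_neg hi]
  · rw [div_one, ← hardcore_ratio_eq hσ]
    have hpos : ∀ v, σ v = true → lam v ≠ 0 := fun v hv h0 =>
      hσ (hardcoreWeight_eq_zero_of_field lam hv h0)
    have h1 := Finset.norm_prod_one_add_sub_one_le Finset.univ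
      (fun v => (if σ v = true then (lam' v : ℝ) / lam v else 1) - 1)
    simp only [add_sub_cancel, Real.norm_eq_abs] at h1
    have h2 : ∑ v, |(if σ v = true then (lam' v : ℝ) / lam v else 1) - 1| ≤ κ := by
      rw [← hκ]
      refine Finset.sum_le_sum fun v _ => ?_
      split
      · rename_i hv
        rw [fieldDist, if_neg (hpos v hv)]
      · simpa using fieldDist_nonneg _ _
    have h0 : 0 ≤ κ := (Finset.sum_nonneg fun v _ => abs_nonneg _).trans h2
    refine h1.trans ((sub_le_sub_right (Real.exp_le_exp.2 h2) 1).trans ?_)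
    have := Real.abs_exp_sub_one_le (x := κ) (by rw [abs_of_nonneg h0]; linarith)
    rw [abs_of_nonneg h0] at this
    exact (le_abs_self _).trans this

end

/-! ### The edge list -/

section Edges

variable {n : ℕ} (G : SimpleGraph (Fin n))

open Classical in
theorem nodup_edgeList : (edgeList G).Nodup :=
  ((List.nodup_finRange n).product (List.nodup_finRange n)).filter _

theorem mem_edgeList {p : Fin n × Fin n} : p ∈ edgeList G ↔ p.1 < p.2 ∧ G.Adj p.1 p.2 := by
  obtain ⟨u, v⟩ := p
  simp [edgeList]

theorem length_edgeList : (edgeList G).length = numEdges G := by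
  classical
  have h : G.edgeSet = (fun p : Fin n × Fin n => s(p.1, p.2)) '' ↑(edgeList G).toFinset := by
    ext e
    induction e using Sym2.ind with
    | _ u v =>
      simp only [SimpleGraph.mem_edgeSet, Set.mem_image, Finset.mem_coe, List.mem_toFinset,
        mem_edgeList]
      constructor
      · intro h
        rcases lt_or_gt_of_ne h.ne with h1 | h1
        · exact ⟨(u, v), ⟨h1, h⟩, rfl⟩
        · exact ⟨(v, u), ⟨h1, h.symm⟩, Sym2.eq_swap⟩
      · rintro ⟨⟨a, b⟩, ⟨_, h2⟩, h3⟩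
        rcases Sym2.eq_iff.1 h3 with ⟨rfl, rfl⟩ | ⟨rfl, rfl⟩
        · exact h2
        · exact h2.symm
  rw [numEdges, h, Set.InjOn.ncard_image, Set.ncard_coe_finset,
    List.toFinset_card_of_nodup (nodup_edgeList G)]
  rintro ⟨a, b⟩ h1 ⟨c, d⟩ h2 h3
  simp only [Finset.mem_coe, List.mem_toFinset, mem_edgeList] at h1 h2
  rcases Sym2.eq_iff.1 h3 with ⟨h4, h5⟩ | ⟨h4, h5⟩
  · exact Prod.ext h4 h5
  · simp only at h4 h5
    rw [h4, h5] at h1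
    exact absurd (h1.1.trans h2.1) (lt_irrefl _)

open Classical in
theorem sum_edgeList (F : Fin n → Fin n → ℝ) :
    ((edgeList G).map fun p => F p.1 p.2).sum =
      ∑ u, ∑ v, if u < v ∧ G.Adj u v then F u v else 0 := by
  rw [← List.sum_toFinset _ (nodup_edgeList G), ← Finset.sum_product', ← Finset.sum_filter]
  refine Finset.sum_congr ?_ fun _ _ => rfl
  ext p
  simp [mem_edgeList]

theorem sum_edgeList_symm {F : Fin n → Fin n → ℝ} (hs : ∀ u v, F u v = F v u)
    (h0 : ∀ u v, ¬ G.Adj u v → F u v = 0) :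
    ((edgeList G).map fun p => F p.1 p.2).sum = (1 / 2) * ∑ u, ∑ v, F u v := by
  classical
  rw [sum_edgeList]
  have h1 : ∑ u, ∑ v, (if u < v ∧ G.Adj u v then F u v else 0) =
      ∑ u, ∑ v, (if v < u ∧ G.Adj u v then F u v else 0) := by
    rw [Finset.sum_comm]
    refine Finset.sum_congr rfl fun u _ => Finset.sum_congr rfl fun v _ => ?_
    simp only [G.adj_comm v u, hs v u]
  have h2 : ∑ u, ∑ v, F u v = ∑ u, ∑ v, (if u < v ∧ G.Adj u v then F u v else 0) +
      ∑ u, ∑ v, (if v < u ∧ G.Adj u v then F u v else 0) := by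
    simp only [← Finset.sum_add_distrib]
    refine Finset.sum_congr rfl fun u _ => Finset.sum_congr rfl fun v _ => ?_
    by_cases h : G.Adj u v
    · rcases lt_or_gt_of_ne h.ne with h3 | h3
      · simp [h, h3, h3.not_gt]
      · simp [h, h3, h3.not_gt]
    · simp [h, h0 u v h]
  rw [h2, ← h1]
  ring

/-- The sum over the edges at `w` is a sum over the neighbours. -/
theorem sum_edgeList_at {F : Fin n → Fin n → ℝ} (h0 : ∀ u v, ¬ G.Adj u v → F u v = 0)
    (w : Fin n) :
    ((edgeList G).map fun p => if p.1 = w then F w p.2 else if p.2 = w then F w p.1 else 0).sum =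
      ∑ u, F w u := by
  classical
  rw [sum_edgeList G (fun a b => if a = w then F w b else if b = w then F w a else 0)]
  have h1 : ∀ u v, (if u < v ∧ G.Adj u v then
      (if u = w then F w v else if v = w then F w u else 0) else 0) =
      (if u = w then (if w < v then F w v else 0) else 0) +
      (if v = w then (if u < w then F w u else 0) else 0) := fun u v => by
    by_cases hu : u = w
    · subst hu
      by_cases hv : v = u
      · subst hv; simp
      · by_cases hA : G.Adj u v
        · simp [hv, hA]
        · simp [hv, hA, h0 u v hA]
    · by_cases hv : v = w
      · subst hv
        by_cases hA : G.Adj u v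
        · simp [hu, hA]
        · simp [hu, hA, h0 v u fun h => hA h.symm]
      · simp [hu, hv]
  simp only [h1, Finset.sum_add_distrib]
  rw [Finset.sum_comm (f := fun u v => if u = w then (if w < v then F w v else 0) else 0)]
  simp only [Finset.sum_ite_eq', Finset.mem_univ, if_true]
  rw [← Finset.sum_add_distrib]
  refine Finset.sum_congr rfl fun u _ => ?_
  rcases lt_trichotomy u w with h | h | h
  · simp [h, h.not_gt]
  · subst h; simp [h0 u u (G.loopless.irrefl u)]
  · simp [h, h.not_gt]

open Classical in
theorem sum_adj_eq : ∑ u, ∑ v, (if G.Adj u v then (1 : ℝ) else 0) = 2 * numEdges G := by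
  have h := sum_edgeList_symm G (F := fun u v => if G.Adj u v then (1 : ℝ) else 0)
    (fun u v => by simp only [G.adj_comm]) (fun u v h => if_neg h)
  have h2 : ((edgeList G).map fun p => if G.Adj p.1 p.2 then (1 : ℝ) else 0).sum = numEdges G := by
    rw [← length_edgeList, List.map_congr_left (g := fun _ => (1 : ℝ))]
    · simp
    · intro p hp
      rw [if_pos ((mem_edgeList G).1 hp).2]
  rw [h2] at h
  linarith

end Edges

/-! ### The logistic function -/

/-- The probability of `+` in the field `x`. -/
def logistic (x : ℝ) : ℝ := Real.exp (2 * x) / (1 + Real.exp (2 * x))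

theorem logistic_bounds {β x L : ℝ} (hβL : β ≤ Real.exp (-2 * L)) (hβ1 : β ≤ 1)
    (hx : |x| ≤ L) : β / 2 ≤ logistic x ∧ β / 2 ≤ 1 - logistic x := by
  have h1 := abs_le.1 hx
  have hE : 0 < Real.exp (2 * x) := Real.exp_pos _
  have h2 : β ≤ Real.exp (2 * x) := hβL.trans (Real.exp_le_exp.2 (by linarith))
  have h3 : β * Real.exp (2 * x) ≤ 1 := by
    calc β * Real.exp (2 * x) ≤ Real.exp (-2 * L) * Real.exp (2 * x) := by gcongr
      _ = Real.exp (-2 * L + 2 * x) := (Real.exp_add _ _).symm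
      _ ≤ 1 := Real.exp_le_one_iff.2 (by linarith)
  have h4 : 1 - logistic x = 1 / (1 + Real.exp (2 * x)) := by
    unfold logistic; field_simp; ring
  rw [h4, logistic, le_div_iff₀ (by positivity), le_div_iff₀ (by positivity)]
  constructor
  · nlinarith
  · nlinarith

theorem logistic_sub_le {β x y L : ℝ} (hβ : 0 < β) (hβL : β ≤ Real.exp (-2 * L))
    (hx : |x| ≤ L) (hy : |y| ≤ L) : β ^ 3 / 2 * |x - y| ≤ |logistic x - logistic y| := by
  wlog hxy : y ≤ x generalizing x y
  · rw [abs_sub_comm x, abs_sub_comm (logistic x)]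
    exact this hy hx (le_of_not_ge hxy)
  have hE : ∀ z, |z| ≤ L → β ≤ Real.exp (2 * z) ∧ β * (1 + Real.exp (2 * z)) ≤ 2 := fun z hz => by
    have h1 := abs_le.1 hz
    have hL : 0 ≤ L := (abs_nonneg _).trans hz
    have h0 : Real.exp (-2 * L) ≤ 1 := Real.exp_le_one_iff.2 (by linarith)
    refine ⟨hβL.trans (Real.exp_le_exp.2 (by linarith)), ?_⟩
    have : β * Real.exp (2 * z) ≤ 1 := by
      calc β * Real.exp (2 * z) ≤ Real.exp (-2 * L) * Real.exp (2 * z) := by gcongr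
        _ = Real.exp (-2 * L + 2 * z) := (Real.exp_add _ _).symm
        _ ≤ 1 := Real.exp_le_one_iff.2 (by linarith)
    linarith
  obtain ⟨hx1, hx2⟩ := hE x hx
  obtain ⟨hy1, hy2⟩ := hE y hy
  have hX : 0 < Real.exp (2 * x) := Real.exp_pos _
  have hY : 0 < Real.exp (2 * y) := Real.exp_pos _
  have h5 : Real.exp (2 * y) * (2 * (x - y)) ≤ Real.exp (2 * x) - Real.exp (2 * y) := by
    have h6 := Real.add_one_le_exp (2 * (x - y))
    have h7 : Real.exp (2 * x) = Real.exp (2 * y) * Real.exp (2 * (x - y)) := by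
      rw [← Real.exp_add]; ring_nf
    rw [h7]; nlinarith
  have h8 : logistic x - logistic y = (Real.exp (2 * x) - Real.exp (2 * y)) /
      ((1 + Real.exp (2 * x)) * (1 + Real.exp (2 * y))) := by
    unfold logistic; field_simp; ring
  have h9 : 0 ≤ x - y := by linarith
  have h10 : β * (2 * (x - y)) ≤ Real.exp (2 * x) - Real.exp (2 * y) :=
    le_trans (by gcongr) h5
  rw [abs_of_nonneg h9, h8, abs_of_nonneg (div_nonneg
    (le_trans (by positivity) h10) (by positivity)), le_div_iff₀ (by positivity)]
  have h11 : (β * (1 + Real.exp (2 * x))) * (β * (1 + Real.exp (2 * y))) ≤ 2 * 2 :=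
    mul_le_mul hx2 hy2 (by positivity) (by norm_num)
  calc _ = ((β * (1 + Real.exp (2 * x))) * (β * (1 + Real.exp (2 * y)))) *
        (β * (x - y) / 2) := by ring
    _ ≤ 2 * 2 * (β * (x - y) / 2) := by gcongr
    _ = β * (2 * (x - y)) := by ring
    _ ≤ _ := h10

/-! ### Ising models -/

section Ising

variable {n : ℕ} {G : SimpleGraph (Fin n)}

namespace IsingModel

variable (I : IsingModel G)

/-- The marks of the fields. -/
def mark (v : Fin n) : ℕ := fieldMark (I.h v)

/-- The finite fields. -/
def field (v : Fin n) : ℝ := (I.h v).toReal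

/-- The spin of a pinned vertex, and `0` for other vertices. -/
def pinSign (v : Fin n) : ℝ := if I.mark v = 1 then 1 else if I.mark v = 2 then -1 else 0

/-- The indicator of the vertices that are not pinned. -/
def freeInd (v : Fin n) : ℝ := if I.mark v = 0 then 1 else 0

/-- The field at `v` together with the influence of the pinned vertices. -/
def effField (v : Fin n) : ℝ := I.field v + ∑ u, I.J v u * I.pinSign u

/-- The maximal strength of the local field at a vertex that is not pinned. -/
def strength (v : Fin n) : ℝ := I.freeInd v * (|I.effField v| + ∑ u, |I.J v u| * I.freeInd u)

/-- Compatibility with the pinned vertices. -/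
def Compat (σ : Config n) : Prop := ∀ v, (I.mark v = 1 → σ v = true) ∧ (I.mark v = 2 → σ v = false)

def energy (σ : Config n) : ℝ :=
  (1 / 2) * ∑ u, ∑ v, I.J u v * spin (σ u) * spin (σ v) + ∑ v, spin (σ v) * I.field v

def localField (v : Fin n) (σ : Config n) : ℝ := I.field v + ∑ u, I.J v u * spin (σ u)

theorem mark_cases (v : Fin n) : I.mark v = 0 ∨ I.mark v = 1 ∨ I.mark v = 2 := by
  unfold mark fieldMark; split
  · simp
  · split <;> simp

theorem mark_eq_one (v : Fin n) : I.mark v = 1 ↔ I.h v = ⊤ := by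
  unfold mark fieldMark; split
  · simp [*]
  · split <;> simp [*]

theorem mark_eq_two (v : Fin n) : I.mark v = 2 ↔ I.h v = ⊥ := by
  unfold mark fieldMark; split
  · simp [*]
  · split <;> simp [*]

open Classical in
theorem weight_eq (σ : Config n) :
    isingWeight I σ = if I.Compat σ then Real.exp (I.energy σ) else 0 := by
  unfold isingWeight
  refine if_congr ?_ rfl rfl
  simp only [Compat, mark_eq_one, mark_eq_two]

theorem weight_nonneg (σ : Config n) : 0 ≤ isingWeight I σ := by
  classical
  rw [weight_eq]; split
  · exact (Real.exp_pos _).le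
  · exact le_rfl

variable {I} in
theorem weight_pos {σ : Config n} (h : I.Compat σ) : 0 < isingWeight I σ := by
  classical
  rw [weight_eq, if_pos h]; exact Real.exp_pos _

variable {I} in
theorem weight_ne_zero {σ : Config n} (h : isingWeight I σ ≠ 0) : I.Compat σ := by
  classical
  by_contra hc
  exact h (by rw [weight_eq, if_neg hc])

theorem partition_pos : 0 < partition (isingWeight I) := by
  refine Finset.sum_pos' (fun σ _ => I.weight_nonneg σ) ⟨fun v => decide (I.mark v = 1),
    Finset.mem_univ _, weight_pos fun v => ⟨fun h => by simp [h], fun h => by simp [h]⟩⟩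

theorem J_self (v : Fin n) : I.J v v = 0 := by
  by_contra h
  exact G.loopless.irrefl v (I.supp v v h)

theorem J_comm (u v : Fin n) : I.J u v = I.J v u := by
  rw [← I.symm.apply u v]

theorem abs_spin (c : Bool) : |spin c| = 1 := by cases c <;> simp [spin]

variable {I} in
theorem spin_eq {σ : Config n} (h : I.Compat σ) (u : Fin n) :
    spin (σ u) = I.pinSign u + I.freeInd u * spin (σ u) := by
  unfold pinSign freeInd
  rcases I.mark_cases u with h0 | h0 | h0
  · simp [h0]
  · simp [h0, (h u).1 h0, spin]
  · simp [h0, (h u).2 h0, spin]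

theorem freeInd_nonneg (v : Fin n) : 0 ≤ I.freeInd v := by unfold freeInd; split <;> norm_num

theorem energy_update (σ : Config n) (v : Fin n) :
    I.energy (Function.update σ v true) = I.energy (Function.update σ v false) +
      2 * I.localField v σ := by
  classical
  have key : ∀ c, I.energy (Function.update σ v c) =
      ((1 / 2) * ∑ u, ∑ x, I.J u x * (if u = v then 0 else spin (σ u)) *
        (if x = v then 0 else spin (σ x)) + ∑ u, (if u = v then 0 else spin (σ u)) * I.field u) +
      spin c * I.localField v σ := by
    intro c
    have hs : ∀ u, spin (Function.update σ v c u) =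
        (if u = v then 0 else spin (σ u)) + spin c * (if u = v then 1 else 0) := fun u => by
      by_cases hu : u = v
      · subst hu; simp
      · simp [hu]
    have h1 : ∑ u, I.J v u * spin (σ u) = ∑ u, I.J v u * (if u = v then 0 else spin (σ u)) := by
      refine Finset.sum_congr rfl fun u _ => ?_
      by_cases hu : u = v
      · subst hu; simp [I.J_self]
      · simp [hu]
    set a : Fin n → ℝ := fun u => if u = v then 0 else spin (σ u) with ha
    have h2 : ∑ u, ∑ x, I.J u x * spin (Function.update σ v c u) *
        spin (Function.update σ v c x) = ∑ u, ∑ x, I.J u x * a u * a x +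
          2 * spin c * ∑ u, I.J v u * a u := by
      have e1 : ∀ u x, I.J u x * spin (Function.update σ v c u) * spin (Function.update σ v c x) =
          I.J u x * a u * a x + spin c * (if x = v then I.J v u * a u else 0) +
          spin c * (if u = v then I.J v x * a x else 0) := fun u x => by
        rw [hs, hs]
        by_cases hu : u = v
        · subst hu
          by_cases hx : x = u
          · subst hx; simp [I.J_self]
          · simp [hx, ha]; ring
        · by_cases hx : x = v
          · subst hx; simp [hu, ha, I.J_comm u x]; ring
          · simp [hu, hx, ha]
      simp only [e1, Finset.sum_add_distrib, ← Finset.mul_sum]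
      rw [Finset.sum_comm (f := fun u x => if u = v then I.J v x * a x else 0)]
      simp only [Finset.sum_ite_eq', Finset.mem_univ, if_true]
      ring
    have h3 : ∑ u, spin (Function.update σ v c u) * I.field u =
        ∑ u, a u * I.field u + spin c * I.field v := by
      have e1 : ∀ u, spin (Function.update σ v c u) * I.field u =
          a u * I.field u + spin c * (if u = v then I.field v else 0) := fun u => by
        rw [hs]
        by_cases hu : u = v
        · subst hu; simp [ha]
        · simp [hu, ha]
      simp only [e1, Finset.sum_add_distrib, ← Finset.mul_sum, Finset.sum_ite_eq',
        Finset.mem_univ, if_true]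
    rw [energy, h2, h3, localField, h1]
    ring
  rw [key true, key false]
  simp [spin]; ring

theorem localField_update (σ : Config n) (v : Fin n) (c : Bool) :
    I.localField v (Function.update σ v c) = I.localField v σ := by
  unfold localField
  congr 1
  refine Finset.sum_congr rfl fun u _ => ?_
  by_cases hu : u = v
  · subst hu; simp [I.J_self]
  · simp [hu]

variable {I} in
theorem compat_update {v : Fin n} (hv : I.mark v = 0) (σ : Config n) (c : Bool) :
    I.Compat (Function.update σ v c) ↔ I.Compat σ := by
  refine forall_congr' fun u => ?_
  by_cases hu : u = v
  · subst hu; simp [hv]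
  · simp [hu]

variable {I} in
theorem weight_update {v : Fin n} (hv : I.mark v = 0) (σ : Config n) :
    isingWeight I (Function.update σ v true) =
      Real.exp (2 * I.localField v σ) * isingWeight I (Function.update σ v false) := by
  classical
  simp only [weight_eq, compat_update hv]
  split
  · rw [energy_update, Real.exp_add, mul_comm]
  · simp

variable {I} in
theorem isCondProb {v : Fin n} (hv : I.mark v = 0) :
    IsCondProb (isingWeight I) v (fun σ => logistic (I.localField v σ)) where
  nonneg σ := by unfold logistic; positivity
  le_one σ := by
    unfold logistic
    rw [div_le_one (by positivity)]; linarith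
  update σ c := by simp only [localField_update]
  balance σ := by
    rw [weight_update hv]
    unfold logistic
    field_simp
    ring

variable {I} in
theorem localField_eq {σ : Config n} (h : I.Compat σ) (v : Fin n) :
    I.localField v σ = I.effField v + ∑ u, I.J v u * (I.freeInd u * spin (σ u)) := by
  rw [localField, effField, add_assoc, ← Finset.sum_add_distrib]
  congr 1
  refine Finset.sum_congr rfl fun u _ => ?_
  rw [← mul_add, ← spin_eq h]

variable {I} in
theorem abs_localField_le {σ : Config n} (h : I.Compat σ) {v : Fin n} (hv : I.mark v = 0) :
    |I.localField v σ| ≤ I.strength v := by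
  rw [localField_eq h, strength, freeInd, if_pos hv, one_mul]
  refine (abs_add_le _ _).trans (add_le_add_right ((Finset.abs_sum_le_sum_abs _ _).trans
    (Finset.sum_le_sum fun u _ => ?_)) _)
  rw [abs_mul, abs_mul, abs_spin, mul_one, abs_of_nonneg (I.freeInd_nonneg u)]

theorem le_exp_strength {b : ℝ} (hb1 : b < 1) (h : MarginallyBounded b (gibbs (isingWeight I)))
    (v : Fin n) : b ≤ Real.exp (-2 * I.strength v) := by
  classical
  by_cases hv : I.mark v = 0
  swap
  · simp [strength, freeInd, hv, hb1.le]
  obtain ⟨c, e, hce, he1, heabs⟩ : ∃ (c : Bool) (e : ℝ), spin c = -e ∧ e * e = 1 ∧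
      e * |I.effField v| = I.effField v := by
    rcases le_total 0 (I.effField v) with h0 | h0
    · exact ⟨false, 1, by simp [spin], by simp, by rw [abs_of_nonneg h0, one_mul]⟩
    · exact ⟨true, -1, by simp [spin], by simp, by rw [abs_of_nonpos h0]; ring⟩
  set σ : Config n := fun u =>
    if I.mark u = 0 then decide (0 ≤ e * I.J v u) else decide (I.mark u = 1) with hσ
  have hcomp : I.Compat σ := fun u =>
    ⟨fun hu => by simp [hσ, hu], fun hu => by simp [hσ, hu]⟩
  have hfield : I.localField v σ = e * I.strength v := by
    rw [localField_eq hcomp, strength, freeInd, if_pos hv, one_mul, mul_add, heabs,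
      Finset.mul_sum]
    congr 1
    refine Finset.sum_congr rfl fun u _ => ?_
    by_cases hu : I.mark u = 0
    · simp only [freeInd, hu, if_true, one_mul, mul_one, hσ]
      have h2 : e * (e * I.J v u) = I.J v u := by rw [← mul_assoc, he1, one_mul]
      have h3 : |I.J v u| = |e * I.J v u| := by
        rw [abs_mul]
        have : |e| = 1 := by
          rw [← abs_neg, ← hce, abs_spin]
        rw [this, one_mul]
      by_cases hs : 0 ≤ e * I.J v u
      · rw [h3, abs_of_nonneg hs, h2]; simp [hs, spin]
      · rw [h3, abs_of_neg (not_le.1 hs)]; simp only [hs, decide_false, spin]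
        simp; linarith
    · simp [freeInd, hu]
  have hm := le_of_marginallyBounded I.partition_pos h σ v c I.weight_nonneg
    (weight_pos ((compat_update hv σ c).2 hcomp))
  refine hm.trans ?_
  have hpos : 0 < isingWeight I (Function.update σ v false) :=
    weight_pos ((compat_update hv σ false).2 hcomp)
  rw [weight_update hv, hfield]
  cases c
  · have : e = 1 := by simp [spin] at hce; linarith
    rw [div_le_iff₀ (by positivity), this, one_mul, mul_add, ← mul_assoc, ← Real.exp_add]
    have e1 : -2 * I.strength v + 2 * I.strength v = 0 := by ring
    rw [e1, Real.exp_zero, one_mul]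
    have := mul_pos (Real.exp_pos (-2 * I.strength v)) hpos
    linarith
  · have : e = -1 := by simp [spin] at hce; linarith
    rw [weight_update hv, hfield, this, show 2 * (-1 * I.strength v) = -2 * I.strength v by ring]
    rw [div_le_iff₀ (by positivity), mul_add]
    have := Real.exp_pos (-2 * I.strength v)
    have := mul_pos (mul_pos this this) hpos
    nlinarith

end IsingModel

end Ising

namespace IsingModel

variable {n : ℕ} {G : SimpleGraph (Fin n)}

/-! ### Lower bounds for the distance of two Ising models -/

open Classical in
/-- The probability of `+` at `v`. -/
def occ (I : IsingModel G) (v : Fin n) : ℝ :=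
  ∑ σ, gibbs (isingWeight I) σ * (if σ v = true then 1 else 0)

variable {I I' : IsingModel G}

theorem occ_of_mark_one {v : Fin n} (hv : I.mark v = 1) : I.occ v = 1 := by
  rw [← sum_gibbs I.partition_pos]
  refine Finset.sum_congr rfl fun σ _ => ?_
  by_cases h : isingWeight I σ = 0
  · simp [gibbs, h]
  · simp [(weight_ne_zero h v).1 hv]

theorem occ_of_mark_two {v : Fin n} (hv : I.mark v = 2) : I.occ v = 0 := by
  refine Finset.sum_eq_zero fun σ _ => ?_
  by_cases h : isingWeight I σ = 0
  · simp [gibbs, h]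
  · simp [(weight_ne_zero h v).2 hv]

theorem occ_bounds {β : ℝ} {v : Fin n} (hβ1 : β ≤ 1) (hβ : β ≤ Real.exp (-2 * I.strength v))
    (hv : I.mark v = 0) : β / 2 ≤ I.occ v ∧ I.occ v ≤ 1 - β / 2 := by
  classical
  have h0 : I.occ v = ∑ σ, gibbs (isingWeight I) σ * logistic (I.localField v σ) := by
    have := (isCondProb hv).sum_eq_zero (g := fun _ => 1) (fun _ _ => rfl)
    rw [← sub_eq_zero, occ, ← Finset.sum_sub_distrib]
    simp only [gibbs, div_mul_eq_mul_div, ← sub_div, ← mul_sub, ← Finset.sum_div]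
    simp only [one_mul] at this
    rw [this, zero_div]
  have h1 : ∀ σ, gibbs (isingWeight I) σ * (β / 2) ≤
      gibbs (isingWeight I) σ * logistic (I.localField v σ) ∧
      gibbs (isingWeight I) σ * logistic (I.localField v σ) ≤
        gibbs (isingWeight I) σ * (1 - β / 2) := fun σ => by
    have hg := gibbs_nonneg I.weight_nonneg σ
    by_cases h : isingWeight I σ = 0
    · simp [gibbs, h]
    · have := logistic_bounds hβ hβ1 (abs_localField_le (weight_ne_zero h) hv)
      exact ⟨mul_le_mul_of_nonneg_left this.1 hg, mul_le_mul_of_nonneg_left (by linarith) hg⟩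
  rw [h0]
  constructor
  · calc β / 2 = ∑ σ, gibbs (isingWeight I) σ * (β / 2) := by
          rw [← Finset.sum_mul, sum_gibbs I.partition_pos, one_mul]
      _ ≤ _ := Finset.sum_le_sum fun σ _ => (h1 σ).1
  · calc _ ≤ ∑ σ, gibbs (isingWeight I) σ * (1 - β / 2) := Finset.sum_le_sum fun σ _ => (h1 σ).2
      _ = _ := by rw [← Finset.sum_mul, sum_gibbs I.partition_pos, one_mul]

theorem le_tvDist_of_mark_ne {β : ℝ} {v : Fin n} (hβ1 : β ≤ 1)
    (hβ : β ≤ Real.exp (-2 * I.strength v)) (hβ' : β ≤ Real.exp (-2 * I'.strength v))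
    (hv : I.mark v ≠ I'.mark v) :
    β / 2 ≤ tvDist (gibbs (isingWeight I)) (gibbs (isingWeight I')) := by
  classical
  have h1 : |I.occ v - I'.occ v| ≤ tvDist (gibbs (isingWeight I)) (gibbs (isingWeight I')) := by
    have := abs_prob_sub_le_tvDist (p := gibbs (isingWeight I)) (q := gibbs (isingWeight I'))
      (by rw [sum_gibbs I.partition_pos, sum_gibbs I'.partition_pos]) (fun σ => σ v = true)
    rw [prob_eq_sum, prob_eq_sum] at this
    convert this using 3 <;> simp [occ]
  refine le_trans ?_ h1
  have hp := le_abs_self (I.occ v - I'.occ v)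
  have hn := neg_le_abs (I.occ v - I'.occ v)
  rcases I.mark_cases v with h | h | h <;> rcases I'.mark_cases v with h' | h' | h'
  · exact absurd (h.trans h'.symm) hv
  · have := occ_bounds hβ1 hβ h; have := occ_of_mark_one h'; linarith
  · have := occ_bounds hβ1 hβ h; have := occ_of_mark_two h'; linarith
  · have := occ_bounds hβ1 hβ' h'; have := occ_of_mark_one h; linarith
  · exact absurd (h.trans h'.symm) hv
  · have := occ_of_mark_one h; have := occ_of_mark_two h'; linarith
  · have := occ_bounds hβ1 hβ' h'; have := occ_of_mark_two h; linarith
  · have := occ_of_mark_two h; have := occ_of_mark_one h'; linarith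
  · exact absurd (h.trans h'.symm) hv

theorem pinSign_congr (hm : ∀ v, I.mark v = I'.mark v) : I'.pinSign = I.pinSign := by
  funext v; simp only [pinSign, hm]

theorem freeInd_congr (hm : ∀ v, I.mark v = I'.mark v) : I'.freeInd = I.freeInd := by
  funext v; simp only [freeInd, hm]

theorem compat_congr (hm : ∀ v, I.mark v = I'.mark v) (σ : Config n) : I'.Compat σ ↔ I.Compat σ := by
  simp only [Compat, hm]

/-- The mean change of the local field is bounded by the distance. -/
theorem sum_abs_localField_sub_le (hm : ∀ v, I.mark v = I'.mark v) {β : ℝ} {v : Fin n} (hβ0 : 0 < β)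
    (hβ : β ≤ Real.exp (-2 * I.strength v)) (hβ' : β ≤ Real.exp (-2 * I'.strength v))
    (hv : I.mark v = 0) :
    β ^ 3 / 2 * ∑ σ, gibbs (isingWeight I') σ * |I'.localField v σ - I.localField v σ| ≤
      2 * tvDist (gibbs (isingWeight I)) (gibbs (isingWeight I')) := by
  have hv' : I'.mark v = 0 := hm v ▸ hv
  refine le_trans ?_ (sum_gibbs_abs_sub_le I.partition_pos I'.partition_pos (isCondProb hv)
    (isCondProb hv'))
  rw [Finset.mul_sum]
  refine Finset.sum_le_sum fun σ _ => ?_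
  by_cases h : isingWeight I' σ = 0
  · simp [gibbs, h]
  · have hc := weight_ne_zero h
    have hL' := abs_localField_le hc hv'
    have hL := abs_localField_le ((compat_congr hm σ).1 hc) hv
    have h2 := logistic_sub_le (x := I'.localField v σ) (y := I.localField v σ)
      (L := max (I.strength v) (I'.strength v)) hβ0
      (by
        rcases max_choice (I.strength v) (I'.strength v) with h3 | h3 <;> rw [h3]
        · exact hβ
        · exact hβ')
      (hL'.trans (le_max_right _ _)) (hL.trans (le_max_left _ _))
    have hg := gibbs_nonneg I'.weight_nonneg σ
    calc _ = gibbs (isingWeight I') σ * (β ^ 3 / 2 * |I'.localField v σ - I.localField v σ|) := by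
          ring
      _ ≤ _ := by gcongr

theorem abs_J_sub_le (hm : ∀ v, I.mark v = I'.mark v) {β : ℝ} {u v : Fin n} (hβ0 : 0 < β) (hβ1 : β ≤ 1)
    (hβ' : β ≤ Real.exp (-2 * I'.strength u)) (hu : I.mark u = 0) :
    β * |I'.J v u - I.J v u| ≤
      ∑ σ, gibbs (isingWeight I') σ * |I'.localField v σ - I.localField v σ| := by
  have hu' : I'.mark u = 0 := hm u ▸ hu
  set g : Config n → ℝ := fun σ => |I'.localField v σ - I.localField v σ| with hg
  have hdiff : ∀ σ : Config n, 2 * |I'.J v u - I.J v u| ≤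
      g (Function.update σ u true) + g (Function.update σ u false) := fun σ => by
    have e1 : ∀ K : IsingModel G, K.localField v (Function.update σ u true) -
        K.localField v (Function.update σ u false) = 2 * K.J v u := fun K => by
      simp only [localField]
      rw [add_sub_add_left_eq_sub, ← Finset.sum_sub_distrib, Finset.sum_eq_single u]
      · simp [spin]; ring
      · intro x _ hx; simp [hx]
      · simp
    have e2 : 2 * (I'.J v u - I.J v u) =
        (I'.localField v (Function.update σ u true) - I.localField v (Function.update σ u true)) -
        (I'.localField v (Function.update σ u false) -
          I.localField v (Function.update σ u false)) := by
      linarith [e1 I, e1 I']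
    calc 2 * |I'.J v u - I.J v u| = |2 * (I'.J v u - I.J v u)| := by rw [abs_mul]; norm_num
      _ ≤ _ := by rw [e2]; exact abs_sub _ _
  have hsum : ∑ σ, gibbs (isingWeight I') σ * g σ = (1 / 2) * ∑ σ : Config n,
      (gibbs (isingWeight I') (Function.update σ u true) * g (Function.update σ u true) +
      gibbs (isingWeight I') (Function.update σ u false) * g (Function.update σ u false)) :=
    sum_eq_half_sum_update u _
  have hone : (1 : ℝ) = (1 / 2) * ∑ σ : Config n,
      (gibbs (isingWeight I') (Function.update σ u true) +
      gibbs (isingWeight I') (Function.update σ u false)) := by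
    rw [← sum_eq_half_sum_update u, sum_gibbs I'.partition_pos]
  rw [hsum]
  calc β * |I'.J v u - I.J v u| = (1 / 2) * ∑ σ : Config n,
      (gibbs (isingWeight I') (Function.update σ u true) +
      gibbs (isingWeight I') (Function.update σ u false)) * (β * |I'.J v u - I.J v u|) := by
        rw [← Finset.sum_mul, ← mul_assoc, ← hone, one_mul]
    _ ≤ _ := by
        refine mul_le_mul_of_nonneg_left (Finset.sum_le_sum fun σ _ => ?_) (by norm_num)
        by_cases hc : I'.Compat σ
        · have hb := logistic_bounds hβ' hβ1 (abs_localField_le hc hu')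
          have hbal := (isCondProb hu').balance σ
          set a := isingWeight I' (Function.update σ u true) with ha
          set d := isingWeight I' (Function.update σ u false) with hd
          have ha0 : 0 ≤ a := I'.weight_nonneg _
          have hd0 : 0 ≤ d := I'.weight_nonneg _
          have h1 : β / 2 * (a + d) ≤ a := by nlinarith
          have h2 : β / 2 * (a + d) ≤ d := by nlinarith
          have hgt : 0 ≤ g (Function.update σ u true) := abs_nonneg _
          have hgf : 0 ≤ g (Function.update σ u false) := abs_nonneg _
          have hd2 := hdiff σ
          have hZ := I'.partition_pos
          simp only [gibbs, ← ha, ← hd]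
          rw [← add_div, div_mul_eq_mul_div, div_mul_eq_mul_div, div_mul_eq_mul_div, ← add_div]
          refine div_le_div_of_nonneg_right ?_ hZ.le
          have hβad : 0 ≤ β / 2 * (a + d) := by
            positivity
          calc (a + d) * (β * |I'.J v u - I.J v u|) =
              β / 2 * (a + d) * (2 * |I'.J v u - I.J v u|) := by ring
            _ ≤ β / 2 * (a + d) * (g (Function.update σ u true) +
                g (Function.update σ u false)) := mul_le_mul_of_nonneg_left hd2 hβad
            _ = β / 2 * (a + d) * g (Function.update σ u true) +
                β / 2 * (a + d) * g (Function.update σ u false) := by ring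
            _ ≤ _ := by gcongr
        · have e1 : ∀ c, gibbs (isingWeight I') (Function.update σ u c) = 0 := fun c => by
            have : isingWeight I' (Function.update σ u c) = 0 := by
              by_contra h
              exact hc ((compat_update hu' σ c).1 (weight_ne_zero h))
            simp [gibbs, this]
          simp [e1]

theorem abs_effField_sub_le (hm : ∀ v, I.mark v = I'.mark v) (v : Fin n) :
    |I'.effField v - I.effField v| ≤
      ∑ σ, gibbs (isingWeight I') σ * |I'.localField v σ - I.localField v σ| +
      ∑ u, I.freeInd u * |I'.J v u - I.J v u| := by
  have hZ := I'.partition_pos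
  have h1 : ∀ σ, I'.Compat σ → |I'.effField v - I.effField v| ≤
      |I'.localField v σ - I.localField v σ| + ∑ u, I.freeInd u * |I'.J v u - I.J v u| := by
    intro σ hc
    have e1 := localField_eq hc v
    have e2 := localField_eq ((compat_congr hm σ).1 hc) v
    have e3 : I'.effField v - I.effField v = (I'.localField v σ - I.localField v σ) -
        ∑ u, (I'.J v u - I.J v u) * (I.freeInd u * spin (σ u)) := by
      rw [e1, e2, freeInd_congr hm]
      simp only [sub_mul, Finset.sum_sub_distrib]
      ring
    rw [e3]
    refine (abs_sub _ _).trans (add_le_add_right ((Finset.abs_sum_le_sum_abs _ _).trans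
      (Finset.sum_le_sum fun u _ => ?_)) _)
    rw [abs_mul, abs_mul, abs_spin, mul_one, abs_of_nonneg (I.freeInd_nonneg u), mul_comm]
  calc |I'.effField v - I.effField v|
      = ∑ σ, gibbs (isingWeight I') σ * |I'.effField v - I.effField v| := by
        rw [← Finset.sum_mul, sum_gibbs hZ, one_mul]
    _ ≤ ∑ σ, gibbs (isingWeight I') σ * (|I'.localField v σ - I.localField v σ| +
        ∑ u, I.freeInd u * |I'.J v u - I.J v u|) := by
        refine Finset.sum_le_sum fun σ _ => ?_
        by_cases h : isingWeight I' σ = 0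
        · simp [gibbs, h]
        · exact mul_le_mul_of_nonneg_left (h1 σ (weight_ne_zero h))
            (gibbs_nonneg I'.weight_nonneg σ)
    _ = _ := by
        simp only [mul_add, Finset.sum_add_distrib]
        rw [← Finset.sum_mul, sum_gibbs hZ, one_mul]

/-- The distance of the parameters of two Ising models. -/
def paramDist (I I' : IsingModel G) : ℝ :=
  ∑ v, (if I.mark v = I'.mark v then I.freeInd v * |I'.effField v - I.effField v| else 1) +
    (1 / 2) * ∑ u, ∑ v, I.freeInd u * I.freeInd v * |I'.J u v - I.J u v|

theorem paramDist_mul_le {β : ℝ} (hβ0 : 0 < β) (hβ1 : β ≤ 1)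
    (hβ : ∀ v, β ≤ Real.exp (-2 * I.strength v)) (hβ' : ∀ v, β ≤ Real.exp (-2 * I'.strength v))
    (hn : 0 < n) :
    min (I.paramDist I') 1 * (β ^ 4 / 16) ≤
      (n + numEdges G : ℕ) * tvDist (gibbs (isingWeight I)) (gibbs (isingWeight I')) := by
  classical
  set η := tvDist (gibbs (isingWeight I)) (gibbs (isingWeight I')) with hη
  have hη0 : 0 ≤ η := tvDist_nonneg _ _
  have hN : (1 : ℝ) ≤ (n + numEdges G : ℕ) := by exact_mod_cast (by omega)
  by_cases hm : ∀ v, I.mark v = I'.mark v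
  · set A : Fin n → ℝ := fun v =>
      ∑ σ, gibbs (isingWeight I') σ * |I'.localField v σ - I.localField v σ| with hA
    set D := 4 * η / β ^ 3 with hD
    have hD0 : 0 ≤ D := by positivity
    have hAD : ∀ v, I.mark v = 0 → A v ≤ D := fun v hv => by
      have := sum_abs_localField_sub_le hm hβ0 (hβ v) (hβ' v) hv
      rw [hD, le_div_iff₀ (by positivity)]
      linarith
    have hJ : ∀ u v, I.freeInd u * I.freeInd v * |I'.J u v - I.J u v| ≤
        if G.Adj u v then D / β else 0 := fun u v => by
      split
      · by_cases hu : I.mark u = 0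
        · by_cases hv : I.mark v = 0
          · have := abs_J_sub_le hm (v := u) hβ0 hβ1 (hβ' v) hv
            simp only [freeInd, hu, hv, if_true, one_mul]
            rw [le_div_iff₀ hβ0, mul_comm]
            exact this.trans (hAD u hu)
          · simp only [freeInd, hv, if_false, mul_zero, zero_mul]; positivity
        · simp only [freeInd, hu, if_false, zero_mul]; positivity
      · rename_i hadj
        have e1 : ∀ K : IsingModel G, K.J u v = 0 := fun K => by
          by_contra h; exact hadj (K.supp u v h)
        simp [e1]
    have hE : ∀ v, (if I.mark v = I'.mark v then I.freeInd v * |I'.effField v - I.effField v|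
        else 1) ≤ D + ∑ u, I.freeInd v * I.freeInd u * |I'.J v u - I.J v u| := fun v => by
      rw [if_pos (hm v)]
      by_cases hv : I.mark v = 0
      · have h1 := abs_effField_sub_le hm v
        have h2 : I.freeInd v = 1 := by simp [freeInd, hv]
        simp only [h2, one_mul]
        exact h1.trans (add_le_add_left (hAD v hv) _)
      · have h2 : I.freeInd v = 0 := by simp [freeInd, hv]
        simp [h2, hD0]
    have hJs : ∑ u, ∑ v, I.freeInd u * I.freeInd v * |I'.J u v - I.J u v| ≤
        2 * numEdges G * (D / β) := by
      rw [← sum_adj_eq, Finset.sum_mul]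
      refine Finset.sum_le_sum fun u _ => ?_
      rw [Finset.sum_mul]
      refine Finset.sum_le_sum fun v _ => (hJ u v).trans (le_of_eq ?_)
      split <;> simp
    have hκ : I.paramDist I' ≤ n * D + 3 * numEdges G * (D / β) := by
      have h1 := Finset.sum_le_sum fun v (_ : v ∈ Finset.univ) => hE v
      rw [Finset.sum_add_distrib] at h1
      simp only [Finset.sum_const, Finset.card_univ, Fintype.card_fin, nsmul_eq_mul] at h1
      unfold paramDist
      linarith
    have hκ0 : I.paramDist I' * (β ^ 4 / 16) ≤ (n + numEdges G : ℕ) * η := by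
      calc _ ≤ (n * D + 3 * numEdges G * (D / β)) * (β ^ 4 / 16) := by gcongr
        _ = (n * β + 3 * numEdges G) * η / 4 := by rw [hD]; field_simp; ring
        _ ≤ _ := by
          push_cast
          have e1 : (0 : ℝ) ≤ numEdges G := by positivity
          have e2 : (n : ℝ) * β ≤ n := mul_le_of_le_one_right (by positivity) hβ1
          have e3 : (0 : ℝ) ≤ n := by positivity
          nlinarith
    refine le_trans ?_ hκ0
    gcongr
    exact min_le_left _ _
  · push Not at hm
    obtain ⟨v, hv⟩ := hm
    have h1 := le_tvDist_of_mark_ne hβ1 (hβ v) (hβ' v) hv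
    rw [← hη] at h1
    calc _ ≤ 1 * (β ^ 4 / 16) := by gcongr; exact min_le_right _ _
      _ ≤ β / 2 := by
        have : β ^ 4 ≤ β ^ 1 := pow_le_pow_of_le_one hβ0.le hβ1 (by norm_num)
        linarith
      _ ≤ 1 * η := by linarith
      _ ≤ _ := by gcongr

/-! ### The likelihood ratio -/

open Classical in
theorem ratio_eq {σ : Config n} (h : isingWeight I σ ≠ 0) :
    isingWeight I' σ / isingWeight I σ =
      if I'.Compat σ then Real.exp (I'.energy σ - I.energy σ) else 0 := by
  rw [I.weight_eq, if_pos (weight_ne_zero h), I'.weight_eq]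
  split
  · rw [Real.exp_sub]
  · simp

theorem energy_sub_eq (hm : ∀ v, I.mark v = I'.mark v) : ∃ c, ∀ σ, I.Compat σ →
    |I'.energy σ - I.energy σ - c| ≤ I.paramDist I' := by
  classical
  refine ⟨(1 / 2) * ∑ u, ∑ v, (I'.J u v - I.J u v) * I.pinSign u * I.pinSign v +
    ∑ v, I.pinSign v * (I'.field v - I.field v), fun σ hc => ?_⟩
  have h1 : I'.energy σ - I.energy σ -
      ((1 / 2) * ∑ u, ∑ v, (I'.J u v - I.J u v) * I.pinSign u * I.pinSign v +
        ∑ v, I.pinSign v * (I'.field v - I.field v)) =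
      ∑ v, I.freeInd v * spin (σ v) * (I'.effField v - I.effField v) +
      (1 / 2) * ∑ u, ∑ v, (I'.J u v - I.J u v) * (I.freeInd u * spin (σ u)) *
        (I.freeInd v * spin (σ v)) := by
    set d : Fin n → Fin n → ℝ := fun u v => I'.J u v - I.J u v with hd
    have e1 : I'.energy σ - I.energy σ = (1 / 2) * ∑ u, ∑ v, d u v * spin (σ u) * spin (σ v) +
        ∑ v, spin (σ v) * (I'.field v - I.field v) := by
      simp only [energy, hd, sub_mul, mul_sub, Finset.sum_sub_distrib]
      ring
    have e2 : ∀ u v, d u v * spin (σ u) * spin (σ v) = d u v * I.pinSign u * I.pinSign v +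
        (d u v * I.pinSign v * (I.freeInd u * spin (σ u)) +
          d v u * I.pinSign u * (I.freeInd v * spin (σ v))) +
        d u v * (I.freeInd u * spin (σ u)) * (I.freeInd v * spin (σ v)) := fun u v => by
      have : d v u = d u v := by simp only [hd, I.J_comm u v, I'.J_comm u v]
      nth_rewrite 1 [spin_eq hc u, spin_eq hc v]
      rw [this]; ring
    have e3 : ∑ v, spin (σ v) * (I'.field v - I.field v) =
        ∑ v, I.pinSign v * (I'.field v - I.field v) +
        ∑ v, I.freeInd v * spin (σ v) * (I'.field v - I.field v) := by
      rw [← Finset.sum_add_distrib]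
      refine Finset.sum_congr rfl fun v _ => ?_
      nth_rewrite 1 [spin_eq hc v]; ring
    have e4 : ∑ v, I.freeInd v * spin (σ v) * (I'.effField v - I.effField v) =
        ∑ v, I.freeInd v * spin (σ v) * (I'.field v - I.field v) +
        ∑ u, ∑ v, d u v * I.pinSign v * (I.freeInd u * spin (σ u)) := by
      rw [← Finset.sum_add_distrib]
      refine Finset.sum_congr rfl fun v _ => ?_
      rw [effField, effField, pinSign_congr hm, ← Finset.sum_mul]
      simp only [hd, sub_mul, Finset.sum_sub_distrib]
      ring
    have e5 : ∑ u, ∑ v, d v u * I.pinSign u * (I.freeInd v * spin (σ v)) =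
        ∑ u, ∑ v, d u v * I.pinSign v * (I.freeInd u * spin (σ u)) := Finset.sum_comm
    rw [e1, e3, e4]
    simp only [e2, Finset.sum_add_distrib]
    rw [e5]
    ring
  rw [h1]
  refine (abs_add_le _ _).trans (add_le_add ?_ ?_)
  · refine (Finset.abs_sum_le_sum_abs _ _).trans (Finset.sum_le_sum fun v _ => ?_)
    rw [if_pos (hm v), abs_mul, abs_mul, abs_spin, mul_one, abs_of_nonneg (I.freeInd_nonneg v)]
  · rw [abs_mul, abs_of_nonneg (by norm_num : (0 : ℝ) ≤ 1 / 2)]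
    refine mul_le_mul_of_nonneg_left ((Finset.abs_sum_le_sum_abs _ _).trans
      (Finset.sum_le_sum fun u _ => (Finset.abs_sum_le_sum_abs _ _).trans
        (Finset.sum_le_sum fun v _ => le_of_eq ?_))) (by norm_num)
    rw [abs_mul, abs_mul, abs_mul, abs_mul, abs_spin, abs_spin,
      abs_of_nonneg (I.freeInd_nonneg u), abs_of_nonneg (I.freeInd_nonneg v)]
    ring

theorem paramDist_ratio_close (h4 : I.paramDist I' ≤ 1 / 4) :
    (∀ σ, isingWeight I σ = 0 → isingWeight I' σ = 0) ∧ ∃ C₀ : ℝ, 0 < C₀ ∧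
      ∀ σ, isingWeight I σ ≠ 0 →
        |isingWeight I' σ / isingWeight I σ / C₀ - 1| ≤ 2 * I.paramDist I' := by
  classical
  have hm : ∀ v, I.mark v = I'.mark v := by
    by_contra hc
    push Not at hc
    obtain ⟨v, hv⟩ := hc
    have h1 : 1 ≤ ∑ v, (if I.mark v = I'.mark v then
        I.freeInd v * |I'.effField v - I.effField v| else 1) := by
      refine le_trans ?_ (Finset.single_le_sum (fun u _ => ?_) (Finset.mem_univ v))
      · rw [if_neg hv]
      · have := I.freeInd_nonneg u
        split <;> positivity
    have h2 : 0 ≤ (1 / 2) * ∑ u, ∑ v, I.freeInd u * I.freeInd v * |I'.J u v - I.J u v| := by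
      refine mul_nonneg (by norm_num) (Finset.sum_nonneg fun u _ => Finset.sum_nonneg fun v _ => ?_)
      have := I.freeInd_nonneg u
      have := I.freeInd_nonneg v
      positivity
    unfold paramDist at h4
    linarith
  refine ⟨fun σ hσ => ?_, ?_⟩
  · by_contra hc
    exact (weight_pos ((compat_congr hm σ).1 (weight_ne_zero hc))).ne' hσ
  · obtain ⟨c, hc⟩ := energy_sub_eq hm
    refine ⟨Real.exp c, Real.exp_pos _, fun σ hσ => ?_⟩
    have h1 := hc σ (weight_ne_zero hσ)
    rw [ratio_eq hσ, if_pos ((compat_congr hm σ).2 (weight_ne_zero hσ)), ← Real.exp_sub]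
    exact (Real.abs_exp_sub_one_le (by linarith)).trans (by linarith)

end IsingModel

/-! ### Counting loops -/

/-- `for i < real b do body`, where real register `c` holds the cast of the counter and index
register `3` holds the constant `1`. -/
def Prog.forLoop (i b c : ℕ) (body : Prog) : Prog :=
  .seq (.op (.natConst i 0)) (.seq (.op (.realCast c i))
    (.loop (.realLT c b) (.seq body (.seq (.op (.natAdd i i 3)) (.op (.realCast c i))))))

theorem exec_loop {n : ℕ} {Tsp Tct : ℝ → ℕ} {ω : Tape n} {i b c : ℕ} {body : Prog}
    {Inv : ℕ → State → Prop} {x : ℝ} {B : ℕ → ℕ}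
    (hInv : ∀ k s, Inv k s → s.real c = k ∧ s.real b = x)
    (step : ∀ (k : ℕ) (s : State), (k : ℝ) < x → Inv k s → ∃ t s', Exec Tsp Tct ω body s t s' ∧ t ≤ B k ∧
      s'.nat 3 = 1 ∧ s'.nat i = k ∧ Inv (k + 1) ((s'.setNat i (k + 1)).setReal c ((k + 1 : ℕ) : ℝ)))
    (l : ℕ) : ∀ (k : ℕ) (s : State), k + l = ⌈x⌉₊ → Inv k s →
    ∃ t s', Exec Tsp Tct ω (.loop (.realLT c b)
        (.seq body (.seq (.op (.natAdd i i 3)) (.op (.realCast c i))))) s t s' ∧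
      t ≤ 1 + ∑ j ∈ Finset.range l, (B (k + j) + 3) ∧ Inv ⌈x⌉₊ s' := by
  induction l with
  | zero =>
    intro k s hk hs
    obtain ⟨h1, h2⟩ := hInv k s hs
    refine ⟨1, s, .loop_false ?_, by simp, by simpa [← hk] using hs⟩
    simp only [Test.holds, h1, h2, not_lt]
    rw [show k = ⌈x⌉₊ by simpa using hk]
    exact Nat.le_ceil x
  | succ l ih =>
    intro k s hk hs
    obtain ⟨h1, h2⟩ := hInv k s hs
    have hlt : (k : ℝ) < x := Nat.lt_ceil.1 (by omega)
    obtain ⟨t, s', he, ht, h3, hi, hI⟩ := step k s hlt hs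
    obtain ⟨t2, s2, he2, ht2, hI2⟩ := ih (k + 1) _ (by omega) hI
    refine ⟨_, s2, .loop_true (t₂ := t2) (by simpa [Test.holds, h1, h2] using hlt)
      (.seq he (.seq (.op _ _) (.op _ _))) ?_, ?_, hI2⟩
    · convert he2 using 1
      simp [Instr.apply, State.setNat, State.setReal, hi, h3]
    · rw [Finset.sum_range_succ']
      have : ∑ j ∈ Finset.range l, (B (k + 1 + j) + 3) =
          ∑ j ∈ Finset.range l, (B (k + (j + 1)) + 3) :=
        Finset.sum_congr rfl fun j _ => by rw [add_assoc, add_comm 1 j]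
      rw [this] at ht2
      simp only [add_zero]
      omega

theorem exec_forLoop {n : ℕ} {Tsp Tct : ℝ → ℕ} {ω : Tape n} {i b c : ℕ} {body : Prog}
    {Inv : ℕ → State → Prop} {x : ℝ} {B : ℕ → ℕ} {s : State}
    (hInv : ∀ k s, Inv k s → s.real c = k ∧ s.real b = x)
    (h0 : Inv 0 ((s.setNat i 0).setReal c 0))
    (step : ∀ (k : ℕ) (s : State), (k : ℝ) < x → Inv k s → ∃ t s', Exec Tsp Tct ω body s t s' ∧ t ≤ B k ∧
      s'.nat 3 = 1 ∧ s'.nat i = k ∧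
      Inv (k + 1) ((s'.setNat i (k + 1)).setReal c ((k + 1 : ℕ) : ℝ))) :
    ∃ t s', Exec Tsp Tct ω (.forLoop i b c body) s t s' ∧
      t ≤ 3 + ∑ j ∈ Finset.range ⌈x⌉₊, (B j + 3) ∧ Inv ⌈x⌉₊ s' := by
  obtain ⟨t, s', he, ht, hI⟩ := exec_loop hInv step ⌈x⌉₊ 0 _ (by simp) h0
  refine ⟨_, s', .seq (.op _ _) (.seq (.op _ _) (t₂ := t) ?_), ?_, hI⟩
  · convert he using 1
    simp [Instr.apply, State.setNat, State.setReal]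
  · simp only [zero_add] at ht
    omega

/-! ### Expressions -/

/-- Index expressions. -/
inductive IdxExpr : Type
  | var (i : ℕ)
  | load (a : ℕ) (j : IdxExpr)

namespace IdxExpr

def eval : IdxExpr → State → ℕ
  | var i, s => s.nat i
  | load a j, s => s.natArr a (j.eval s)

/-- The variables are among `vn`. -/
def ok (vn : List ℕ) : IdxExpr → Bool
  | var i => decide (i ∈ vn)
  | load _ j => j.ok vn

/-- Evaluation into index register `p`. -/
def compile (p : ℕ) : IdxExpr → Prog
  | var i => .op (.natCopy p i)
  | load a j => .seq (j.compile p) (.op (.natLoad p a p))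

def cost : IdxExpr → ℕ
  | var _ => 1
  | load _ j => j.cost + 1

end IdxExpr

/-- Agreement on the variables `vn`, `vr` and on all arrays. -/
structure AgreeOn (vn vr : List ℕ) (s s' : State) : Prop where
  nat : ∀ i ∈ vn, s'.nat i = s.nat i
  real : ∀ i ∈ vr, s'.real i = s.real i
  natArr : s'.natArr = s.natArr
  realArr : s'.realArr = s.realArr

/-- Agreement on the registers below `p` and `d`, on all arrays, and on the number of calls. -/
structure Keeps (p d : ℕ) (s s' : State) : Prop where
  nat : ∀ i < p, s'.nat i = s.nat i
  real : ∀ i < d, s'.real i = s.real i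
  natArr : s'.natArr = s.natArr
  realArr : s'.realArr = s.realArr
  calls : s'.calls = s.calls

theorem Keeps.refl (p d : ℕ) (s : State) : Keeps p d s s :=
  ⟨fun _ _ => rfl, fun _ _ => rfl, rfl, rfl, rfl⟩

theorem Keeps.trans {p d : ℕ} {s₁ s₂ s₃ : State} (h : Keeps p d s₁ s₂) (h' : Keeps p d s₂ s₃) :
    Keeps p d s₁ s₃ :=
  ⟨fun i hi => (h'.nat i hi).trans (h.nat i hi), fun i hi => (h'.real i hi).trans (h.real i hi),
    h'.natArr.trans h.natArr, h'.realArr.trans h.realArr, h'.calls.trans h.calls⟩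

theorem Keeps.mono {p d p' d' : ℕ} {s s' : State} (h : Keeps p d s s') (hp : p' ≤ p)
    (hd : d' ≤ d) : Keeps p' d' s s' :=
  ⟨fun i hi => h.nat i (hi.trans_le hp), fun i hi => h.real i (hi.trans_le hd),
    h.natArr, h.realArr, h.calls⟩

theorem Keeps.setReal {p d i : ℕ} {s s' : State} (h : Keeps p d s s') (hi : d ≤ i) (x : ℝ) :
    Keeps p d s (s'.setReal i x) :=
  ⟨h.nat, fun j hj => by
    simp [State.setReal, Function.update_of_ne (show j ≠ i by omega), h.real j hj],
    h.natArr, h.realArr, h.calls⟩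

theorem Keeps.setNat {p d i : ℕ} {s s' : State} (h : Keeps p d s s') (hi : p ≤ i) (x : ℕ) :
    Keeps p d s (s'.setNat i x) :=
  ⟨fun j hj => by
    simp [State.setNat, Function.update_of_ne (show j ≠ i by omega), h.nat j hj],
    h.real, h.natArr, h.realArr, h.calls⟩

theorem Keeps.agreeOn {p d : ℕ} {s s' : State} (h : Keeps p d s s') {vn vr : List ℕ}
    (hn : ∀ i ∈ vn, i < p) (hr : ∀ i ∈ vr, i < d) : AgreeOn vn vr s s' :=
  ⟨fun i hi => h.nat i (hn i hi), fun i hi => h.real i (hr i hi), h.natArr, h.realArr⟩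

theorem IdxExpr.eval_congr {vn vr : List ℕ} {s s' : State} (h : AgreeOn vn vr s s') :
    ∀ j : IdxExpr, j.ok vn = true → j.eval s' = j.eval s
  | var i, hj => h.nat i (by simpa [ok] using hj)
  | load a j, hj => by
    simp only [eval, IdxExpr.eval_congr h j (by simpa [ok] using hj), h.natArr]

theorem IdxExpr.exec_compile {n : ℕ} {Tsp Tct : ℝ → ℕ} {ω : Tape n} {p : ℕ} (d : ℕ) (s : State) :
    ∀ j : IdxExpr, ∃ s', Exec Tsp Tct ω (j.compile p) s j.cost s' ∧
      s'.nat p = j.eval s ∧ Keeps p d s s'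
  | var i => ⟨_, .op _ _, by simp [Instr.apply, State.setNat, eval],
      (Keeps.refl p d s).setNat le_rfl _⟩
  | load a j => by
    obtain ⟨s', he, hv, hk⟩ := IdxExpr.exec_compile d s j
    refine ⟨_, .seq he (.op _ _), ?_, hk.setNat le_rfl _⟩
    simp [Instr.apply, State.setNat, eval, hv, hk.natArr]

/-- Binary operations on reals. -/
inductive BinOp : Type
  | add
  | sub
  | mul
  | div

def BinOp.eval : BinOp → ℝ → ℝ → ℝ
  | add, x, y => x + y
  | sub, x, y => x - y
  | mul, x, y => x * y
  | div, x, y => x / y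

def BinOp.instr : BinOp → ℕ → ℕ → ℕ → Instr
  | add => .realAdd
  | sub => .realSub
  | mul => .realMul
  | div => .realDiv

/-- Iteration of a step that depends on the counter. -/
def iter (x : ℝ) (f : ℕ → ℝ → ℝ) : ℕ → ℝ
  | 0 => x
  | k + 1 => f k (iter x f k)

/-- Real expressions. -/
inductive RealExpr : Type
  | var (i : ℕ)
  | const (q : ℚ)
  | cast (j : IdxExpr)
  | load (a : ℕ) (j : IdxExpr)
  | bin (o : BinOp) (x y : RealExpr)
  | exp (x : RealExpr)
  /-- `if a ≤ b then x else y` -/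
  | ite (a b x y : RealExpr)
  /-- Start with the value of `init` and execute `real r := body` for `nat i = 0, 1, …` while
  `nat i` is less than `bound`. -/
  | fold (i r : ℕ) (bound init body : RealExpr)

namespace RealExpr

open Classical in
def eval : RealExpr → State → ℝ
  | var i, s => s.real i
  | const q, _ => q
  | cast j, s => j.eval s
  | load a j, s => s.realArr a (j.eval s)
  | bin o x y, s => o.eval (x.eval s) (y.eval s)
  | exp x, s => Real.exp (x.eval s)
  | ite a b x y, s => if a.eval s ≤ b.eval s then x.eval s else y.eval s
  | fold i r bound init body, s =>
    iter (init.eval s) (fun k acc => body.eval ((s.setNat i k).setReal r acc)) ⌈bound.eval s⌉₊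

open Classical in
def cost : RealExpr → State → ℕ
  | var _, _ => 1
  | const _, _ => 1
  | cast j, _ => j.cost + 1
  | load _ j, _ => j.cost + 1
  | bin _ x y, s => x.cost s + y.cost s + 1
  | exp x, s => x.cost s + 1
  | ite a b x y, s => a.cost s + b.cost s + 1 +
      if a.eval s ≤ b.eval s then x.cost s else y.cost s
  | fold i r bound init body, s => bound.cost s + init.cost s + 6 +
      ∑ k ∈ Finset.range ⌈bound.eval s⌉₊, (4 + body.cost ((s.setNat i k).setReal r
        (iter (init.eval s) (fun k acc => body.eval ((s.setNat i k).setReal r acc)) k)))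

/-- The free variables are among `vn`, `vr`, and the bound ones are compatible with a compilation
that uses the index registers from `p` on and the real registers from `d` on. -/
def ok : RealExpr → (p d : ℕ) → (vn vr : List ℕ) → Bool
  | var i, _, _, _, vr => decide (i ∈ vr)
  | const _, _, _, _, _ => true
  | cast j, _, _, vn, _ => j.ok vn
  | load _ j, _, _, vn, _ => j.ok vn
  | bin _ x y, p, d, vn, vr => x.ok p d vn vr && y.ok p (d + 1) vn vr
  | exp x, p, d, vn, vr => x.ok p d vn vr
  | ite a b x y, p, d, vn, vr =>
    a.ok p d vn vr && b.ok p (d + 1) vn vr && x.ok p d vn vr && y.ok p d vn vr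
  | fold i r bound init body, p, d, vn, vr =>
    decide (p ≤ i) && decide (d ≤ r) && bound.ok p d vn vr && init.ok p (r + 2) vn vr &&
      body.ok (i + 1) (r + 3) (i :: vn) (r :: vr)

/-- Evaluation into real register `d`, using the index registers from `p` on and the real
registers from `d` on. -/
def compile : RealExpr → (p d : ℕ) → Prog
  | var i, _, d => .op (.realCopy d i)
  | const q, _, d => .op (.realConst d q)
  | cast j, p, d => .seq (j.compile p) (.op (.realCast d p))
  | load a j, p, d => .seq (j.compile p) (.op (.realLoad d a p))
  | bin o x y, p, d =>
    .seq (x.compile p d) (.seq (y.compile p (d + 1)) (.op (o.instr d d (d + 1))))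
  | exp x, p, d => .seq (x.compile p d) (.op (.realExp d d))
  | ite a b x y, p, d =>
    .seq (a.compile p d) (.seq (b.compile p (d + 1))
      (.branch (.realLE d (d + 1)) (x.compile p d) (y.compile p d)))
  | fold i r bound init body, p, d =>
    .seq (bound.compile p d) (.seq (.op (.realCopy (r + 1) d))
      (.seq (init.compile p (r + 2)) (.seq (.op (.realCopy r (r + 2)))
        (.seq (.forLoop i (r + 1) (r + 2)
          (.seq (body.compile (i + 1) (r + 3)) (.op (.realCopy r (r + 3)))))
          (.op (.realCopy d r))))))

theorem agreeOn_bind {vn vr : List ℕ} {s s' : State} (h : AgreeOn vn vr s s') (i r k : ℕ)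
    (acc : ℝ) : AgreeOn (i :: vn) (r :: vr) ((s.setNat i k).setReal r acc)
      ((s'.setNat i k).setReal r acc) := by
  refine ⟨fun j hj => ?_, fun j hj => ?_, h.natArr, h.realArr⟩
  · by_cases hji : j = i
    · simp [State.setReal, State.setNat, hji]
    · simpa [State.setReal, State.setNat, hji] using
        h.nat j (by simpa [hji] using hj)
  · by_cases hji : j = r
    · simp [State.setReal, State.setNat, hji]
    · simpa [State.setReal, State.setNat, hji] using
        h.real j (by simpa [hji] using hj)

theorem eval_cost_congr : ∀ (e : RealExpr) {p d : ℕ} {vn vr : List ℕ} {s s' : State},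
    AgreeOn vn vr s s' → e.ok p d vn vr = true → e.eval s' = e.eval s ∧ e.cost s' = e.cost s
  | var i, _, _, _, _, _, _, h, ho => ⟨h.real i (by simpa [ok] using ho), rfl⟩
  | const _, _, _, _, _, _, _, _, _ => ⟨rfl, rfl⟩
  | cast j, _, _, _, _, _, _, h, ho => ⟨by simp only [eval, j.eval_congr h ho], rfl⟩
  | load a j, _, _, _, _, _, _, h, ho =>
    ⟨by simp only [eval, j.eval_congr h ho, h.realArr], rfl⟩
  | bin o x y, _, _, _, _, _, _, h, ho => by
    simp only [ok, Bool.and_eq_true] at ho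
    have h1 := eval_cost_congr x h ho.1
    have h2 := eval_cost_congr y h ho.2
    exact ⟨by simp only [eval, h1.1, h2.1], by simp only [cost, h1.2, h2.2]⟩
  | exp x, _, _, _, _, _, _, h, ho => by
    have h1 := eval_cost_congr x h ho
    exact ⟨by simp only [eval, h1.1], by simp only [cost, h1.2]⟩
  | ite a b x y, _, _, _, _, _, _, h, ho => by
    simp only [ok, Bool.and_eq_true] at ho
    have h1 := eval_cost_congr a h ho.1.1.1
    have h2 := eval_cost_congr b h ho.1.1.2
    have h3 := eval_cost_congr x h ho.1.2
    have h4 := eval_cost_congr y h ho.2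
    exact ⟨by simp only [eval, h1.1, h2.1, h3.1, h4.1],
      by simp only [cost, h1.1, h1.2, h2.1, h2.2, h3.2, h4.2]⟩
  | fold i r bound init body, _, _, _, _, _, _, h, ho => by
    simp only [ok, Bool.and_eq_true] at ho
    have h1 := eval_cost_congr bound h ho.1.1.2
    have h2 := eval_cost_congr init h ho.1.2
    have h3 := fun k acc => eval_cost_congr body (agreeOn_bind h i r k acc) ho.2
    exact ⟨by simp only [eval, h1.1, h2.1, (h3 _ _).1],
      by simp only [cost, h1.1, h1.2, h2.1, h2.2, (h3 _ _).1, (h3 _ _).2]⟩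

theorem exec_compile {n : ℕ} {Tsp Tct : ℝ → ℕ} {ω : Tape n} : ∀ (e : RealExpr) {p d : ℕ}
    {vn vr : List ℕ} {s : State}, 3 < p → s.nat 3 = 1 → (∀ i ∈ vn, i < p) → (∀ i ∈ vr, i < d) →
    e.ok p d vn vr = true → ∃ t s', Exec Tsp Tct ω (e.compile p d) s t s' ∧ t ≤ e.cost s ∧
      s'.real d = e.eval s ∧ Keeps p d s s'
  | var i, p, d, _, _, s, _, _, _, _, _ =>
    ⟨_, _, .op _ _, by simp [cost], by simp [Instr.apply, State.setReal, eval],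
      (Keeps.refl p d s).setReal le_rfl _⟩
  | const q, p, d, _, _, s, _, _, _, _, _ =>
    ⟨_, _, .op _ _, by simp [cost], by simp [Instr.apply, State.setReal, eval],
      (Keeps.refl p d s).setReal le_rfl _⟩
  | cast j, p, d, _, _, s, _, _, _, _, _ => by
    obtain ⟨s', he, hv, hk⟩ := j.exec_compile (Tsp := Tsp) (Tct := Tct) (ω := ω) (p := p) d s
    exact ⟨_, _, .seq he (.op _ _), by simp [cost],
      by simp [Instr.apply, State.setReal, eval, hv], hk.setReal le_rfl _⟩
  | load a j, p, d, _, _, s, _, _, _, _, _ => by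
    obtain ⟨s', he, hv, hk⟩ := j.exec_compile (Tsp := Tsp) (Tct := Tct) (ω := ω) (p := p) d s
    exact ⟨_, _, .seq he (.op _ _), by simp [cost],
      by simp [Instr.apply, State.setReal, eval, hv, hk.realArr], hk.setReal le_rfl _⟩
  | bin o x y, p, d, vn, vr, s, hp, h1, hn, hr, ho => by
    simp only [ok, Bool.and_eq_true] at ho
    obtain ⟨t, s', he, ht, hv, hk⟩ := exec_compile x hp h1 hn hr ho.1
    obtain ⟨t2, s2, he2, ht2, hv2, hk2⟩ := exec_compile y (s := s') hp (by rw [hk.nat 3 hp, h1]) hn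
      (fun i hi => (hr i hi).trans (by omega)) ho.2
    have hc := eval_cost_congr y (hk.agreeOn hn hr) ho.2
    refine ⟨_, _, .seq he (.seq he2 (.op _ _)), by simp only [cost]; omega, ?_, ?_⟩
    · cases o <;> simp [BinOp.instr, BinOp.eval, Instr.apply, State.setReal, eval, hv2, hc.1,
        hk2.real d (by omega), hv]
    · have := hk.trans (hk2.mono le_rfl (by omega))
      cases o <;> exact this.setReal le_rfl _
  | exp x, p, d, vn, vr, s, hp, h1, hn, hr, ho => by
    obtain ⟨t, s', he, ht, hv, hk⟩ := exec_compile x hp h1 hn hr ho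
    exact ⟨_, _, .seq he (.op _ _), by simp only [cost]; omega,
      by simp [Instr.apply, State.setReal, eval, hv], hk.setReal le_rfl _⟩
  | ite a b x y, p, d, vn, vr, s, hp, h1, hn, hr, ho => by
    simp only [ok, Bool.and_eq_true] at ho
    obtain ⟨t, s', he, ht, hv, hk⟩ := exec_compile a hp h1 hn hr ho.1.1.1
    obtain ⟨t2, s2, he2, ht2, hv2, hk2⟩ := exec_compile b (s := s') hp (by rw [hk.nat 3 hp, h1]) hn
      (fun i hi => (hr i hi).trans (by omega)) ho.1.1.2
    have hcb := eval_cost_congr b (hk.agreeOn hn hr) ho.1.1.2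
    have hk' := hk.trans (hk2.mono le_rfl (by omega))
    have hcx := eval_cost_congr x (hk'.agreeOn hn hr) ho.1.2
    have hcy := eval_cost_congr y (hk'.agreeOn hn hr) ho.2
    have h3 : s2.nat 3 = 1 := by rw [hk'.nat 3 hp, h1]
    have htest : (Test.realLE d (d + 1)).holds s2 ↔ a.eval s ≤ b.eval s := by
      simp [Test.holds, hv2, hcb.1, hk2.real d (by omega), hv]
    by_cases hab : a.eval s ≤ b.eval s
    · obtain ⟨t3, s3, he3, ht3, hv3, hk3⟩ := exec_compile x (s := s2) hp h3 hn hr ho.1.2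
      refine ⟨_, _, .seq he (.seq he2 (.branch_true (htest.2 hab) he3)), ?_, ?_, hk'.trans hk3⟩
      · simp only [cost, hab, if_true]; omega
      · simp only [eval, hab, if_true, hv3, hcx.1]
    · obtain ⟨t3, s3, he3, ht3, hv3, hk3⟩ := exec_compile y (s := s2) hp h3 hn hr ho.2
      refine ⟨_, _, .seq he (.seq he2 (.branch_false (fun h => hab (htest.1 h)) he3)), ?_, ?_,
        hk'.trans hk3⟩
      · simp only [cost, hab, if_false]; omega
      · simp only [eval, hab, if_false, hv3, hcy.1]
  | fold i r bound init body, p, d, vn, vr, s, hp, h1, hn, hr, ho => by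
    simp only [ok, Bool.and_eq_true, decide_eq_true_eq] at ho
    obtain ⟨⟨⟨⟨hpi, hdr⟩, hob⟩, hoi⟩, hoy⟩ := ho
    obtain ⟨t, s₁, he, ht, hv, hk⟩ := exec_compile bound hp h1 hn hr hob
    have hk₁ : Keeps p d s (s₁.setReal (r + 1) (s₁.real d)) := hk.setReal (by omega) _
    obtain ⟨t2, s₂, he2, ht2, hv2, hk2⟩ := exec_compile init
      (s := s₁.setReal (r + 1) (s₁.real d)) hp (by rw [hk₁.nat 3 hp, h1]) hn
      (fun i hi => (hr i hi).trans (by omega)) hoi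
    have hci := eval_cost_congr init (hk₁.agreeOn hn hr) hoi
    have hk₂ : Keeps p d s (s₂.setReal r (s₂.real (r + 2))) :=
      (hk₁.trans (hk2.mono le_rfl (by omega))).setReal hdr _
    have hT : s₂.real (r + 1) = bound.eval s := by
      rw [hk2.real _ (by omega), ← hv]; simp [State.setReal]
    let f : ℕ → ℝ → ℝ := fun k acc => body.eval ((s.setNat i k).setReal r acc)
    let Inv : ℕ → State → Prop := fun k st => st.nat i = k ∧ st.real (r + 2) = k ∧
      st.real (r + 1) = bound.eval s ∧ st.real r = iter (init.eval s) f k ∧ Keeps p d s st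
    obtain ⟨t4, s₄, he4, ht4, hI⟩ := exec_forLoop (Tsp := Tsp) (Tct := Tct) (ω := ω) (i := i)
      (b := r + 1) (c := r + 2)
      (body := .seq (body.compile (i + 1) (r + 3)) (.op (.realCopy r (r + 3)))) (Inv := Inv)
      (x := bound.eval s)
      (B := fun k => body.cost ((s.setNat i k).setReal r (iter (init.eval s) f k)) + 1)
      (s := s₂.setReal r (s₂.real (r + 2))) (fun k st h => ⟨h.2.1, h.2.2.1⟩)
      (by
        refine ⟨by simp [State.setNat, State.setReal], by simp [State.setNat, State.setReal], ?_, ?_,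
          (hk₂.setNat hpi _).setReal (by omega) _⟩
        · simp [State.setNat, State.setReal, hT]
        · simpa [State.setNat, State.setReal, hv2, iter] using hci.1)
      (by
        rintro k st hk' ⟨hI1, hI2, hI3, hI4, hI5⟩
        have hag : AgreeOn (i :: vn) (r :: vr)
            ((s.setNat i k).setReal r (iter (init.eval s) f k)) st := by
          have hA := hI5.agreeOn hn hr
          refine ⟨fun j hj => ?_, fun j hj => ?_, hA.natArr, hA.realArr⟩
          · by_cases hji : j = i
            · simp [State.setReal, State.setNat, hji, hI1]
            · simpa [State.setReal, State.setNat, hji] using hA.nat j (by simpa [hji] using hj)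
          · by_cases hji : j = r
            · simp [State.setReal, State.setNat, hji, hI4]
            · simpa [State.setReal, State.setNat, hji] using hA.real j (by simpa [hji] using hj)
        obtain ⟨t5, s₅, he5, ht5, hv5, hk5⟩ := exec_compile body (p := i + 1) (d := r + 3)
          (s := st) (by omega) (by rw [hI5.nat 3 hp, h1])
          (by
            intro j hj
            rcases List.mem_cons.1 hj with rfl | hj
            · omega
            · have := hn j hj; omega)
          (by
            intro j hj
            rcases List.mem_cons.1 hj with rfl | hj
            · omega
            · have := hr j hj; omega) hoy
        have hcb := eval_cost_congr body hag hoy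
        have hk6 : Keeps p d s (s₅.setReal r (s₅.real (r + 3))) :=
          (hI5.trans (hk5.mono (by omega) (by omega))).setReal hdr _
        refine ⟨_, _, .seq he5 (.op _ _), by rw [hcb.2] at ht5; omega, ?_, ?_, ?_⟩
        · show (s₅.setReal r (s₅.real (r + 3))).nat 3 = 1
          rw [hk6.nat 3 hp, h1]
        · show s₅.nat i = k
          rw [hk5.nat i (by omega), hI1]
        · refine ⟨by simp [State.setNat, State.setReal], by simp [State.setNat, State.setReal],
            ?_, ?_, (hk6.setNat hpi _).setReal (by omega) _⟩
          · simp [State.setNat, State.setReal, Instr.apply, hk5.real (r + 1) (by omega), hI3]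
          · simp [State.setNat, State.setReal, Instr.apply, hv5, hcb.1, iter, f])
    obtain ⟨hI1, hI2, hI3, hI4, hI5⟩ := hI
    refine ⟨_, _, .seq he (.seq (.op _ _) (.seq he2 (.seq (.op _ _) (.seq he4 (.op _ _))))), ?_, ?_,
      hI5.setReal le_rfl _⟩
    · have h9 : ∑ k ∈ Finset.range ⌈bound.eval s⌉₊,
          (body.cost ((s.setNat i k).setReal r (iter (init.eval s) f k)) + 1 + 3) =
          ∑ k ∈ Finset.range ⌈bound.eval s⌉₊,
          (4 + body.cost ((s.setNat i k).setReal r (iter (init.eval s) f k))) :=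
        Finset.sum_congr rfl fun _ _ => by omega
      rw [h9] at ht4
      rw [hci.2] at ht2
      show _ ≤ bound.cost s + init.cost s + 6 + ∑ k ∈ Finset.range ⌈bound.eval s⌉₊,
          (4 + body.cost ((s.setNat i k).setReal r (iter (init.eval s) f k)))
      omega
    · simp [State.setReal, Instr.apply, hI4, eval, f]

/-- A bound for the cost: loops whose bound is index register `0` or `1` are counted `n` or `m`
times, and the other ones `K` times. -/
def costBound (n m K : ℕ) : RealExpr → ℕ
  | var _ => 1
  | const _ => 1
  | cast j => j.cost + 1
  | load _ j => j.cost + 1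
  | bin _ x y => x.costBound n m K + y.costBound n m K + 1
  | exp x => x.costBound n m K + 1
  | ite a b x y => a.costBound n m K + b.costBound n m K + 1 +
      (x.costBound n m K + y.costBound n m K)
  | fold _ _ bound init body => bound.costBound n m K + init.costBound n m K + 6 +
      (match bound with
        | cast (.var 0) => n
        | cast (.var 1) => m
        | _ => K) * (4 + body.costBound n m K)

/-- The loop bounds are index registers `0` and `1`, which are not modified, real registers among
`l`, which are not modified, or the constant `1`. -/
def boundsOk (l : List ℕ) : RealExpr → Bool
  | var _ => true
  | const _ => true
  | cast _ => true
  | load _ _ => true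
  | bin _ x y => x.boundsOk l && y.boundsOk l
  | exp x => x.boundsOk l
  | ite a b x y => a.boundsOk l && b.boundsOk l && x.boundsOk l && y.boundsOk l
  | fold i r bound init body => decide (2 ≤ i) && decide (r ∉ l) && bound.boundsOk l &&
      init.boundsOk l && body.boundsOk l && (match bound with
        | cast (.var 0) => true
        | cast (.var 1) => true
        | var j => decide (j ∈ l)
        | const q => decide (q = 1)
        | _ => false)

theorem cost_le_costBound {n m K : ℕ} (hK : 1 ≤ K) {l : List ℕ} : ∀ (e : RealExpr) {s : State},
    s.nat 0 = n → s.nat 1 = m → (∀ j ∈ l, ⌈s.real j⌉₊ ≤ K) → e.boundsOk l = true →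
    e.cost s ≤ e.costBound n m K
  | var i, _, _, _, _, _ => le_rfl
  | const _, _, _, _, _, _ => le_rfl
  | cast j, _, _, _, _, _ => le_rfl
  | load a j, _, _, _, _, _ => le_rfl
  | bin o x y, _, h0, h1, hl, hb => by
    simp only [boundsOk, Bool.and_eq_true] at hb
    have := cost_le_costBound hK x h0 h1 hl hb.1
    have := cost_le_costBound hK y h0 h1 hl hb.2
    simp only [cost, costBound]; omega
  | exp x, _, h0, h1, hl, hb => by
    have := cost_le_costBound hK x h0 h1 hl hb
    simp only [cost, costBound]; omega
  | ite a b x y, _, h0, h1, hl, hb => by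
    simp only [boundsOk, Bool.and_eq_true] at hb
    have := cost_le_costBound hK a h0 h1 hl hb.1.1.1
    have := cost_le_costBound hK b h0 h1 hl hb.1.1.2
    have := cost_le_costBound hK x h0 h1 hl hb.1.2
    have := cost_le_costBound hK y h0 h1 hl hb.2
    simp only [cost, costBound]; split <;> omega
  | fold i r bound init body, s, h0, h1, hl, hb => by
    simp only [boundsOk, Bool.and_eq_true, decide_eq_true_eq] at hb
    obtain ⟨⟨⟨⟨⟨hi, hr⟩, hbb⟩, hbi⟩, hby⟩, hbo⟩ := hb
    have hB := cost_le_costBound hK bound h0 h1 hl hbb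
    have hI := cost_le_costBound hK init h0 h1 hl hbi
    have hY : ∀ k acc, body.cost ((s.setNat i k).setReal r acc) ≤ body.costBound n m K := by
      intro k acc
      refine cost_le_costBound hK body ?_ ?_ ?_ hby
      · simpa [State.setReal, State.setNat, Function.update_of_ne (show 0 ≠ i by omega)] using h0
      · simpa [State.setReal, State.setNat, Function.update_of_ne (show 1 ≠ i by omega)] using h1
      · intro j hj
        have : j ≠ r := fun h => hr (h ▸ hj)
        simpa [State.setReal, State.setNat, this] using hl j hj
    have hS := Finset.sum_le_card_nsmul (Finset.range ⌈bound.eval s⌉₊)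
      (fun k => 4 + body.cost ((s.setNat i k).setReal r
        (iter (init.eval s) (fun k acc => body.eval ((s.setNat i k).setReal r acc)) k)))
      (4 + body.costBound n m K) (fun k _ => by have := hY k; simpa using this _)
    rw [Finset.card_range, smul_eq_mul] at hS
    simp only [cost, costBound]
    refine Nat.add_le_add (by omega) (hS.trans (Nat.mul_le_mul_right _ ?_))
    split at hbo
    · simp [eval, IdxExpr.eval, h0]
    · simp [eval, IdxExpr.eval, h1]
    · exact hl _ (by simpa using hbo)
    · rename_i q
      have : q = (1 : ℚ) := by simpa using hbo
      simpa [eval, this] using hK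
    · simp at hbo

end RealExpr

/-! ### Statements -/

theorem exec_expr {n : ℕ} {Tsp Tct : ℝ → ℕ} {ω : Tape n} {e : RealExpr}
    (ho : e.ok 10 20 (List.range 10) (List.range 20) = true) {s : State} (h1 : s.nat 3 = 1) :
    ∃ t s', Exec Tsp Tct ω (e.compile 10 20) s t s' ∧ t ≤ e.cost s ∧ s'.real 20 = e.eval s ∧
      Keeps 10 20 s s' :=
  e.exec_compile (by norm_num) h1 (by simp) (by simp) ho

/-- `real r := e` -/
def Prog.assign (r : ℕ) (e : RealExpr) : Prog := .seq (e.compile 10 20) (.op (.realCopy r 20))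

theorem exec_assign {n : ℕ} {Tsp Tct : ℝ → ℕ} {ω : Tape n} (r : ℕ) {e : RealExpr}
    (ho : e.ok 10 20 (List.range 10) (List.range 20) = true) {s : State} (h1 : s.nat 3 = 1) :
    ∃ t s', Exec Tsp Tct ω (.assign r e) s t s' ∧ t ≤ e.cost s + 1 ∧
      Keeps 10 20 (s.setReal r (e.eval s)) s' := by
  obtain ⟨t, s', he, ht, hv, hk⟩ := exec_expr (Tsp := Tsp) (Tct := Tct) (ω := ω) ho h1
  refine ⟨_, _, .seq he (.op _ _), by omega, ?_⟩
  refine ⟨hk.nat, fun i hi => ?_, hk.natArr, hk.realArr, hk.calls⟩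
  simp only [Instr.apply, State.setReal, hv]
  by_cases hir : i = r
  · subst hir; simp
  · simp [hir, hk.real i hi]

theorem iter_add (g : ℕ → ℝ) (x : ℝ) (K : ℕ) :
    iter x (fun k acc => acc + g k) K = x + ∑ k ∈ Finset.range K, g k := by
  induction K with
  | zero => simp [iter]
  | succ K ih => rw [iter, ih, Finset.sum_range_succ, add_assoc]

theorem iter_mul (g : ℕ → ℝ) (x : ℝ) (K : ℕ) :
    iter x (fun k acc => acc * g k) K = x * ∏ k ∈ Finset.range K, g k := by
  induction K with
  | zero => simp [iter]
  | succ K ih => rw [iter, ih, Finset.prod_range_succ, mul_assoc]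

theorem iter_congr {f g : ℕ → ℝ → ℝ} {K : ℕ} (h : ∀ k < K, ∀ x, f k x = g k x) (x : ℝ) :
    iter x f K = iter x g K := by
  induction K with
  | zero => rfl
  | succ K ih => rw [iter, iter, ih fun k hk => h k (by omega), h K (by omega)]

/-! ### The main loop -/

namespace RealExpr

def zero : RealExpr := const 0
def one : RealExpr := const 1
def add (x y : RealExpr) : RealExpr := bin .add x y
def sub (x y : RealExpr) : RealExpr := bin .sub x y
def mul (x y : RealExpr) : RealExpr := bin .mul x y
def div (x y : RealExpr) : RealExpr := bin .div x y

/-- `∑ i < bound, x`, where the index is in register `i` and the partial sum in register `r`. -/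
def sum (i r : ℕ) (bound x : RealExpr) : RealExpr := fold i r bound zero (add (var r) x)

/-- `∏ i < bound, x`. -/
def prod (i r : ℕ) (bound x : RealExpr) : RealExpr := fold i r bound one (mul (var r) x)

def max0 (x : RealExpr) : RealExpr := ite zero x x zero

end RealExpr

open RealExpr in
/-- `real 1` is the marginal bound on entry and becomes the parameter `β`. -/
def betaExpr : RealExpr := div (mul (mul (var 1) (var 1)) (mul (var 1) (var 1))) (const 16)

open RealExpr in
def sampleErrExpr : RealExpr :=
  div (mul (mul (var 0) (var 0)) (mul (var 1) (var 1))) (mul (const 4194304) (mul (var 3) (var 3)))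

open RealExpr in
def sampleSizeExpr : RealExpr :=
  div (mul (const 65536) (mul (var 3) (var 3))) (mul (mul (var 0) (var 0)) (mul (var 1) (var 1)))

open RealExpr in
def countErrExpr : RealExpr := div (mul (var 0) (var 1)) (mul (const 64) (var 3))

open RealExpr in
/-- The mean of the stored ratios. -/
def meanExpr : RealExpr := div (sum 10 20 (var 5) (load 4 (.var 10))) (var 6)

open RealExpr in
def estimateExpr : RealExpr :=
  div (sum 10 20 (var 5) (max0 (sub one (div (load 4 (.var 10)) (var 8))))) (var 6)

/-- Draw a sample of `mu` and store its likelihood ratio. -/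
def sampleStep (ratio : RealExpr) : Prog :=
  .seq (.sample .mu 4 4) (.seq (ratio.compile 10 20) (.op (.realStore 4 6 20)))

/-- The estimate of the ratio of the partition functions. -/
def ratioProg : Prog :=
  .seq (.assign 7 (.const (1 / 4))) (.branch (.realLE 2 7) (.assign 8 meanExpr)
    (.seq (.assign 9 countErrExpr) (.seq (.count .mu 9 10) (.seq (.count .nu 9 11)
      (.op (.realDiv 8 11 10))))))

/-- The algorithm after the preprocessing: real registers `0`, `1`, `2`, `3` hold the error bound,
the marginal bound, the distance of the parameters and the size, and `ratio` computes the
likelihood ratio of the sample in index array `4`. -/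
def mainProg (ratio : RealExpr) : Prog :=
  .seq (.assign 1 betaExpr) (.seq (.assign 4 sampleErrExpr) (.seq (.assign 5 sampleSizeExpr)
    (.seq (.forLoop 6 5 6 (sampleStep ratio)) (.seq ratioProg (.assign 0 estimateExpr)))))

/-- Agreement on the input. -/
structure SameInput (s s' : State) : Prop where
  nat : ∀ i < 4, s'.nat i = s.nat i
  natArr : ∀ a < 4, s'.natArr a = s.natArr a
  realArr : ∀ a < 4, s'.realArr a = s.realArr a

theorem SameInput.refl (s : State) : SameInput s s :=
  ⟨fun _ _ => rfl, fun _ _ => rfl, fun _ _ => rfl⟩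

theorem SameInput.keeps {s s₁ s₂ : State} (h : SameInput s s₁) {d : ℕ} (hk : Keeps 10 d s₁ s₂) :
    SameInput s s₂ :=
  ⟨fun i hi => (hk.nat i (by omega)).trans (h.nat i hi),
    fun a ha => by rw [hk.natArr, h.natArr a ha], fun a ha => by rw [hk.realArr, h.realArr a ha]⟩

theorem SameInput.setReal {s s₁ : State} (h : SameInput s s₁) (i : ℕ) (x : ℝ) :
    SameInput s (s₁.setReal i x) := ⟨h.nat, h.natArr, h.realArr⟩

theorem SameInput.setNat {s s₁ : State} (h : SameInput s s₁) {i : ℕ} (hi : 4 ≤ i) (x : ℕ) :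
    SameInput s (s₁.setNat i x) :=
  ⟨fun j hj => by
    simp only [State.setNat, Function.update_of_ne (show j ≠ i by omega), h.nat j hj],
    h.natArr, h.realArr⟩

theorem eval_meanExpr {n : ℕ} {ω : Tape n} {s : State} {δ : ℝ} {K : ℕ} {ρ : Config n → ℝ}
    (h5 : ⌈s.real 5⌉₊ = K) (h6 : s.real 6 = K)
    (hρ : ∀ j < K, s.realArr 4 j = ρ (ω.sampleAt δ j)) :
    meanExpr.eval s = ω.mean δ K ρ := by
  simp only [meanExpr, RealExpr.div, RealExpr.eval, RealExpr.sum, RealExpr.add, RealExpr.zero,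
    BinOp.eval, h5, h6, IdxExpr.eval, State.setReal, State.setNat, Function.update_self]
  rw [iter_add, Tape.mean, Finset.sum_congr rfl fun j hj => hρ j (Finset.mem_range.1 hj)]
  simp

theorem eval_estimateExpr {n : ℕ} {ω : Tape n} {s : State} {δ : ℝ} {K : ℕ} {ρ : Config n → ℝ}
    (h5 : ⌈s.real 5⌉₊ = K) (h6 : s.real 6 = K)
    (hρ : ∀ j < K, s.realArr 4 j = ρ (ω.sampleAt δ j)) :
    estimateExpr.eval s = ω.estimate δ K ρ (s.real 8) := by
  simp only [estimateExpr, RealExpr.div, RealExpr.eval, RealExpr.sum, RealExpr.add, RealExpr.zero,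
    BinOp.eval, h5, h6, IdxExpr.eval, State.setReal, State.setNat, Function.update_self,
    RealExpr.max0, RealExpr.sub, RealExpr.one,
    Function.update_of_ne (show (8 : ℕ) ≠ 20 by norm_num)]
  rw [Tape.estimate, Tape.mean, iter_add]
  congr 1
  simp only [Rat.cast_zero, zero_add, Rat.cast_one]
  refine Finset.sum_congr rfl fun j hj => ?_
  rw [hρ j (Finset.mem_range.1 hj), deficit, max_def]

theorem costBound_meanExpr (n m K : ℕ) : meanExpr.costBound n m K = 10 + 8 * K := by
  simp only [meanExpr, RealExpr.costBound, RealExpr.div, RealExpr.sum, RealExpr.zero, RealExpr.add,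
    IdxExpr.cost]
  ring

theorem costBound_estimateExpr (n m K : ℕ) : estimateExpr.costBound n m K = 10 + 21 * K := by
  simp only [estimateExpr, RealExpr.costBound, RealExpr.div, RealExpr.sum, RealExpr.zero,
    RealExpr.add, RealExpr.max0, RealExpr.sub, RealExpr.one, IdxExpr.cost]
  ring

theorem exec_sampleLoop {n : ℕ} {Tsp Tct : ℝ → ℕ} {ω : Tape n} {ratio : RealExpr}
    (ho : ratio.ok 10 20 (List.range 10) (List.range 20) = true) {s₀ s : State} {B : ℕ}
    {ρ : Config n → ℝ} (hs : SameInput s₀ s) (h3 : s₀.nat 3 = 1) (hc : s.calls = 0)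
    (hδ : s.real 4 ∈ Set.Ioo (0 : ℝ) 1)
    (hρ : ∀ (σ : Config n) (s' : State), SameInput s₀ s' →
      (∀ v : Fin n, s'.natArr 4 v = (σ v).toNat) → ratio.eval s' = ρ σ ∧ ratio.cost s' ≤ B) :
    ∃ t s', Exec Tsp Tct ω (.forLoop 6 5 6 (sampleStep ratio)) s t s' ∧
      t ≤ 3 + ⌈s.real 5⌉₊ * (Tsp (s.real 4) + B + 5) ∧ SameInput s₀ s' ∧
      (∀ i < 6, s'.real i = s.real i) ∧ s'.real 6 = ⌈s.real 5⌉₊ ∧ s'.calls = ⌈s.real 5⌉₊ ∧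
      ∀ j < ⌈s.real 5⌉₊, s'.realArr 4 j = ρ (ω.sampleAt (s.real 4) j) := by
  have h := exec_forLoop (Tsp := Tsp) (Tct := Tct) (ω := ω) (i := 6) (b := 5) (c := 6)
    (body := sampleStep ratio) (x := s.real 5) (B := fun _ => Tsp (s.real 4) + B + 2) (s := s)
    (Inv := fun k st => st.nat 6 = k ∧ st.real 6 = k ∧ SameInput s₀ st ∧
      (∀ i < 6, st.real i = s.real i) ∧ st.calls = k ∧
      ∀ j < k, st.realArr 4 j = ρ (ω.sampleAt (s.real 4) j))
    (fun k st h => ⟨h.2.1, h.2.2.2.1 5 (by norm_num)⟩)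
    (by
      refine ⟨by simp [State.setNat, State.setReal], by simp [State.setNat, State.setReal],
        (hs.setNat (i := 6) (by norm_num) _).setReal _ _, fun i hi => ?_, hc, by simp⟩
      simp [State.setNat, State.setReal, hi.ne])
    (by
      rintro k st hk ⟨i1, i2, i3, i4, i5, i6⟩
      have e4 := i4 4 (by norm_num)
      have i3' : SameInput s₀ ((st.setConfig 4 (ω.2.1 (st.calls, .mu, st.real 4))).nextCall) :=
        ⟨i3.nat, fun a ha => by
          simp [State.setConfig, State.nextCall, ha.ne, i3.natArr a ha], i3.realArr⟩
      obtain ⟨r1, r2⟩ := hρ (ω.sampleAt (s.real 4) k) _ i3' (fun v => by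
        simp [State.setConfig, State.nextCall, i5, e4, Tape.sampleAt])
      obtain ⟨t, s', he, ht, hv, hk'⟩ := exec_expr (Tsp := Tsp) (Tct := Tct) (ω := ω) ho
        (s := (st.setConfig 4 (ω.2.1 (st.calls, .mu, st.real 4))).nextCall)
        (by rw [i3'.nat 3 (by norm_num), h3])
      have i3'' := i3'.keeps hk'
      have hn6 : s'.nat 6 = k := by rw [hk'.nat 6 (by norm_num), ← i1]; rfl
      refine ⟨_, _, .seq (.sample .mu 4 4 st (by rw [e4]; exact hδ)) (.seq he (.op _ _)), ?_, ?_,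
        ?_, by simp [State.setNat, State.setReal], by simp [State.setNat, State.setReal], ?_, ?_,
        ?_, ?_⟩
      · rw [e4]; omega
      · show s'.nat 3 = 1
        rw [i3''.nat 3 (by norm_num), h3]
      · exact hn6
      · have i7 : SameInput s₀ ((Instr.realStore 4 6 20).apply s') :=
          ⟨i3''.nat, i3''.natArr, fun a ha => by
            simp [Instr.apply, State.setRealArr, ha.ne, i3''.realArr a ha]⟩
        exact (i7.setNat (i := 6) (by norm_num) _).setReal _ _
      · intro i hi
        have : s'.real i = s.real i := by rw [hk'.real i (by omega), ← i4 i hi]; rfl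
        simp [State.setNat, State.setReal, Instr.apply, State.setRealArr, hi.ne, this]
      · simp [State.setNat, State.setReal, Instr.apply, State.setRealArr, hk'.calls,
          State.nextCall, State.setConfig, i5]
      · intro j hj
        simp only [State.setNat, State.setReal, Instr.apply, State.setRealArr, hn6,
          Function.update_self]
        by_cases hjk : j = k
        · subst hjk
          rw [Function.update_self, hv, r1]
        · rw [Function.update_of_ne hjk, hk'.realArr]
          exact i6 j (by omega))
  obtain ⟨t, s', he, ht, i1, i2, i3, i4, i5, i6⟩ := h
  refine ⟨t, s', he, ht.trans ?_, i3, i4, i2, i5, i6⟩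
  simp [add_assoc]

/-- The result of the program for given random answers. -/
def mainOutput {n : ℕ} (ω : Tape n) (δ δ' κ : ℝ) (K : ℕ) (ρ : Config n → ℝ) : ℝ :=
  ω.estimate δ K ρ (if κ ≤ 1 / 4 then ω.mean δ K ρ else
    ω.2.2 (K + 1, .nu, δ') / ω.2.2 (K, .mu, δ'))

theorem exec_ratioProg {n : ℕ} {Tsp Tct : ℝ → ℕ} {ω : Tape n} {s : State} {δ : ℝ} {K : ℕ}
    {ρ : Config n → ℝ} (h3 : s.nat 3 = 1) (hc : s.calls = K) (hK : 0 < K)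
    (h5 : ⌈s.real 5⌉₊ = K) (h6 : s.real 6 = K)
    (hρ : ∀ j < K, s.realArr 4 j = ρ (ω.sampleAt δ j))
    (hδ' : countErr (s.real 3) (s.real 0) (s.real 1) ∈ Set.Ioo (0 : ℝ) 1) :
    ∃ t s', Exec Tsp Tct ω ratioProg s t s' ∧
      t ≤ 50 + 10 * K + 2 * Tct (countErr (s.real 3) (s.real 0) (s.real 1)) ∧
      s'.real 8 = (if s.real 2 ≤ 1 / 4 then ω.mean δ K ρ else
        ω.2.2 (K + 1, .nu, countErr (s.real 3) (s.real 0) (s.real 1)) /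
          ω.2.2 (K, .mu, countErr (s.real 3) (s.real 0) (s.real 1))) ∧
      s'.realArr = s.realArr ∧ s'.real 5 = s.real 5 ∧ s'.real 6 = s.real 6 ∧ s'.nat 3 = 1 := by
  set δ' := countErr (s.real 3) (s.real 0) (s.real 1) with hδd
  obtain ⟨t, s₁, he, ht, hk⟩ := exec_assign (Tsp := Tsp) (Tct := Tct) (ω := ω) 7
    (e := .const (1 / 4)) rfl h3
  have r7 : s₁.real 7 = 1 / 4 := by
    rw [hk.real 7 (by norm_num)]; simp [State.setReal, RealExpr.eval]
  have rr : ∀ i < 7, s₁.real i = s.real i := fun i hi => by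
    rw [hk.real i (by omega)]; simp [State.setReal, hi.ne]
  have n3 : s₁.nat 3 = 1 := by rw [hk.nat 3 (by norm_num), ← h3]; rfl
  have ra : s₁.realArr = s.realArr := hk.realArr
  have t1 : t ≤ 2 := ht.trans (by simp [RealExpr.cost])
  by_cases hκ : s.real 2 ≤ 1 / 4
  · obtain ⟨t2, s₂, he2, ht2, hk2⟩ := exec_assign (Tsp := Tsp) (Tct := Tct) (ω := ω) 8
      (e := meanExpr) rfl n3
    have hcost := RealExpr.cost_le_costBound (n := s₁.nat 0) (m := s₁.nat 1) (K := K) hK (l := [5])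
      meanExpr (s := s₁) rfl rfl
      (fun j hj => by rw [List.mem_singleton.1 hj, rr 5 (by norm_num), h5]) rfl
    refine ⟨_, s₂, .seq he (.branch_true ?_ he2), ?_, ?_, ?_, ?_, ?_, ?_⟩
    · simpa [Test.holds, r7, rr] using hκ
    · rw [costBound_meanExpr] at hcost
      omega
    · rw [if_pos hκ, hk2.real 8 (by norm_num)]
      simp only [State.setReal, Function.update_self]
      exact eval_meanExpr (by rw [rr 5 (by norm_num), h5]) (by rw [rr 6 (by norm_num), h6])
        (by rw [ra]; exact hρ)
    · exact hk2.realArr.trans ra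
    · rw [hk2.real 5 (by norm_num), ← rr 5 (by norm_num)]; simp [State.setReal]
    · rw [hk2.real 6 (by norm_num), ← rr 6 (by norm_num)]; simp [State.setReal]
    · rw [hk2.nat 3 (by norm_num), ← n3]; rfl
  · obtain ⟨t2, s₂, he2, ht2, hk2⟩ := exec_assign (Tsp := Tsp) (Tct := Tct) (ω := ω) 9
      (e := countErrExpr) rfl n3
    have r9 : s₂.real 9 = δ' := by
      rw [hk2.real 9 (by norm_num), hδd]
      simp [State.setReal, countErrExpr, RealExpr.eval, BinOp.eval, RealExpr.div, RealExpr.mul, rr,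
        countErr]
    have hcost : countErrExpr.cost s₁ = 7 := by
      simp [countErrExpr, RealExpr.cost, RealExpr.div, RealExpr.mul]
    have c2 : s₂.calls = K := hk2.calls.trans (hk.calls.trans hc)
    refine ⟨_, _, .seq he (.branch_false ?_ (.seq he2 (.seq (.count .mu 9 10 _ ?_)
      (.seq (.count .nu 9 11 _ ?_) (.op _ _))))), ?_, ?_, ?_, ?_, ?_, ?_⟩
    · simpa [Test.holds, r7, rr] using hκ
    · rw [r9]; exact hδ'
    · simpa [State.nextCall, State.setReal, r9] using hδ'
    · simp only [State.nextCall, State.setReal, r9, ne_eq, Nat.reduceEqDiff, not_false_eq_true,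
        Function.update_of_ne]
      omega
    · rw [if_neg hκ]
      simp [Instr.apply, State.nextCall, State.setReal, r9, c2]
    · exact hk2.realArr.trans ra
    · rw [← rr 5 (by norm_num)]
      have := hk2.real 5 (by norm_num)
      simp only [Instr.apply, State.nextCall, State.setReal] at this ⊢
      simpa using this
    · rw [← rr 6 (by norm_num)]
      have := hk2.real 6 (by norm_num)
      simp only [Instr.apply, State.nextCall, State.setReal] at this ⊢
      simpa using this
    · have := hk2.nat 3 (by norm_num)
      simpa [Instr.apply, State.nextCall, State.setReal, n3] using this

theorem exec_mainProg {n : ℕ} {Tsp Tct : ℝ → ℕ} {ω : Tape n} {ratio : RealExpr}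
    (ho : ratio.ok 10 20 (List.range 10) (List.range 20) = true) {s₀ s : State} {B : ℕ}
    {ρ : Config n → ℝ} (hs : SameInput s₀ s) (h3 : s₀.nat 3 = 1) (hc : s.calls = 0)
    {N ε b κ : ℝ} (r0 : s.real 0 = ε) (r1 : s.real 1 = b) (r2 : s.real 2 = κ) (r3 : s.real 3 = N)
    (hN : 1 ≤ N) (h0 : 0 < ε) (h1 : ε < 1) (hb : 0 < b) (hb1 : b ≤ 1)
    (hρ : ∀ (σ : Config n) (s' : State), SameInput s₀ s' →
      (∀ v : Fin n, s'.natArr 4 v = (σ v).toNat) → ratio.eval s' = ρ σ ∧ ratio.cost s' ≤ B) :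
    ∃ t s', Exec Tsp Tct ω (mainProg ratio) s t s' ∧
      t ≤ 200 + ⌈sampleSize N ε (b ^ 4 / 16)⌉₊ * (Tsp (sampleErr N ε (b ^ 4 / 16)) + B + 100) +
        2 * Tct (countErr N ε (b ^ 4 / 16)) ∧
      s'.real 0 = mainOutput ω (sampleErr N ε (b ^ 4 / 16)) (countErr N ε (b ^ 4 / 16)) κ
        ⌈sampleSize N ε (b ^ 4 / 16)⌉₊ ρ := by
  have hβ : 0 < b ^ 4 / 16 := by positivity
  have hβ1 : b ^ 4 / 16 ≤ 1 := by
    have := pow_le_one₀ (n := 4) hb.le hb1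
    linarith
  set β := b ^ 4 / 16 with hβd
  have hδ := sampleErr_mem hN h0 h1 hβ hβ1
  have hδ' := countErr_mem hN h0 h1 hβ hβ1
  have hT := one_le_sampleSize hN h0 h1 hβ hβ1
  have n3 : s.nat 3 = 1 := by rw [hs.nat 3 (by norm_num), h3]
  obtain ⟨t₁, s₁, he₁, ht₁, hk₁⟩ := exec_assign (Tsp := Tsp) (Tct := Tct) (ω := ω) 1
    (e := betaExpr) rfl n3
  have hs₁ := (hs.setReal 1 (betaExpr.eval s)).keeps hk₁
  have v1 : s₁.real 1 = β := by
    rw [hk₁.real 1 (by norm_num)]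
    simp [State.setReal, betaExpr, RealExpr.eval, BinOp.eval, RealExpr.div, RealExpr.mul, r1, hβd]
    ring
  have q1 : ∀ i < 20, i ≠ 1 → s₁.real i = s.real i := fun i hi hne => by
    rw [hk₁.real i hi]; simp [State.setReal, hne]
  obtain ⟨t₂, s₂, he₂, ht₂, hk₂⟩ := exec_assign (Tsp := Tsp) (Tct := Tct) (ω := ω) 4
    (e := sampleErrExpr) (s := s₁) rfl (by rw [hs₁.nat 3 (by norm_num), h3])
  have hs₂ := (hs₁.setReal 4 (sampleErrExpr.eval s₁)).keeps hk₂
  have v4 : s₂.real 4 = sampleErr N ε β := by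
    rw [hk₂.real 4 (by norm_num)]
    simp [State.setReal, sampleErrExpr, RealExpr.eval, BinOp.eval, RealExpr.div, RealExpr.mul, v1,
      q1, r0, r3, sampleErr]
    ring
  have q2 : ∀ i < 20, i ≠ 4 → s₂.real i = s₁.real i := fun i hi hne => by
    rw [hk₂.real i hi]; simp [State.setReal, hne]
  obtain ⟨t₃, s₃, he₃, ht₃, hk₃⟩ := exec_assign (Tsp := Tsp) (Tct := Tct) (ω := ω) 5
    (e := sampleSizeExpr) (s := s₂) rfl (by rw [hs₂.nat 3 (by norm_num), h3])
  have hs₃ := (hs₂.setReal 5 (sampleSizeExpr.eval s₂)).keeps hk₃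
  have v5 : s₃.real 5 = sampleSize N ε β := by
    rw [hk₃.real 5 (by norm_num)]
    simp [State.setReal, sampleSizeExpr, RealExpr.eval, BinOp.eval, RealExpr.div, RealExpr.mul, v1,
      q1, q2, r0, r3, sampleSize]
    ring
  have q3 : ∀ i < 20, i ≠ 5 → s₃.real i = s₂.real i := fun i hi hne => by
    rw [hk₃.real i hi]; simp [State.setReal, hne]
  have v4' : s₃.real 4 = sampleErr N ε β := by rw [q3 4 (by norm_num) (by norm_num), v4]
  obtain ⟨t₄, s₄, he₄, ht₄, hs₄, q4, v6, c4, hρ4⟩ := exec_sampleLoop (Tsp := Tsp) (Tct := Tct)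
    (ω := ω) ho hs₃ h3 (by rw [hk₃.calls]; show s₂.calls = 0; rw [hk₂.calls]
                           show s₁.calls = 0; rw [hk₁.calls]; exact hc) (by rw [v4']; exact hδ) hρ
  rw [v5] at ht₄ v6 c4 hρ4
  rw [v4'] at ht₄ hρ4
  set K := ⌈sampleSize N ε β⌉₊ with hK
  have hKpos : 0 < K := Nat.ceil_pos.2 (by linarith)
  have w : ∀ i < 4, s₄.real i = s₁.real i := fun i hi => by
    rw [q4 i (by omega), q3 i (by omega) (by omega), q2 i (by omega) (by omega)]
  have w5 : s₄.real 5 = sampleSize N ε β := by rw [q4 5 (by norm_num), v5]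
  have wδ : countErr (s₄.real 3) (s₄.real 0) (s₄.real 1) = countErr N ε β := by
    rw [w 3 (by norm_num), w 0 (by norm_num), w 1 (by norm_num), v1, q1 3 (by norm_num)
      (by norm_num), q1 0 (by norm_num) (by norm_num), r0, r3]
  have w2 : s₄.real 2 = κ := by
    rw [w 2 (by norm_num), q1 2 (by norm_num) (by norm_num), r2]
  obtain ⟨t₅, s₅, he₅, ht₅, v8, ra5, w55, w56, n53⟩ := exec_ratioProg (Tsp := Tsp) (Tct := Tct)
    (ω := ω) (s := s₄) (δ := sampleErr N ε β) (K := K) (ρ := ρ)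
    (by rw [hs₄.nat 3 (by norm_num), h3]) c4 hKpos (by rw [w5]) v6 hρ4 (by rw [wδ]; exact hδ')
  rw [wδ] at ht₅ v8
  rw [w2] at v8
  obtain ⟨t₆, s₆, he₆, ht₆, hk₆⟩ := exec_assign (Tsp := Tsp) (Tct := Tct) (ω := ω) 0
    (e := estimateExpr) (s := s₅) rfl n53
  have hcost := RealExpr.cost_le_costBound (n := s₅.nat 0) (m := s₅.nat 1) (K := K) hKpos
    (l := [5]) estimateExpr (s := s₅) rfl rfl
    (fun j hj => by rw [List.mem_singleton.1 hj, w55, w5]) rfl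
  refine ⟨_, s₆, .seq he₁ (.seq he₂ (.seq he₃ (.seq he₄ (.seq he₅ he₆)))), ?_, ?_⟩
  · rw [costBound_estimateExpr] at hcost
    have z1 : betaExpr.cost s = 9 := by
      simp [betaExpr, RealExpr.cost, RealExpr.div, RealExpr.mul]
    have z2 : sampleErrExpr.cost s₁ = 13 := by
      simp [sampleErrExpr, RealExpr.cost, RealExpr.div, RealExpr.mul]
    have z3 : sampleSizeExpr.cost s₂ = 13 := by
      simp [sampleSizeExpr, RealExpr.cost, RealExpr.div, RealExpr.mul]
    have z4 : K * (Tsp (sampleErr N ε β) + B + 100) =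
      K * (Tsp (sampleErr N ε β) + B + 5) + K * 95 := by ring
    omega
  · rw [hk₆.real 0 (by norm_num)]
    simp only [State.setReal, Function.update_self, mainOutput]
    rw [eval_estimateExpr (by rw [w55, w5]) (by rw [w56, v6]) (by rw [ra5]; exact hρ4), v8]

/-! ### Evaluation of sums, products and minima -/

@[to_additive]
theorem prod_range_eq_prod_map {α M : Type*} [CommMonoid M] (l : List α) {f : ℕ → M} {g : α → M}
    (h : ∀ k p, l[k]? = some p → f k = g p) :
    ∏ k ∈ Finset.range l.length, f k = (l.map g).prod := by
  induction l generalizing f with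
  | nil => simp
  | cons a l ih =>
    rw [List.length_cons, Finset.prod_range_succ', List.map_cons, List.prod_cons,
      ih fun k p hk => h (k + 1) p (by simpa using hk), h 0 a (by simp), mul_comm]

theorem le_iter_min_iff {g : ℕ → ℝ} {x b : ℝ} {K : ℕ} :
    b ≤ iter x (fun k acc => min acc (g k)) K ↔ b ≤ x ∧ ∀ k < K, b ≤ g k := by
  induction K with
  | zero => simp [iter]
  | succ K ih =>
    simp only [iter, le_min_iff, ih, Nat.lt_succ_iff_lt_or_eq, or_imp, forall_and, forall_eq,
      and_assoc]

/-- Index registers `0` and `1` and index arrays `0` and `1` hold the graph. -/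
structure HasGraph {n : ℕ} (G : SimpleGraph (Fin n)) (s : State) : Prop where
  nat_zero : s.nat 0 = n
  nat_one : s.nat 1 = numEdges G
  fst : s.natArr 0 = edgeVec G fun u _ => (u : ℕ)
  snd : s.natArr 1 = edgeVec G fun _ v => (v : ℕ)

section

variable {n : ℕ} {G : SimpleGraph (Fin n)} {s s' : State}

theorem HasGraph.setNat (h : HasGraph G s) {i : ℕ} (hi : 2 ≤ i) (k : ℕ) :
    HasGraph G (s.setNat i k) :=
  ⟨by simpa [State.setNat, Function.update_of_ne (show 0 ≠ i by omega)] using h.nat_zero,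
    by simpa [State.setNat, Function.update_of_ne (show 1 ≠ i by omega)] using h.nat_one,
    h.fst, h.snd⟩

theorem HasGraph.setReal (h : HasGraph G s) (i : ℕ) (x : ℝ) : HasGraph G (s.setReal i x) :=
  ⟨h.nat_zero, h.nat_one, h.fst, h.snd⟩

theorem HasGraph.sameInput (h : HasGraph G s) (hs : SameInput s s') : HasGraph G s' :=
  ⟨(hs.nat 0 (by norm_num)).trans h.nat_zero, (hs.nat 1 (by norm_num)).trans h.nat_one,
    (hs.natArr 0 (by norm_num)).trans h.fst, (hs.natArr 1 (by norm_num)).trans h.snd⟩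

theorem edgeVec_eq {α : Type} [Zero α] {f : Fin n → Fin n → α} {k : ℕ} {p : Fin n × Fin n}
    (hk : (edgeList G)[k]? = some p) : edgeVec G f k = f p.1 p.2 := by
  simp [edgeVec, hk]

theorem HasGraph.fst_eq (h : HasGraph G s) {k : ℕ} {p : Fin n × Fin n}
    (hk : (edgeList G)[k]? = some p) : s.natArr 0 k = p.1 := by
  rw [h.fst, edgeVec_eq hk]

theorem HasGraph.snd_eq (h : HasGraph G s) {k : ℕ} {p : Fin n × Fin n}
    (hk : (edgeList G)[k]? = some p) : s.natArr 1 k = p.2 := by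
  rw [h.snd, edgeVec_eq hk]

namespace RealExpr

theorem eval_var (i : ℕ) : (var i).eval s = s.real i := rfl

theorem eval_const (q : ℚ) : (const q).eval s = q := rfl

theorem eval_zero : zero.eval s = 0 := by simp [zero, eval]

theorem eval_one : one.eval s = 1 := by simp [one, eval]

theorem eval_add (x y : RealExpr) : (add x y).eval s = x.eval s + y.eval s := rfl

theorem eval_sub (x y : RealExpr) : (sub x y).eval s = x.eval s - y.eval s := rfl

theorem eval_mul (x y : RealExpr) : (mul x y).eval s = x.eval s * y.eval s := rfl

theorem eval_div (x y : RealExpr) : (div x y).eval s = x.eval s / y.eval s := rfl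

theorem eval_exp (x : RealExpr) : (exp x).eval s = Real.exp (x.eval s) := rfl

theorem eval_cast (j : IdxExpr) : (cast j).eval s = j.eval s := rfl

theorem eval_load (a : ℕ) (j : IdxExpr) : (load a j).eval s = s.realArr a (j.eval s) := rfl

open Classical in
theorem eval_ite (a b x y : RealExpr) :
    (ite a b x y).eval s = if a.eval s ≤ b.eval s then x.eval s else y.eval s := rfl

def minimum (x y : RealExpr) : RealExpr := ite x y x y

theorem eval_minimum (x y : RealExpr) : (minimum x y).eval s = min (x.eval s) (y.eval s) := by
  rw [minimum, eval_ite, min_def]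

def abs (x : RealExpr) : RealExpr := ite zero x x (sub zero x)

theorem eval_abs (x : RealExpr) : x.abs.eval s = |x.eval s| := by
  rw [abs, eval_ite, eval_sub, eval_zero, zero_sub]
  split
  · rw [abs_of_nonneg ‹_›]
  · rw [abs_of_neg (not_le.1 ‹_›)]

/-- The indicator of equality. -/
def eqInd (x y : RealExpr) : RealExpr := ite x y (ite y x one zero) zero

open Classical in
theorem eval_eqInd (x y : RealExpr) :
    (eqInd x y).eval s = if x.eval s = y.eval s then 1 else 0 := by
  rw [eqInd, eval_ite, eval_ite, eval_one, eval_zero]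
  split_ifs with h1 h2 h3 h3 h3
  · rfl
  · exact absurd (le_antisymm h1 h2) h3
  · exact absurd h3.ge h2
  · rfl
  · exact absurd h3.le h1
  · rfl

theorem eval_sum {i r K : ℕ} {bound x : RealExpr} {g : ℕ → ℝ} (hb : bound.eval s = K)
    (hx : ∀ k < K, ∀ acc, x.eval ((s.setNat i k).setReal r acc) = g k) :
    (sum i r bound x).eval s = ∑ k ∈ Finset.range K, g k := by
  simp only [sum, eval, hb, Nat.ceil_natCast, eval_add, eval_zero]
  rw [iter_congr (g := fun k acc => acc + g k), iter_add, zero_add]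
  intro k hk acc
  rw [hx k hk]
  simp [State.setReal]

theorem eval_prod {i r K : ℕ} {bound x : RealExpr} {g : ℕ → ℝ} (hb : bound.eval s = K)
    (hx : ∀ k < K, ∀ acc, x.eval ((s.setNat i k).setReal r acc) = g k) :
    (prod i r bound x).eval s = ∏ k ∈ Finset.range K, g k := by
  simp only [prod, eval, hb, Nat.ceil_natCast, eval_mul, eval_one]
  rw [iter_congr (g := fun k acc => acc * g k), iter_mul, one_mul]
  intro k hk acc
  rw [hx k hk]
  simp [State.setReal]

/-- Sum over the vertices. -/
def sumV (i r : ℕ) (x : RealExpr) : RealExpr := sum i r (cast (.var 0)) x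

/-- Sum over the edges. -/
def sumE (i r : ℕ) (x : RealExpr) : RealExpr := sum i r (cast (.var 1)) x

def prodV (i r : ℕ) (x : RealExpr) : RealExpr := prod i r (cast (.var 0)) x

def prodE (i r : ℕ) (x : RealExpr) : RealExpr := prod i r (cast (.var 1)) x

theorem eval_sumV (h : HasGraph G s) {i r : ℕ} {x : RealExpr} {g : Fin n → ℝ}
    (hx : ∀ (v : Fin n) acc, x.eval ((s.setNat i v).setReal r acc) = g v) :
    (sumV i r x).eval s = ∑ v, g v := by
  rw [sumV, eval_sum (K := n) (g := fun k => if hk : k < n then g ⟨k, hk⟩ else 0)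
    (by rw [eval_cast, IdxExpr.eval, h.nat_zero])
    (fun k hk acc => by rw [dif_pos hk]; exact hx ⟨k, hk⟩ acc), ← Fin.sum_univ_eq_sum_range]
  simp

theorem eval_prodV (h : HasGraph G s) {i r : ℕ} {x : RealExpr} {g : Fin n → ℝ}
    (hx : ∀ (v : Fin n) acc, x.eval ((s.setNat i v).setReal r acc) = g v) :
    (prodV i r x).eval s = ∏ v, g v := by
  rw [prodV, eval_prod (K := n) (g := fun k => if hk : k < n then g ⟨k, hk⟩ else 0)
    (by rw [eval_cast, IdxExpr.eval, h.nat_zero])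
    (fun k hk acc => by rw [dif_pos hk]; exact hx ⟨k, hk⟩ acc), ← Fin.prod_univ_eq_prod_range]
  simp

theorem eval_sumE (h : HasGraph G s) {i r : ℕ} {x : RealExpr} {g : Fin n × Fin n → ℝ}
    (hx : ∀ k p, (edgeList G)[k]? = some p → ∀ acc,
      x.eval ((s.setNat i k).setReal r acc) = g p) :
    (sumE i r x).eval s = ((edgeList G).map g).sum := by
  rw [sumE, eval_sum (K := (edgeList G).length)
    (g := fun k => x.eval ((s.setNat i k).setReal r 0))
    (by rw [eval_cast, IdxExpr.eval, h.nat_one, length_edgeList]) (fun k hk acc => ?_)]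
  · exact sum_range_eq_sum_map _ fun k p hk => hx k p hk 0
  · rw [hx k _ (List.getElem?_eq_getElem hk), hx k _ (List.getElem?_eq_getElem hk)]

theorem eval_prodE (h : HasGraph G s) {i r : ℕ} {x : RealExpr} {g : Fin n × Fin n → ℝ}
    (hx : ∀ k p, (edgeList G)[k]? = some p → ∀ acc,
      x.eval ((s.setNat i k).setReal r acc) = g p) :
    (prodE i r x).eval s = ((edgeList G).map g).prod := by
  rw [prodE, eval_prod (K := (edgeList G).length)
    (g := fun k => x.eval ((s.setNat i k).setReal r 0))
    (by rw [eval_cast, IdxExpr.eval, h.nat_one, length_edgeList]) (fun k hk acc => ?_)]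
  · exact prod_range_eq_prod_map _ fun k p hk => hx k p hk 0
  · rw [hx k _ (List.getElem?_eq_getElem hk), hx k _ (List.getElem?_eq_getElem hk)]

/-- Minimum of `init` and a function of the vertices. -/
def minV (i r : ℕ) (init x : RealExpr) : RealExpr :=
  fold i r (cast (.var 0)) init (minimum (var r) x)

theorem le_eval_minV (h : HasGraph G s) {i r : ℕ} {init x : RealExpr} {g : Fin n → ℝ}
    (hx : ∀ (v : Fin n) acc, x.eval ((s.setNat i v).setReal r acc) = g v) {b : ℝ} :
    b ≤ (minV i r init x).eval s ↔ b ≤ init.eval s ∧ ∀ v, b ≤ g v := by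
  simp only [minV, eval, h.nat_zero, IdxExpr.eval, Nat.ceil_natCast, eval_minimum]
  rw [iter_congr (g := fun k acc => min acc (if hk : k < n then g ⟨k, hk⟩ else 0)),
    le_iter_min_iff]
  · refine and_congr_right fun _ => ⟨fun hk v => by simpa using hk v v.2, fun hv k hk => ?_⟩
    rw [dif_pos hk]; exact hv _
  · intro k hk acc
    rw [dif_pos hk, ← hx ⟨k, hk⟩ acc]
    simp [State.setReal]

end RealExpr
end

/-! ### Enumeration of the configurations on a set of vertices -/

open Classical in
/-- Shift the binary expansion of a number in `[0, 1)`. -/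
def doubling (y : ℝ) : ℝ := if 1 / 2 ≤ y then 2 * y - 1 else 2 * y

open Classical in
/-- Shift the binary expansion of `y` by the number of elements of `f` below `u`. -/
def shifted (f : ℕ → Prop) (y : ℝ) (u : ℕ) : ℝ :=
  iter y (fun j acc => if f j then doubling acc else acc) u

open Classical in
/-- The configuration supported in `f` whose spins are the binary digits of `y`. -/
def bits (f : ℕ → Prop) (n : ℕ) (y : ℝ) : Config n := fun u => decide (f u ∧ 1 / 2 ≤ shifted f y u)

theorem iter_succ_front (x : ℝ) (g : ℕ → ℝ → ℝ) (K : ℕ) :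
    iter x g (K + 1) = iter (g 0 x) (fun k => g (k + 1)) K := by
  induction K with
  | zero => rfl
  | succ K ih => rw [iter, ih, iter]

open Classical in
theorem bits_succ (f : ℕ → Prop) (n : ℕ) (y : ℝ) :
    bits f (n + 1) y = Fin.cons (decide (f 0 ∧ 1 / 2 ≤ y))
      (bits (fun j => f (j + 1)) n (if f 0 then doubling y else y)) := by
  funext u
  refine Fin.cases ?_ (fun u => ?_) u
  · simp [bits, shifted, iter]
  · simp [bits, shifted, iter_succ_front]

open Classical in
theorem sum_bits : ∀ (n : ℕ) (f : ℕ → Prop) (F : Config n → ℝ),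
    ∑ x ∈ Finset.range (2 ^ (Finset.univ.filter fun u : Fin n => f u).card),
      F (bits f n (x / 2 ^ (Finset.univ.filter fun u : Fin n => f u).card)) =
    ∑ σ : Config n, if ∀ u : Fin n, σ u = true → f u then F σ else 0
  | 0, f, F => by
    simp only [Finset.univ_eq_empty, Finset.filter_empty, Finset.card_empty, pow_zero,
      Finset.sum_range_one, IsEmpty.forall_iff, if_true, Fintype.sum_subsingleton _ default]
    congr 1
    exact Subsingleton.elim _ _
  | n + 1, f, F => by
    have ih := sum_bits n fun j => f (j + 1)
    have hR : ∑ σ : Config (n + 1), (if ∀ u : Fin (n + 1), σ u = true → f u then F σ else 0) =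
        ∑ c : Bool, ∑ σ : Config n, if (c = true → f 0) ∧ ∀ u : Fin n, σ u = true → f (u + 1) then
          F (Fin.cons c σ) else 0 := by
      rw [← Fintype.sum_prod_type', ← (Fin.consEquiv fun _ => Bool).sum_comp]
      refine Finset.sum_congr rfl fun x _ => ?_
      simp [Fin.consEquiv, Fin.forall_fin_succ]
    have hcard : (Finset.univ.filter fun u : Fin (n + 1) => f u).card =
        (if f 0 then 1 else 0) + (Finset.univ.filter fun u : Fin n => f (u + 1)).card := by
      simp only [Finset.card_filter, Fin.sum_univ_succ, Fin.val_zero, Fin.val_succ]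
      congr!
    set c := (Finset.univ.filter fun u : Fin n => f (u + 1)).card with hc
    rw [hR, Fintype.sum_bool, hcard]
    simp only [bits_succ]
    by_cases h0 : f 0
    · simp only [h0, if_true, true_and, forall_const, implies_true]
      have hp : (2 : ℕ) ^ (1 + c) = 2 ^ c + 2 ^ c := by ring
      have hpos : (0 : ℝ) < 2 ^ c := by positivity
      have e1 : ∀ x : ℕ, (x : ℝ) / 2 ^ (1 + c) = x / 2 ^ c / 2 := fun x => by
        rw [pow_add, pow_one, div_div, mul_comm]
      rw [hp, Finset.sum_range_add, add_comm, ← ih, ← ih]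
      congr 1
      · refine Finset.sum_congr rfl fun x hx => ?_
        have h2 : (0 : ℝ) ≤ x / 2 ^ c := by positivity
        have : ((2 ^ c + x : ℕ) : ℝ) / 2 ^ (1 + c) = (1 + x / 2 ^ c) / 2 := by
          rw [e1]; push_cast; rw [add_div, div_self hpos.ne']
        have h3 : (1 : ℝ) / 2 ≤ (1 + x / 2 ^ c) / 2 := by linarith
        rw [this]
        simp only [doubling, h3, if_true, decide_true]
        congr 2
        ring_nf
      · refine Finset.sum_congr rfl fun x hx => ?_
        have h2 : (x : ℝ) / 2 ^ c < 1 := by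
          rw [div_lt_one hpos]
          exact_mod_cast Finset.mem_range.1 hx
        have h3 : ¬ (1 : ℝ) / 2 ≤ x / 2 ^ c / 2 := by linarith
        rw [e1]
        simp only [doubling, h3, if_false, decide_false]
        congr 2
        ring_nf
    · simp only [h0, if_false, zero_add, false_and, decide_false]
      rw [ih fun σ => F (Fin.cons false σ)]
      simp

/-! ### Hardcore models: expressions -/

section

variable {n : ℕ} {G : SimpleGraph (Fin n)} {s s₀ : State} (lam : Fin n → ℝ≥0)

theorem hardcoreWeight_eq_prod (σ : Config n) : hardcoreWeight G lam σ =
    (∏ v, if σ v = true then (lam v : ℝ) else 1) *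
      ((edgeList G).map fun p => if σ p.1 = true ∧ σ p.2 = true then (0 : ℝ) else 1).prod := by
  unfold hardcoreWeight
  split
  · rename_i h
    rw [isIndepSet_iff] at h
    rw [List.prod_eq_one, mul_one]
    simp only [List.mem_map, forall_exists_index, and_imp]
    rintro x p hp rfl
    exact if_neg fun hh => h _ _ ((mem_edgeList G).1 hp).2 hh.1 hh.2
  · rename_i h
    rw [List.prod_eq_zero, mul_zero]
    rw [isIndepSet_iff] at h
    push Not at h
    obtain ⟨u, v, huv, hu, hv, -⟩ := h
    rw [List.mem_map]
    rcases lt_or_gt_of_ne huv.ne with hlt | hlt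
    · exact ⟨(u, v), (mem_edgeList G).2 ⟨hlt, huv⟩, if_pos ⟨hu, hv⟩⟩
    · exact ⟨(v, u), (mem_edgeList G).2 ⟨hlt, huv.symm⟩, if_pos ⟨hv, hu⟩⟩

/-- `IsFree` on natural numbers. -/
def FreeAt (G : SimpleGraph (Fin n)) (lam : Fin n → ℝ≥0) (v : Fin n) (j : ℕ) : Prop :=
  ∃ h : j < n, IsFree G lam v ⟨j, h⟩

theorem freeAt_val (v u : Fin n) : FreeAt G lam v u ↔ IsFree G lam v u :=
  ⟨fun ⟨_, h⟩ => h, fun h => ⟨u.2, h⟩⟩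

open Classical in
theorem localPartition_eq_sum_bits (v : Fin n) : localPartition G lam v =
    ∑ x ∈ Finset.range (2 ^ (Finset.univ.filter (IsFree G lam v)).card),
      hardcoreWeight G lam (bits (FreeAt G lam v) n
        (x / ((2 ^ (Finset.univ.filter (IsFree G lam v)).card : ℕ) : ℝ))) := by
  have h := sum_bits n (FreeAt G lam v) (hardcoreWeight G lam)
  simp only [freeAt_val] at h
  rw [localPartition, ← h]
  push_cast
  rfl

theorem iter_guard (g : ℕ → ℝ → ℝ) (x : ℝ) {u n : ℕ} (h : u ≤ n) :
    iter x (fun j acc => if j + 1 ≤ u then g j acc else acc) n = iter x g u := by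
  induction n with
  | zero => obtain rfl : u = 0 := by omega
            rfl
  | succ n ih =>
    rcases h.lt_or_eq with h | rfl
    · rw [iter, if_neg (by omega), ih (by omega)]
    · rw [iter, if_pos le_rfl, iter]
      congr 1
      refine iter_congr (fun k hk y => ?_) x
      rw [if_pos (by omega)]

open RealExpr

def RealExpr.half : RealExpr := const (1 / 2)

theorem RealExpr.eval_half : half.eval s = 1 / 2 := by simp [half, eval]

/-- The table of free vertices is in real array `5`. -/
def bitExpr (u : IdxExpr) (r : ℕ) : RealExpr :=
  ite one (load 5 u)
    (ite half
      (fold 12 r (cast (.var 0)) (div (cast (.var 10)) (var 12))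
        (ite (add (cast (.var 12)) one) (cast u)
          (ite one (load 5 (.var 12))
            (ite half (var r) (sub (mul (const 2) (var r)) one)
              (mul (const 2) (var r)))
            (var r))
          (var r)))
      one zero)
    zero

open Classical in
theorem eval_bitExpr (hg : HasGraph G s) {f : ℕ → Prop}
    (h5 : ∀ j < n, s.realArr 5 j = if f j then 1 else 0) {u : IdxExpr} {v : Fin n} {r : ℕ}
    (hu : u.eval s = v) (hu' : ∀ k acc, u.eval ((s.setNat 12 k).setReal r acc) = v) :
    (bitExpr u r).eval s = if bits f n (s.nat 10 / s.real 12) v = true then 1 else 0 := by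
  have hf : (fold 12 r (cast (.var 0)) (div (cast (.var 10)) (var 12))
        (ite (add (cast (.var 12)) one) (cast u)
          (ite one (load 5 (.var 12))
            (ite half (var r) (sub (mul (const 2) (var r)) one)
              (mul (const 2) (var r)))
            (var r))
          (var r))).eval s = shifted f (s.nat 10 / s.real 12) v := by
    rw [RealExpr.eval, eval_cast, eval_div, eval_cast, IdxExpr.eval, IdxExpr.eval, hg.nat_zero, Nat.ceil_natCast,
      shifted, ← iter_guard _ _ v.2.le]
    refine iter_congr (fun j hj acc => ?_) _
    simp only [eval_ite, eval_add, eval_cast, hu', eval_one, eval_load, eval_var, eval_half, eval_const,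
      eval_sub, eval_mul, IdxExpr.eval]
    have e1 : ((s.setNat 12 j).setReal r acc).nat 12 = j := by
      simp [State.setNat, State.setReal]
    have e2 : ((s.setNat 12 j).setReal r acc).real r = acc := by simp [State.setReal]
    have e3 : ((s.setNat 12 j).setReal r acc).realArr = s.realArr := rfl
    have e4 : ((j : ℝ) + 1 ≤ (v : ℕ)) ↔ j + 1 ≤ (v : ℕ) := by exact_mod_cast Iff.rfl
    rw [e1, e2, e3, h5 j hj]
    simp only [e4]
    by_cases hfj : f j
    · simp [hfj, doubling]
    · simp [hfj]
  rw [bitExpr, eval_ite, eval_ite, hf, eval_load, hu, h5 v v.2, eval_one, eval_zero, eval_half]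
  by_cases hfv : f v
  · by_cases hb : 1 / 2 ≤ shifted f (s.nat 10 / s.real 12) v
    · simp [bits, hfv]
    · simp [bits, hfv]
  · simp [bits, hfv]

/-- The indicator of `IsFree` for the vertices in index registers `4` and `5` and the fields in real
array `a`. -/
def freeExpr (a : ℕ) : RealExpr :=
  ite (load a (.var 5)) zero zero
    (ite one (add (eqInd (cast (.var 5)) (cast (.var 4)))
        (sumE 10 30 (add
          (mul (eqInd (cast (.load 0 (.var 10))) (cast (.var 5)))
            (eqInd (cast (.load 1 (.var 10))) (cast (.var 4))))
          (mul (eqInd (cast (.load 0 (.var 10))) (cast (.var 4)))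
            (eqInd (cast (.load 1 (.var 10))) (cast (.var 5)))))))
      one zero)

theorem realVec_val (f : Fin n → ℝ) (v : Fin n) : realVec f v = f v := by simp [realVec]

open Classical in
theorem eval_freeExpr (hg : HasGraph G s) {a : ℕ} (ha : s.realArr a = realVec fun v => (lam v : ℝ))
    {u v : Fin n} (h4 : s.nat 4 = v) (h5 : s.nat 5 = u) :
    (freeExpr a).eval s = if IsFree G lam v u then 1 else 0 := by
  have hS := eval_sumE hg (i := 10) (r := 30) (x := add
          (mul (eqInd (cast (.load 0 (.var 10))) (cast (.var 5)))
            (eqInd (cast (.load 1 (.var 10))) (cast (.var 4))))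
          (mul (eqInd (cast (.load 0 (.var 10))) (cast (.var 4)))
            (eqInd (cast (.load 1 (.var 10))) (cast (.var 5)))))
    (g := fun p => (if p.1 = u then 1 else 0) * (if p.2 = v then 1 else 0) +
      (if p.1 = v then 1 else 0) * (if p.2 = u then 1 else 0))
    (fun k p hk acc => by
      simp [eval_add, eval_mul, eval_eqInd, eval_cast, IdxExpr.eval, State.setReal, State.setNat,
        hg.fst_eq hk, hg.snd_eq hk, h4, h5, Fin.val_inj])
  rw [freeExpr, eval_ite, eval_ite, eval_add, hS, eval_eqInd, eval_cast, eval_cast, eval_load,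
    eval_one, eval_zero]
  simp only [IdxExpr.eval, h4, h5, ha, realVec_val, Nat.cast_inj, Fin.val_inj]
  by_cases hl : (lam u : ℝ) ≤ 0
  · rw [if_pos hl, if_neg]
    exact fun h => absurd h.1 (not_lt.2 (by exact_mod_cast hl))
  · rw [if_neg hl]
    have hl' : 0 < lam u := by exact_mod_cast not_le.1 hl
    have hn : 0 ≤ ((edgeList G).map fun p : Fin n × Fin n =>
        ((if p.1 = u then 1 else 0) * (if p.2 = v then 1 else 0) +
      (if p.1 = v then 1 else 0) * (if p.2 = u then 1 else 0) : ℝ)).sum := by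
      refine List.sum_nonneg fun x hx => ?_
      obtain ⟨p, -, rfl⟩ := List.mem_map.1 hx
      split_ifs <;> norm_num
    by_cases huv : u = v
    · rw [if_pos huv, if_pos (by linarith), if_pos]
      exact ⟨hl', Or.inl huv⟩
    · rw [if_neg huv, zero_add]
      by_cases hadj : G.Adj v u
      · have hone : ∀ p ∈ edgeList G, (p = (u, v) ∨ p = (v, u)) →
            1 ≤ ((edgeList G).map fun p : Fin n × Fin n =>
              ((if p.1 = u then 1 else 0) * (if p.2 = v then 1 else 0) +
      (if p.1 = v then 1 else 0) * (if p.2 = u then 1 else 0) : ℝ)).sum := by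
          intro p hp h
          refine le_trans ?_ (List.single_le_sum (fun x hx => ?_) _ (List.mem_map.2 ⟨p, hp, rfl⟩))
          · rcases h with rfl | rfl <;> simp [huv, Ne.symm huv]
          · obtain ⟨p, -, rfl⟩ := List.mem_map.1 hx
            split_ifs <;> norm_num
        rw [if_pos (c := IsFree G lam v u) ⟨hl', Or.inr hadj⟩, if_pos]
        rcases lt_or_gt_of_ne huv with hlt | hlt
        · exact hone (u, v) ((mem_edgeList G).2 ⟨hlt, hadj.symm⟩) (Or.inl rfl)
        · exact hone (v, u) ((mem_edgeList G).2 ⟨hlt, hadj⟩) (Or.inr rfl)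
      · rw [if_neg (c := IsFree G lam v u) fun h => h.2.elim huv hadj, if_neg]
        rw [List.map_congr_left (g := fun _ => (0 : ℝ))]
        · simp
        · intro p hp
          have hp' := ((mem_edgeList G).1 hp).2
          have e1 : ¬ (p.1 = u ∧ p.2 = v) := fun h => hadj (by rw [← h.1, ← h.2]; exact hp'.symm)
          have e2 : ¬ (p.1 = v ∧ p.2 = u) := fun h => hadj (by rw [← h.1, ← h.2]; exact hp')
          rw [not_and] at e1 e2
          split_ifs with q1 q2 q3 q4 q5 q6 <;> simp_all

/-- The number of configurations on the free vertices. -/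
def enumSizeExpr (a : ℕ) : RealExpr :=
  ite (load a (.var 4)) zero one (prodV 10 30 (add one (load 5 (.var 10))))

open Classical in
theorem eval_enumSizeExpr (hg : HasGraph G s) {a : ℕ}
    (ha : s.realArr a = realVec fun v => (lam v : ℝ)) {v : Fin n} (h4 : s.nat 4 = v)
    (h5 : ∀ j < n, s.realArr 5 j = if FreeAt G lam v j then 1 else 0) :
    (enumSizeExpr a).eval s = if lam v = 0 then 1 else
      ((2 ^ (Finset.univ.filter (IsFree G lam v)).card : ℕ) : ℝ) := by
  have hP := eval_prodV hg (i := 10) (r := 30) (x := add one (load 5 (.var 10)))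
    (g := fun u => if IsFree G lam v u then 2 else 1) (fun u acc => by
      have := h5 u u.2
      rw [freeAt_val] at this
      simp only [eval_add, eval_one, eval_load, IdxExpr.eval, State.setReal, State.setNat,
        Function.update_self, this]
      split_ifs <;> norm_num)
  rw [enumSizeExpr, eval_ite, hP, eval_load, eval_one, eval_zero, IdxExpr.eval, h4, ha, realVec_val]
  have : ((lam v : ℝ) ≤ 0) ↔ lam v = 0 := by
    rw [← NNReal.coe_zero, NNReal.coe_le_coe, nonpos_iff_eq_zero]
  rw [if_congr this rfl rfl, Finset.prod_ite]
  simp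

/-- The partition function of the closed neighbourhood. -/
def localPartitionExpr (a : ℕ) : RealExpr :=
  sum 10 30 (var 12)
    (mul
      (prodV 11 40 (ite half (bitExpr (.var 11) 50) (load a (.var 11)) one))
      (prodE 11 40 (ite half
        (mul (bitExpr (.load 0 (.var 11)) 50) (bitExpr (.load 1 (.var 11)) 60)) zero one)))

open Classical in
theorem eval_localPartitionExpr (hg : HasGraph G s) {a : ℕ}
    (ha : s.realArr a = realVec fun v => (lam v : ℝ)) {v : Fin n}
    (h5 : ∀ j < n, s.realArr 5 j = if FreeAt G lam v j then 1 else 0)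
    (h12 : s.real 12 = ((2 ^ (Finset.univ.filter (IsFree G lam v)).card : ℕ) : ℝ)) :
    (localPartitionExpr a).eval s = localPartition G lam v := by
  rw [localPartition_eq_sum_bits, localPartitionExpr]
  refine eval_sum h12 fun x hx acc => ?_
  set st := (s.setNat 10 x).setReal 30 acc with hst
  have hg' : HasGraph G st := (hg.setNat (i := 10) (by norm_num) x).setReal 30 acc
  have hx10 : ∀ k acc', (((st.setNat 11 k).setReal 40 acc').nat 10 : ℝ) /
      ((st.setNat 11 k).setReal 40 acc').real 12 =
        x / ((2 ^ (Finset.univ.filter (IsFree G lam v)).card : ℕ) : ℝ) := fun k acc' => by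
    rw [← h12]; simp [hst, State.setReal, State.setNat]
  rw [eval_mul, hardcoreWeight_eq_prod]
  congr 1
  · refine eval_prodV hg' fun u acc' => ?_
    have hb := eval_bitExpr (s := (st.setNat 11 u).setReal 40 acc') (f := FreeAt G lam v)
      ((hg'.setNat (i := 11) (by norm_num) _).setReal _ _) h5 (u := .var 11) (v := u) (r := 50)
      (by simp [IdxExpr.eval, State.setNat, State.setReal])
      (by simp [IdxExpr.eval, State.setNat, State.setReal])
    rw [eval_ite, hb, hx10, eval_load, eval_one, eval_half]
    have : ((st.setNat 11 u).setReal 40 acc').realArr a = realVec fun v => (lam v : ℝ) := ha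
    rw [this, IdxExpr.eval, show ((st.setNat 11 u).setReal 40 acc').nat 11 = u by
      simp [State.setNat, State.setReal], realVec_val]
    by_cases q : bits (FreeAt G lam v) n
        (x / ((2 ^ (Finset.univ.filter (IsFree G lam v)).card : ℕ) : ℝ)) u = true
    · rw [if_pos q, if_pos q, if_pos (by norm_num)]
    · rw [if_neg q, if_neg q, if_neg (by norm_num)]
  · refine eval_prodE hg' fun k p hk acc' => ?_
    have hg'' : HasGraph G ((st.setNat 11 k).setReal 40 acc') :=
      (hg'.setNat (i := 11) (by norm_num) _).setReal _ _
    have hb1 := eval_bitExpr (s := (st.setNat 11 k).setReal 40 acc') (f := FreeAt G lam v)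
      hg'' h5 (u := .load 0 (.var 11)) (v := p.1) (r := 50)
      (by simp [IdxExpr.eval, State.setNat, State.setReal, hst, hg.fst_eq hk])
      (by simp [IdxExpr.eval, State.setNat, State.setReal, hst, hg.fst_eq hk])
    have hb2 := eval_bitExpr (s := (st.setNat 11 k).setReal 40 acc') (f := FreeAt G lam v)
      hg'' h5 (u := .load 1 (.var 11)) (v := p.2) (r := 60)
      (by simp [IdxExpr.eval, State.setNat, State.setReal, hst, hg.snd_eq hk])
      (by simp [IdxExpr.eval, State.setNat, State.setReal, hst, hg.snd_eq hk])
    rw [eval_ite, eval_mul, hb1, hb2, hx10, eval_zero, eval_one, eval_half]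
    set σ := bits (FreeAt G lam v) n
        (x / ((2 ^ (Finset.univ.filter (IsFree G lam v)).card : ℕ) : ℝ))
    by_cases q1 : σ p.1 = true
    · by_cases q2 : σ p.2 = true
      · rw [if_pos q1, if_pos q2, if_pos (by norm_num), if_pos ⟨q1, q2⟩]
      · rw [if_pos q1, if_neg q2, if_neg (by norm_num), if_neg fun h => q2 h.2]
    · rw [if_neg q1, zero_mul, if_neg (by norm_num), if_neg fun h => q1 h.1]

/-- The bound for the marginals at the vertex in index register `4`. -/
def vertexBoundExpr (a : ℕ) : RealExpr :=
  minimum (var 1) (ite (load a (.var 4)) zero one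
    (minimum (div one (add one (load a (.var 4)))) (div (load a (.var 4)) (localPartitionExpr a))))

/-- A lower bound for the conditional marginals at `v`. -/
def vertexBound (G : SimpleGraph (Fin n)) (lam : Fin n → ℝ≥0) (v : Fin n) : ℝ :=
  if lam v = 0 then 1 else min (1 / (1 + lam v)) (lam v / localPartition G lam v)

open Classical in
theorem eval_vertexBoundExpr (hg : HasGraph G s) {a : ℕ}
    (ha : s.realArr a = realVec fun v => (lam v : ℝ)) {v : Fin n} (h4 : s.nat 4 = v)
    (h5 : ∀ j < n, s.realArr 5 j = if FreeAt G lam v j then 1 else 0)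
    (h12 : s.real 12 = if lam v = 0 then 1 else
      ((2 ^ (Finset.univ.filter (IsFree G lam v)).card : ℕ) : ℝ)) :
    (vertexBoundExpr a).eval s = min (s.real 1) (vertexBound G lam v) := by
  have : ((lam v : ℝ) ≤ 0) ↔ lam v = 0 := by
    rw [← NNReal.coe_zero, NNReal.coe_le_coe, nonpos_iff_eq_zero]
  rw [vertexBoundExpr, eval_minimum, eval_ite, eval_minimum, eval_div, eval_div, eval_add, eval_load,
    IdxExpr.eval, h4, ha, realVec_val, eval_one, eval_zero, eval_var, if_congr this rfl rfl,
    vertexBound]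
  split_ifs with h
  · rfl
  · rw [if_neg h] at h12
    rw [eval_localPartitionExpr lam hg ha h5 h12]

end

/-! ### Hardcore models: programs -/

/-- Write the table of free vertices. -/
def freeStep (a : ℕ) : Prog := .seq ((freeExpr a).compile 10 20) (.op (.realStore 5 5 20))

/-- Update the marginal bound in real register `1` by the vertex in index register `4`. -/
def vertexStep (a : ℕ) : Prog :=
  .seq (.forLoop 5 13 15 (freeStep a)) (.seq (.assign 12 (enumSizeExpr a))
    (.assign 1 (vertexBoundExpr a)))

section

variable {n : ℕ} {G : SimpleGraph (Fin n)} {Tsp Tct : ℝ → ℕ} {ω : Tape n} {s s₀ : State}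
  (lam : Fin n → ℝ≥0) {a : ℕ}

theorem costBound_freeExpr (n m K : ℕ) : (freeExpr a).costBound n m K = 32 + 69 * m := by
  simp only [freeExpr, RealExpr.costBound, RealExpr.sumE, RealExpr.sum, RealExpr.add, RealExpr.mul,
    RealExpr.eqInd, RealExpr.one, RealExpr.zero, IdxExpr.cost]
  ring

theorem costBound_enumSizeExpr (n m K : ℕ) : (enumSizeExpr a).costBound n m K = 14 + 10 * n := by
  simp only [enumSizeExpr, RealExpr.costBound, RealExpr.prodV, RealExpr.prod, RealExpr.add,
    RealExpr.mul, RealExpr.one, RealExpr.zero, IdxExpr.cost]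
  ring

theorem costBound_vertexBoundExpr (n m K : ℕ) : (vertexBoundExpr a).costBound n m K =
    83 + K * (100 + 128 * n + 112 * (n * n) + 220 * m + 232 * (n * m)) := by
  simp only [vertexBoundExpr, localPartitionExpr, bitExpr, RealExpr.costBound, RealExpr.prodV,
    RealExpr.prodE, RealExpr.prod, RealExpr.sum, RealExpr.add, RealExpr.div, RealExpr.sub,
    RealExpr.half, RealExpr.minimum, RealExpr.mul, RealExpr.one, RealExpr.zero, IdxExpr.cost]
  ring

open Classical in
theorem exec_freeLoop (hs : SameInput s₀ s) (hg : HasGraph G s₀) (h3 : s₀.nat 3 = 1) (ha4 : a < 4)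
    (ha : s₀.realArr a = realVec fun v => (lam v : ℝ)) {v : Fin n} (h4 : s.nat 4 = v)
    (h13 : s.real 13 = n) :
    ∃ t s', Exec Tsp Tct ω (.forLoop 5 13 15 (freeStep a)) s t s' ∧
      t ≤ 3 + n * (36 + 69 * numEdges G) ∧ SameInput s₀ s' ∧ s'.nat 4 = v ∧
      (∀ i < 15, s'.real i = s.real i) ∧ s'.calls = s.calls ∧
      ∀ j < n, s'.realArr 5 j = if FreeAt G lam v j then 1 else 0 := by
  have h := exec_forLoop (Tsp := Tsp) (Tct := Tct) (ω := ω) (i := 5) (b := 13) (c := 15)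
    (body := freeStep a) (x := n) (B := fun _ => 33 + 69 * numEdges G) (s := s)
    (Inv := fun k st => st.nat 5 = k ∧ st.real 15 = k ∧ SameInput s₀ st ∧ st.nat 4 = v ∧
      (∀ i < 15, st.real i = s.real i) ∧ st.calls = s.calls ∧
      ∀ j < k, j < n → st.realArr 5 j = if FreeAt G lam v j then 1 else 0)
    (fun k st h => ⟨h.2.1, (h.2.2.2.2.1 13 (by norm_num)).trans h13⟩)
    (by
      refine ⟨by simp [State.setNat, State.setReal], by simp [State.setNat, State.setReal],
        (hs.setNat (i := 5) (by norm_num) _).setReal _ _, by simpa [State.setNat, State.setReal],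
        fun i hi => ?_, rfl, by simp⟩
      simp [State.setNat, State.setReal, hi.ne])
    (by
      rintro k st hk ⟨i1, i2, i3, i4, i5, i6, i7⟩
      have hkn : k < n := by exact_mod_cast hk
      have hgs := hg.sameInput i3
      obtain ⟨t, s', he, ht, hv, hk'⟩ := exec_expr (Tsp := Tsp) (Tct := Tct) (ω := ω)
        (e := freeExpr a) rfl (s := st) (by rw [i3.nat 3 (by norm_num), h3])
      rw [eval_freeExpr lam hgs (by rw [i3.realArr a ha4, ha]) i4 (u := ⟨k, hkn⟩) i1,
        ← freeAt_val] at hv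
      have hc := RealExpr.cost_le_costBound le_rfl (l := []) (freeExpr a) hgs.nat_zero hgs.nat_one
        (by simp) rfl
      rw [costBound_freeExpr] at hc
      have hn5 : s'.nat 5 = k := by rw [hk'.nat 5 (by norm_num), i1]
      have i3' := i3.keeps hk'
      have i3'' : SameInput s₀ ((Instr.realStore 5 5 20).apply s') :=
        ⟨i3'.nat, i3'.natArr, fun b hb => by
          simp [Instr.apply, State.setRealArr, show b ≠ 5 by omega, i3'.realArr b hb]⟩
      refine ⟨_, _, .seq he (.op _ _), by omega, ?_, hn5, by simp [State.setNat, State.setReal],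
        by simp [State.setNat, State.setReal], (i3''.setNat (i := 5) (by norm_num) _).setReal _ _,
        ?_, ?_, ?_, ?_⟩
      · exact (i3''.nat 3 (by norm_num)).trans h3
      · simp [State.setNat, State.setReal, Instr.apply, State.setRealArr, hk'.nat 4, i4]
      · intro i hi
        simp [State.setNat, State.setReal, Instr.apply, State.setRealArr, hi.ne,
          hk'.real i (by omega), i5 i hi]
      · simp [State.setNat, State.setReal, Instr.apply, State.setRealArr, hk'.calls, i6]
      · intro j hj hjn
        simp only [State.setNat, State.setReal, Instr.apply, State.setRealArr, hn5,
          Function.update_self]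
        by_cases hjk : j = k
        · subst hjk
          rw [Function.update_self, hv]
        · rw [Function.update_of_ne hjk, hk'.realArr]
          exact i7 j (by omega) hjn)
  obtain ⟨t, s', he, ht, -, -, i3, i4, i5, i6, i7⟩ := h
  refine ⟨t, s', he, ht.trans (le_of_eq ?_), i3, i4, i5, i6, fun j hj => i7 j (by simpa) hj⟩
  simp only [Nat.ceil_natCast, Finset.sum_const, Finset.card_range, smul_eq_mul]
  ring

open Classical in
theorem exec_vertexStep (hs : SameInput s₀ s) (hg : HasGraph G s₀) (h3 : s₀.nat 3 = 1) (ha4 : a < 4)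
    (ha : s₀.realArr a = realVec fun v => (lam v : ℝ)) {v : Fin n} (h4 : s.nat 4 = v)
    (h13 : s.real 13 = n) {K : ℕ} (hK : 1 ≤ K)
    (hfree : lam v ≠ 0 → 2 ^ (Finset.univ.filter (IsFree G lam v)).card ≤ K) :
    ∃ t s', Exec Tsp Tct ω (vertexStep a) s t s' ∧
      t ≤ 1000 * (K * (n * (n + numEdges G))) ∧ SameInput s₀ s' ∧ s'.nat 4 = v ∧
      (∀ i < 15, i ≠ 1 → i ≠ 12 → s'.real i = s.real i) ∧ s'.calls = s.calls ∧
      s'.real 1 = min (s.real 1) (vertexBound G lam v) := by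
  obtain ⟨t₁, s₁, he₁, ht₁, hs₁, n4, r₁, c₁, f₁⟩ := exec_freeLoop (Tsp := Tsp) (Tct := Tct) (ω := ω)
    lam hs hg h3 ha4 ha h4 h13
  have hg₁ := hg.sameInput hs₁
  have ha₁ : s₁.realArr a = realVec fun v => (lam v : ℝ) := by rw [hs₁.realArr a ha4, ha]
  obtain ⟨t₂, s₂, he₂, ht₂, hk₂⟩ := exec_assign (Tsp := Tsp) (Tct := Tct) (ω := ω) 12
    (e := enumSizeExpr a) rfl (s := s₁) (by rw [hs₁.nat 3 (by norm_num), h3])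
  have hs₂ := (hs₁.setReal 12 ((enumSizeExpr a).eval s₁)).keeps hk₂
  have hg₂ := hg.sameInput hs₂
  have n4' : s₂.nat 4 = v := by rw [hk₂.nat 4 (by norm_num)]; exact n4
  have f₂ : ∀ j < n, s₂.realArr 5 j = if FreeAt G lam v j then 1 else 0 := fun j hj => by
    rw [hk₂.realArr]; exact f₁ j hj
  have r12 : s₂.real 12 = if lam v = 0 then 1 else
      ((2 ^ (Finset.univ.filter (IsFree G lam v)).card : ℕ) : ℝ) := by
    rw [hk₂.real 12 (by norm_num), ← eval_enumSizeExpr lam hg₁ ha₁ n4 f₁]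
    simp [State.setReal]
  have hceil : ⌈s₂.real 12⌉₊ ≤ K := by
    rw [r12]
    split_ifs with h
    · simpa using hK
    · rw [Nat.ceil_natCast]; exact hfree h
  have r₂ : ∀ i < 15, i ≠ 12 → s₂.real i = s.real i := fun i hi hne => by
    rw [hk₂.real i (by omega), ← r₁ i hi]; simp [State.setReal, hne]
  obtain ⟨t₃, s₃, he₃, ht₃, hk₃⟩ := exec_assign (Tsp := Tsp) (Tct := Tct) (ω := ω) 1
    (e := vertexBoundExpr a) rfl (s := s₂) (by rw [hs₂.nat 3 (by norm_num), h3])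
  have hev := eval_vertexBoundExpr lam hg₂ (by rw [hs₂.realArr a ha4, ha]) n4' f₂ r12
  rw [r₂ 1 (by norm_num) (by norm_num)] at hev
  refine ⟨_, s₃, .seq he₁ (.seq he₂ he₃), ?_,
    (hs₂.setReal 1 ((vertexBoundExpr a).eval s₂)).keeps hk₃, ?_, ?_, ?_, ?_⟩
  · have c2 := RealExpr.cost_le_costBound le_rfl (l := []) (enumSizeExpr a) hg₁.nat_zero hg₁.nat_one
        (by simp) rfl
    have c3 := RealExpr.cost_le_costBound hK (l := [12]) (vertexBoundExpr a) hg₂.nat_zero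
      hg₂.nat_one (fun j hj => by rw [List.mem_singleton.1 hj]; exact hceil) rfl
    rw [costBound_enumSizeExpr] at c2
    rw [costBound_vertexBoundExpr] at c3
    have hn : 1 ≤ n := v.pos
    set m := numEdges G
    have hA : n ≤ n * n := Nat.le_mul_self n
    have hB : m ≤ n * m := Nat.le_mul_of_pos_left m hn
    have hC : n * (n + m) ≤ K * (n * (n + m)) := Nat.le_mul_of_pos_left _ hK
    have hD : K * (100 + 128 * n + 112 * (n * n) + 220 * m + 232 * (n * m)) ≤
        K * (500 * (n * (n + m))) := by
      refine Nat.mul_le_mul_left _ ?_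
      rw [mul_add]
      omega
    have hE : K * (500 * (n * (n + m))) = 500 * (K * (n * (n + m))) := by ring
    have hF : n * (36 + 69 * m) = 36 * n + 69 * (n * m) := by ring
    have hG : n * (n + m) = n * n + n * m := by ring
    omega
  · rw [hk₃.nat 4 (by norm_num)]; exact n4'
  · intro i hi h1 h12
    rw [hk₃.real i (by omega), ← r₂ i hi h12]; simp [State.setReal, h1]
  · rw [hk₃.calls]; exact hk₂.calls.trans c₁
  · rw [hk₃.real 1 (by norm_num), ← hev]; simp [State.setReal]

open Classical in
theorem exec_vertexLoop (hs : SameInput s₀ s) (hg : HasGraph G s₀) (h3 : s₀.nat 3 = 1) (ha4 : a < 4)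
    (ha : s₀.realArr a = realVec fun v => (lam v : ℝ)) (h13 : s.real 13 = n) {K : ℕ} (hK : 1 ≤ K)
    (hfree : ∀ v, lam v ≠ 0 → 2 ^ (Finset.univ.filter (IsFree G lam v)).card ≤ K) :
    ∃ t s', Exec Tsp Tct ω (.forLoop 4 13 14 (vertexStep a)) s t s' ∧
      t ≤ 3 + n * (1000 * (K * (n * (n + numEdges G))) + 3) ∧ SameInput s₀ s' ∧
      s'.real 0 = s.real 0 ∧ s'.real 13 = n ∧ s'.calls = s.calls ∧
      ∀ x, x ≤ s'.real 1 ↔ x ≤ s.real 1 ∧ ∀ v, x ≤ vertexBound G lam v := by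
  have h := exec_forLoop (Tsp := Tsp) (Tct := Tct) (ω := ω) (i := 4) (b := 13) (c := 14)
    (body := vertexStep a) (x := n) (B := fun _ => 1000 * (K * (n * (n + numEdges G)))) (s := s)
    (Inv := fun k st => st.nat 4 = k ∧ st.real 14 = k ∧ SameInput s₀ st ∧
      st.real 0 = s.real 0 ∧ st.real 13 = n ∧ st.calls = s.calls ∧
      ∀ x, x ≤ st.real 1 ↔ x ≤ s.real 1 ∧ ∀ v : Fin n, v < k → x ≤ vertexBound G lam v)
    (fun k st h => ⟨h.2.1, h.2.2.2.2.1⟩)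
    (by
      refine ⟨by simp [State.setNat, State.setReal], by simp [State.setNat, State.setReal],
        (hs.setNat (i := 4) (by norm_num) _).setReal _ _, by simp [State.setNat, State.setReal],
        by simpa [State.setNat, State.setReal], rfl, by simp [State.setNat, State.setReal]⟩)
    (by
      rintro k st hk ⟨i1, i2, i3, i4, i5, i6, i7⟩
      have hkn : k < n := by exact_mod_cast hk
      obtain ⟨t, s', he, ht, hs', j4, jr, jc, j1⟩ := exec_vertexStep (Tsp := Tsp) (Tct := Tct)
        (ω := ω) lam i3 hg h3 ha4 ha (v := ⟨k, hkn⟩) i1 i5 hK (hfree _)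
      refine ⟨t, s', he, ht, (hs'.nat 3 (by norm_num)).trans h3, j4,
        by simp [State.setNat, State.setReal], by simp [State.setNat, State.setReal],
        (hs'.setNat (i := 4) (by norm_num) _).setReal _ _, ?_, ?_, ?_, ?_⟩
      · simp [State.setNat, State.setReal, jr 0, i4]
      · simp [State.setNat, State.setReal, jr 13, i5]
      · simp [State.setNat, State.setReal, jc, i6]
      · intro x
        simp only [State.setNat, State.setReal, ne_eq, OfNat.one_ne_ofNat, not_false_eq_true,
          Function.update_of_ne, j1, le_min_iff, i7, and_assoc]
        refine and_congr_right fun _ => ⟨fun h v hv => ?_, fun h => ⟨fun v hv => h v (by omega),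
          h ⟨k, hkn⟩ (by simp)⟩⟩
        rcases Nat.lt_succ_iff_lt_or_eq.1 hv with hv | hv
        · exact h.1 v hv
        · rw [show v = ⟨k, hkn⟩ from Fin.ext hv]; exact h.2)
  obtain ⟨t, s', he, ht, -, -, i3, i4, i5, i6, i7⟩ := h
  refine ⟨t, s', he, ht.trans (le_of_eq ?_), i3, i4, i5, i6, fun x => ?_⟩
  · simp only [Nat.ceil_natCast, Finset.sum_const, Finset.card_range, smul_eq_mul]
  · simp [i7 x]

end

/-- The bounds on the parameters that the main program relies on: `b` is a bound for the marginals
and `κ` is the distance of the parameters of `w` and `w'`. -/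
structure ParamBounds {n : ℕ} (w w' : Config n → ℝ) (N b κ : ℝ) : Prop where
  far : min κ 1 * (b ^ 4 / 16) ≤ N * tvDist (gibbs w) (gibbs w')
  supp : κ ≤ 1 / 4 → ∀ σ, w σ = 0 → w' σ = 0
  close : κ ≤ 1 / 4 → ∃ C₀ : ℝ, 0 < C₀ ∧ ∀ σ, w σ ≠ 0 → |w' σ / w σ / C₀ - 1| ≤ 2 * κ

/-- The state from which the preprocessing starts. -/
def ModelPair.start {n : ℕ} {G : SimpleGraph (Fin n)} (M : ModelPair G) (ε : ℝ) : State :=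
  (M.input ε).setNat 3 1

theorem ModelPair.hasGraph_start {n : ℕ} {G : SimpleGraph (Fin n)} (M : ModelPair G) (ε : ℝ) :
    HasGraph G (M.start ε) :=
  ⟨by simp [start, State.setNat, input], by simp [start, State.setNat, input],
    by simp [start, State.setNat, input], by simp [start, State.setNat, input]⟩

theorem ModelPair.start_three {n : ℕ} {G : SimpleGraph (Fin n)} (M : ModelPair G) (ε : ℝ) :
    (M.start ε).nat 3 = 1 := by simp [start, State.setNat]

open RealExpr

/-- The distance of the parameters of two hardcore models. -/
def hardcoreDistExpr : RealExpr :=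
  sumV 10 30 (ite (load 0 (.var 10)) zero (ite (load 1 (.var 10)) zero zero one)
    (RealExpr.abs (sub (div (load 1 (.var 10)) (load 0 (.var 10))) one)))

/-- The likelihood ratio of the sample in index array `4`. -/
def hardcoreRatioExpr : RealExpr :=
  prodV 10 30 (ite one (cast (.load 4 (.var 10))) (div (load 1 (.var 10)) (load 0 (.var 10))) one)

/-- Preprocessing for hardcore models. -/
def hardcorePre : Prog :=
  .seq (.assign 13 (cast (.var 0))) (.seq (.assign 1 one) (.seq (.forLoop 4 13 14 (vertexStep 0))
    (.seq (.forLoop 4 13 14 (vertexStep 1)) (.seq (.assign 2 hardcoreDistExpr)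
      (.assign 3 (cast (.var 0)))))))

section

variable {n : ℕ} {G : SimpleGraph (Fin n)} {s : State}

theorem costBound_hardcoreDistExpr (n m K : ℕ) :
    hardcoreDistExpr.costBound n m K = 9 + 41 * n := by
  simp only [hardcoreDistExpr, RealExpr.costBound, RealExpr.sumV, RealExpr.sum, RealExpr.add,
    RealExpr.abs, RealExpr.sub, RealExpr.div, RealExpr.one, RealExpr.zero, IdxExpr.cost]
  ring

theorem costBound_hardcoreRatioExpr (n m K : ℕ) :
    hardcoreRatioExpr.costBound n m K = 9 + 17 * n := by
  simp only [hardcoreRatioExpr, RealExpr.costBound, RealExpr.prodV, RealExpr.prod, RealExpr.mul,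
    RealExpr.div, RealExpr.one, IdxExpr.cost]
  ring

theorem eval_hardcoreDistExpr (hg : HasGraph G s) {lam lam' : Fin n → ℝ≥0}
    (h0 : s.realArr 0 = realVec fun v => (lam v : ℝ))
    (h1 : s.realArr 1 = realVec fun v => (lam' v : ℝ)) :
    hardcoreDistExpr.eval s = ∑ v, fieldDist (lam v) (lam' v) := by
  have hz : ∀ x : ℝ≥0, ((x : ℝ) ≤ 0) ↔ x = 0 := fun x => by
    rw [← NNReal.coe_zero, NNReal.coe_le_coe, nonpos_iff_eq_zero]
  refine eval_sumV hg fun v acc => ?_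
  simp only [eval_ite, eval_abs, eval_sub, eval_div, eval_load, eval_one, eval_zero, IdxExpr.eval,
    State.setNat, State.setReal, Function.update_self, h0, h1, realVec_val, hz, fieldDist]

theorem eval_hardcoreRatioExpr (hg : HasGraph G s) {lam lam' : Fin n → ℝ≥0}
    (h0 : s.realArr 0 = realVec fun v => (lam v : ℝ))
    (h1 : s.realArr 1 = realVec fun v => (lam' v : ℝ)) {σ : Config n}
    (hσ : ∀ v : Fin n, s.natArr 4 v = (σ v).toNat) :
    hardcoreRatioExpr.eval s = ∏ v, if σ v = true then (lam' v : ℝ) / lam v else 1 := by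
  refine eval_prodV hg fun v acc => ?_
  simp only [eval_ite, eval_div, eval_load, eval_one, eval_cast, IdxExpr.eval,
    State.setNat, State.setReal, Function.update_self, h0, h1, realVec_val, hσ]
  cases σ v <;> simp

theorem le_vertexBound {lam : Fin n → ℝ≥0} {b : ℝ} (hb1 : b ≤ 1)
    (h : MarginallyBounded b (gibbs (hardcoreWeight G lam))) (v : Fin n) :
    b ≤ vertexBound G lam v := by
  unfold vertexBound
  split_ifs with h0
  · exact hb1
  · exact le_min (le_one_div_one_add h v) (le_div_localPartition h (pos_iff_ne_zero.2 h0))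

theorem hardcore_paramBounds {lam lam' : Fin n → ℝ≥0} {b : ℝ} (hb : 0 < b) (hb1 : b ≤ 1)
    (h : ∀ v, b ≤ vertexBound G lam v) (h' : ∀ v, b ≤ vertexBound G lam' v) :
    ParamBounds (hardcoreWeight G lam) (hardcoreWeight G lam') n b
      (∑ v, fieldDist (lam v) (lam' v)) := by
  have key : ∀ {l : Fin n → ℝ≥0}, (∀ v, b ≤ vertexBound G l v) →
      (∀ v, 0 < l v → b ≤ l v / localPartition G l v) ∧ ∀ v, b ≤ 1 / (1 + l v) := by
    intro l hl
    refine ⟨fun v hv => ?_, fun v => ?_⟩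
    · have := hl v
      rw [vertexBound, if_neg hv.ne'] at this
      exact this.trans (min_le_right _ _)
    · have := hl v
      unfold vertexBound at this
      split_ifs at this with h0
      · simpa [h0] using this
      · exact this.trans (min_le_left _ _)
  refine ⟨?_, fun hκ => (hardcore_ratio_close rfl hκ).1,
    fun hκ => ⟨1, one_pos, (hardcore_ratio_close rfl hκ).2⟩⟩
  have hs : b ^ 4 * ∑ v, fieldDist (lam v) (lam' v) ≤
      n * (2 * tvDist (gibbs (hardcoreWeight G lam)) (gibbs (hardcoreWeight G lam'))) := by
    rw [Finset.mul_sum]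
    refine (Finset.sum_le_card_nsmul _ _ _ fun v _ =>
      fieldDist_mul_le hb hb1 (key h).1 (key h').1 (key h).2 (key h').2 v).trans_eq ?_
    simp
  have hm : min (∑ v, fieldDist (lam v) (lam' v)) 1 * (b ^ 4 / 16) ≤
      (∑ v, fieldDist (lam v) (lam' v)) * (b ^ 4 / 16) :=
    mul_le_mul_of_nonneg_right (min_le_left _ _) (by positivity)
  have hn : 0 ≤ (n : ℝ) * tvDist (gibbs (hardcoreWeight G lam)) (gibbs (hardcoreWeight G lam')) :=
    mul_nonneg (Nat.cast_nonneg _) (tvDist_nonneg _ _)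
  linarith

open Classical in
theorem exists_exec_hardcorePre {lam : Side → Fin n → ℝ≥0} {ε b : ℝ}
    (hb : 0 < b) (hb1 : b ≤ 1) (hn : 0 < n)
    (h : ∀ x, MarginallyBounded b (gibbs (hardcoreWeight G (lam x)))) :
    ∃ b' κ, b ≤ b' ∧ b' ≤ 1 ∧
      ParamBounds (hardcoreWeight G (lam .mu)) (hardcoreWeight G (lam .nu)) n b' κ ∧
      ∀ (Tsp Tct : ℝ → ℕ) (ω : Tape n), ∃ t s,
        Exec Tsp Tct ω hardcorePre ((ModelPair.hardcore lam).start (G := G) ε) t s ∧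
        t ≤ 3000 * (2 ^ ⌊1 / b ^ 3⌋₊ * (n * (n * (n + numEdges G)))) ∧
        SameInput ((ModelPair.hardcore lam).start (G := G) ε) s ∧ s.calls = 0 ∧ s.real 0 = ε ∧
        s.real 1 = b' ∧ s.real 2 = κ ∧ s.real 3 = n := by
  set s₀ := (ModelPair.hardcore lam).start (G := G) ε with hs₀
  have hg := (ModelPair.hardcore lam).hasGraph_start (G := G) ε
  have h3 := (ModelPair.hardcore lam).start_three (G := G) ε
  rw [← hs₀] at hg h3
  have a0 : s₀.realArr 0 = realVec fun v => (lam .mu v : ℝ) := rfl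
  have a1 : s₀.realArr 1 = realVec fun v => (lam .nu v : ℝ) := rfl
  set K := 2 ^ ⌊1 / b ^ 3⌋₊ with hK
  have hK1 : 1 ≤ K := Nat.one_le_two_pow
  have hfree : ∀ x v, lam x v ≠ 0 →
      2 ^ (Finset.univ.filter (IsFree G (lam x) v)).card ≤ K := fun x v hv =>
    Nat.pow_le_pow_right (by norm_num)
      (Nat.le_floor (card_free_le hb (h x) (pos_iff_ne_zero.2 hv)))
  have : Nonempty (Fin n) := ⟨⟨0, hn⟩⟩
  obtain ⟨b', hb'⟩ : ∃ b' : ℝ, ∀ x, x ≤ b' ↔ x ≤ 1 ∧ (∀ v, x ≤ vertexBound G (lam .mu) v) ∧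
      ∀ v, x ≤ vertexBound G (lam .nu) v :=
    ⟨min 1 (min (Finset.univ.inf' Finset.univ_nonempty (vertexBound G (lam .mu)))
      (Finset.univ.inf' Finset.univ_nonempty (vertexBound G (lam .nu)))), fun x => by simp⟩
  have hbb : b ≤ b' := (hb' b).2 ⟨hb1, le_vertexBound hb1 (h _), le_vertexBound hb1 (h _)⟩
  obtain ⟨hle1, hle2, hle3⟩ := (hb' _).1 le_rfl
  refine ⟨b', ∑ v, fieldDist (lam .mu v) (lam .nu v), hbb, hle1,
    hardcore_paramBounds (hb.trans_le hbb) hle1 hle2 hle3, fun Tsp Tct ω => ?_⟩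
  obtain ⟨t₁, s₁, he₁, ht₁, hk₁⟩ := exec_assign (Tsp := Tsp) (Tct := Tct) (ω := ω) 13
    (e := cast (.var 0)) (s := s₀) rfl h3
  have hs₁ := ((SameInput.refl s₀).setReal 13 ((cast (.var 0)).eval s₀)).keeps hk₁
  obtain ⟨t₂, s₂, he₂, ht₂, hk₂⟩ := exec_assign (Tsp := Tsp) (Tct := Tct) (ω := ω) 1
    (e := one) (s := s₁) rfl ((hs₁.nat 3 (by norm_num)).trans h3)
  have hs₂ := (hs₁.setReal 1 (one.eval s₁)).keeps hk₂
  have r13 : s₂.real 13 = n := by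
    rw [hk₂.real 13 (by norm_num)]
    simp [State.setReal, hk₁.real 13, eval_cast, IdxExpr.eval, hg.nat_zero]
  have r0 : s₂.real 0 = ε := by
    rw [hk₂.real 0 (by norm_num)]
    simp [State.setReal, hk₁.real 0, hs₀, ModelPair.start, State.setNat, ModelPair.input]
  have r1 : s₂.real 1 = 1 := by
    rw [hk₂.real 1 (by norm_num)]
    simp [State.setReal, eval_one]
  have c₂ : s₂.calls = 0 := hk₂.calls.trans hk₁.calls
  obtain ⟨t₃, s₃, he₃, ht₃, hs₃, q0, q13, c₃, q1⟩ := exec_vertexLoop (Tsp := Tsp) (Tct := Tct)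
    (ω := ω) (lam .mu) hs₂ hg h3 (by norm_num) a0 r13 hK1 (hfree .mu)
  obtain ⟨t₄, s₄, he₄, ht₄, hs₄, p0, p13, c₄, p1⟩ := exec_vertexLoop (Tsp := Tsp) (Tct := Tct)
    (ω := ω) (lam .nu) hs₃ hg h3 (by norm_num) a1 q13 hK1 (hfree .nu)
  obtain ⟨t₅, s₅, he₅, ht₅, hk₅⟩ := exec_assign (Tsp := Tsp) (Tct := Tct) (ω := ω) 2
    (e := hardcoreDistExpr) (s := s₄) rfl ((hs₄.nat 3 (by norm_num)).trans h3)
  have hs₅ := (hs₄.setReal 2 (hardcoreDistExpr.eval s₄)).keeps hk₅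
  obtain ⟨t₆, s₆, he₆, ht₆, hk₆⟩ := exec_assign (Tsp := Tsp) (Tct := Tct) (ω := ω) 3
    (e := cast (.var 0)) (s := s₅) rfl ((hs₅.nat 3 (by norm_num)).trans h3)
  have hs₆ := (hs₅.setReal 3 ((cast (.var 0)).eval s₅)).keeps hk₆
  have r6 : ∀ i < 2, s₆.real i = s₄.real i := fun i hi => by
    rw [hk₆.real i (by omega)]
    simp [State.setReal, hk₅.real i (by omega), hi.ne, show i ≠ 3 by omega]
  have hall : s₄.real 1 = b' :=
    eq_of_forall_le_iff fun x => by rw [p1, q1, r1, and_assoc, hb']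
  refine ⟨_, s₆, .seq he₁ (.seq he₂ (.seq he₃ (.seq he₄ (.seq he₅ he₆)))), ?_, hs₆, ?_, ?_,
    (r6 1 (by norm_num)).trans hall, ?_, ?_⟩
  · have hc := RealExpr.cost_le_costBound hK1 (l := []) hardcoreDistExpr
      (hg.sameInput hs₄).nat_zero (hg.sameInput hs₄).nat_one (by simp) rfl
    rw [costBound_hardcoreDistExpr] at hc
    simp only [RealExpr.cost, IdxExpr.cost, one] at ht₁ ht₂ ht₆
    set X := K * (n * (n + numEdges G)) with hX
    have e1 : K * (n * (n * (n + numEdges G))) = n * X := by rw [hX]; ring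
    have e2 : n ≤ n * X := Nat.le_mul_of_pos_right _ (by positivity)
    have e3 : n * (1000 * X + 3) = 1000 * (n * X) + 3 * n := by ring
    rw [e1]
    omega
  · exact hk₆.calls.trans (hk₅.calls.trans (c₄.trans (c₃.trans c₂)))
  · rw [r6 0 (by norm_num), p0, q0, r0]
  · rw [← eval_hardcoreDistExpr (hg.sameInput hs₄) ((hs₄.realArr 0 (by norm_num)).trans a0)
      ((hs₄.realArr 1 (by norm_num)).trans a1), hk₆.real 2 (by norm_num)]
    simp [State.setReal, hk₅.real 2]
  · rw [hk₆.real 3 (by norm_num)]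
    simp [State.setReal, eval_cast, IdxExpr.eval, (hg.sameInput hs₅).nat_zero]

end

/-! ### Ising models: expressions -/

namespace RealExpr

def two : RealExpr := const 2

/-- Sum over the edges at the vertex in index register `i`, where `x` is the summand if the vertex
is the first end and `y` if it is the second end. -/
def sumAt (i k r : ℕ) (x y : RealExpr) : RealExpr :=
  sumE k r (add (mul (eqInd (cast (.load 0 (.var k))) (cast (.var i))) x)
    (mul (eqInd (cast (.load 1 (.var k))) (cast (.var i))) y))

/-- The indicator that the vertex `j` is not pinned in the system number `a`. -/
def freeIndExpr (a : ℕ) (j : IdxExpr) : RealExpr := eqInd (cast (.load (a + 2) j)) zero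

def pinSignExpr (a : ℕ) (j : IdxExpr) : RealExpr :=
  sub (eqInd (cast (.load (a + 2) j)) one) (eqInd (cast (.load (a + 2) j)) two)

def effFieldExpr (a i k r : ℕ) : RealExpr :=
  add (load a (.var i)) (sumAt i k r
    (mul (load (a + 2) (.var k)) (pinSignExpr a (.load 1 (.var k))))
    (mul (load (a + 2) (.var k)) (pinSignExpr a (.load 0 (.var k)))))

def strengthExpr (a i k r : ℕ) : RealExpr :=
  mul (freeIndExpr a (.var i)) (add (effFieldExpr a i k r).abs (sumAt i k r
    (mul (load (a + 2) (.var k)).abs (freeIndExpr a (.load 1 (.var k))))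
    (mul (load (a + 2) (.var k)).abs (freeIndExpr a (.load 0 (.var k))))))

def marginalExpr (a i k r : ℕ) : RealExpr := exp (mul (const (-2)) (strengthExpr a i k r))

def isingBoundExpr : RealExpr :=
  minV 10 30 (minV 10 40 one (marginalExpr 0 10 11 60)) (marginalExpr 1 10 11 60)

def isingDistExpr : RealExpr :=
  add
    (sumV 10 30 (add
      (mul (eqInd (cast (.load 2 (.var 10))) (cast (.load 3 (.var 10))))
        (mul (freeIndExpr 0 (.var 10))
          (sub (effFieldExpr 1 10 11 50) (effFieldExpr 0 10 11 60)).abs))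
      (sub one (eqInd (cast (.load 2 (.var 10))) (cast (.load 3 (.var 10)))))))
    (sumE 10 30 (mul
      (mul (freeIndExpr 0 (.load 0 (.var 10))) (freeIndExpr 0 (.load 1 (.var 10))))
      (sub (load 3 (.var 10)) (load 2 (.var 10))).abs))

/-- The spin of the vertex `j` in the sample. -/
def spinExpr (j : IdxExpr) : RealExpr := sub (mul two (cast (.load 4 j))) one

/-- The number of vertices of the sample that violate the second system. -/
def violationsExpr : RealExpr :=
  sumV 10 30 (add
    (mul (eqInd (cast (.load 3 (.var 10))) one) (sub one (cast (.load 4 (.var 10)))))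
    (mul (eqInd (cast (.load 3 (.var 10))) two) (cast (.load 4 (.var 10)))))

def isingRatioExpr : RealExpr :=
  ite violationsExpr zero
    (exp (add
      (sumE 10 30 (mul (sub (load 3 (.var 10)) (load 2 (.var 10)))
        (mul (spinExpr (.load 0 (.var 10))) (spinExpr (.load 1 (.var 10))))))
      (sumV 10 30 (mul (spinExpr (.var 10)) (sub (load 1 (.var 10)) (load 0 (.var 10)))))))
    zero

end RealExpr

open RealExpr

section

variable {n : ℕ} {G : SimpleGraph (Fin n)} {s : State}

/-- The arrays of the system number `a` hold the parameters of `I`. -/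
structure HoldsIsing (I : IsingModel G) (a : ℕ) (s : State) : Prop where
  field : s.realArr a = realVec I.field
  mark : s.natArr (a + 2) = natVec I.mark
  J : s.realArr (a + 2) = edgeVec G I.J

theorem natVec_val (f : Fin n → ℕ) (v : Fin n) : natVec f v = f v := by simp [natVec]

namespace RealExpr

theorem eval_two : two.eval s = 2 := by simp [two, eval]

theorem eval_sumAt (hg : HasGraph G s) {i k r : ℕ} (hik : i ≠ k) {w : Fin n}
    (hi : s.nat i = w) {F : Fin n → Fin n → ℝ} (h0 : ∀ u v, ¬ G.Adj u v → F u v = 0)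
    {x y : RealExpr}
    (hx : ∀ j p, (edgeList G)[j]? = some p → ∀ acc,
      x.eval ((s.setNat k j).setReal r acc) = F p.1 p.2)
    (hy : ∀ j p, (edgeList G)[j]? = some p → ∀ acc,
      y.eval ((s.setNat k j).setReal r acc) = F p.2 p.1) :
    (sumAt i k r x y).eval s = ∑ u, F w u := by
  rw [← sum_edgeList_at G h0 w]
  refine eval_sumE hg fun j p hj acc => ?_
  have hne : p.1 ≠ p.2 := ((mem_edgeList G).1 (List.mem_of_getElem? hj)).1.ne
  have e0 : ((s.setNat k j).setReal r acc).natArr 0 j = p.1 := hg.fst_eq hj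
  have e1 : ((s.setNat k j).setReal r acc).natArr 1 j = p.2 := hg.snd_eq hj
  have e2 : ((s.setNat k j).setReal r acc).nat k = j := by simp [State.setNat, State.setReal]
  have e3 : ((s.setNat k j).setReal r acc).nat i = w := by
    simp [State.setNat, State.setReal, hik, hi]
  rw [eval_add, eval_mul, eval_mul, eval_eqInd, eval_eqInd, hx j p hj, hy j p hj]
  simp only [eval_cast, IdxExpr.eval, e0, e1, e2, e3, Nat.cast_inj, Fin.val_inj]
  by_cases h1 : p.1 = w
  · have h2 : ¬ p.2 = w := fun h => hne (h1.trans h.symm)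
    simp [h1, h2]
  · by_cases h2 : p.2 = w <;> simp [h1, h2]

variable {I I' : IsingModel G} {a : ℕ}

theorem eval_freeIndExpr (h : HoldsIsing I a s) {j : IdxExpr} {v : Fin n} (hj : j.eval s = v) :
    (freeIndExpr a j).eval s = I.freeInd v := by
  rw [freeIndExpr, eval_eqInd, eval_cast, IdxExpr.eval, hj, h.mark, natVec_val, eval_zero,
    IsingModel.freeInd]
  simp

theorem eval_pinSignExpr (h : HoldsIsing I a s) {j : IdxExpr} {v : Fin n} (hj : j.eval s = v) :
    (pinSignExpr a j).eval s = I.pinSign v := by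
  rw [pinSignExpr, eval_sub, eval_eqInd, eval_eqInd, eval_cast, IdxExpr.eval, hj, h.mark,
    natVec_val, eval_one, eval_two, IsingModel.pinSign]
  rcases I.mark_cases v with h | h | h <;> simp [h]

theorem _root_.TVSpin.HoldsIsing.set (h : HoldsIsing I a s) (i k r : ℕ) (x : ℝ) :
    HoldsIsing I a ((s.setNat i k).setReal r x) := ⟨h.field, h.mark, h.J⟩

theorem J_eq_zero (I : IsingModel G) {u v : Fin n} (h : ¬ G.Adj u v) : I.J u v = 0 := by
  by_contra h0
  exact h (I.supp u v h0)

theorem eval_load_J (h : HoldsIsing I a s) {k j : ℕ} (hk : s.nat k = j) {p : Fin n × Fin n}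
    (hj : (edgeList G)[j]? = some p) : (load (a + 2) (.var k)).eval s = I.J p.1 p.2 := by
  rw [eval_load, IdxExpr.eval, h.J, hk]
  exact edgeVec_eq hj

theorem eval_effFieldExpr (hg : HasGraph G s) (h : HoldsIsing I a s) {i k r : ℕ} (hik : i ≠ k) {v : Fin n} (hi : s.nat i = v) :
    (effFieldExpr a i k r).eval s = I.effField v := by
  have hnk : ∀ j x, ((s.setNat k j).setReal r x).nat k = j := by simp [State.setNat, State.setReal]
  rw [effFieldExpr, eval_add, eval_sumAt hg hik hi (F := fun v u => I.J v u * I.pinSign u)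
    (fun u v huv => by simp only [J_eq_zero I huv, zero_mul]), eval_load, IdxExpr.eval, hi, h.field,
    realVec_val, IsingModel.effField]
  · intro j p hj x
    rw [eval_mul, eval_load_J (h.set _ _ _ _) (hnk _ _) hj,
      eval_pinSignExpr (h.set _ _ _ _) (v := p.2)]
    rw [IdxExpr.eval, IdxExpr.eval, hnk]
    exact hg.snd_eq hj
  · intro j p hj x
    rw [eval_mul, eval_load_J (h.set _ _ _ _) (hnk _ _) hj, I.J_comm p.2,
      eval_pinSignExpr (h.set _ _ _ _) (v := p.1)]
    rw [IdxExpr.eval, IdxExpr.eval, hnk]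
    exact hg.fst_eq hj

theorem eval_strengthExpr (hg : HasGraph G s) (h : HoldsIsing I a s) {i k r : ℕ} (hik : i ≠ k) {v : Fin n} (hi : s.nat i = v) :
    (strengthExpr a i k r).eval s = I.strength v := by
  have hnk : ∀ j x, ((s.setNat k j).setReal r x).nat k = j := by simp [State.setNat, State.setReal]
  rw [strengthExpr, eval_mul, eval_freeIndExpr h (v := v) (by rw [IdxExpr.eval, hi]), eval_add,
    eval_abs, eval_effFieldExpr hg h hik hi,
    eval_sumAt hg hik hi (F := fun v u => |I.J v u| * I.freeInd u)
    (fun u v huv => by simp only [J_eq_zero I huv, abs_zero, zero_mul]), IsingModel.strength]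
  · intro j p hj x
    rw [eval_mul, eval_abs, eval_load_J (h.set _ _ _ _) (hnk _ _) hj,
      eval_freeIndExpr (h.set _ _ _ _) (v := p.2)]
    rw [IdxExpr.eval, IdxExpr.eval, hnk]
    exact hg.snd_eq hj
  · intro j p hj x
    rw [eval_mul, eval_abs, eval_load_J (h.set _ _ _ _) (hnk _ _) hj, I.J_comm p.2,
      eval_freeIndExpr (h.set _ _ _ _) (v := p.1)]
    rw [IdxExpr.eval, IdxExpr.eval, hnk]
    exact hg.fst_eq hj

theorem eval_marginalExpr (hg : HasGraph G s) (h : HoldsIsing I a s) {i k r : ℕ} (hik : i ≠ k) {v : Fin n} (hi : s.nat i = v) :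
    (marginalExpr a i k r).eval s = Real.exp (-2 * I.strength v) := by
  rw [marginalExpr, eval_exp, eval_mul, eval_strengthExpr hg h hik hi, eval_const]
  norm_num

theorem le_eval_isingBoundExpr (hg : HasGraph G s) (h : HoldsIsing I 0 s)
    (h' : HoldsIsing I' 1 s) {x : ℝ} : x ≤ isingBoundExpr.eval s ↔
      (x ≤ 1 ∧ ∀ v, x ≤ Real.exp (-2 * I.strength v)) ∧ ∀ v, x ≤ Real.exp (-2 * I'.strength v) := by
  rw [isingBoundExpr, le_eval_minV hg, le_eval_minV hg, eval_one]
  · intro v acc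
    exact eval_marginalExpr ((hg.setNat (by norm_num) _).setReal _ _) (h.set _ _ _ _) (by norm_num)
      (by simp [State.setNat, State.setReal])
  · intro v acc
    exact eval_marginalExpr ((hg.setNat (by norm_num) _).setReal _ _) (h'.set _ _ _ _) (by norm_num)
      (by simp [State.setNat, State.setReal])

theorem eval_isingDistExpr (hg : HasGraph G s) (h : HoldsIsing I 0 s) (h' : HoldsIsing I' 1 s) :
    isingDistExpr.eval s = I.paramDist I' := by
  rw [isingDistExpr, eval_add, IsingModel.paramDist]
  congr 1
  · refine eval_sumV hg fun v acc => ?_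
    have hv : ((s.setNat 10 v).setReal 30 acc).nat 10 = v := by simp [State.setNat, State.setReal]
    have hg' : HasGraph G ((s.setNat 10 v).setReal 30 acc) :=
      (hg.setNat (i := 10) (by norm_num) _).setReal _ _
    rw [eval_add, eval_mul, eval_mul, eval_sub, eval_one, eval_abs, eval_sub,
      eval_freeIndExpr (h.set _ _ _ _) (v := v) (by rw [IdxExpr.eval, hv]),
      eval_effFieldExpr hg' (h.set _ _ _ _) (by norm_num) hv,
      eval_effFieldExpr hg' (h'.set _ _ _ _) (by norm_num) hv, eval_eqInd]
    have m0 : ((s.setNat 10 v).setReal 30 acc).natArr 2 = natVec I.mark := h.mark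
    have m1 : ((s.setNat 10 v).setReal 30 acc).natArr 3 = natVec I'.mark := h'.mark
    simp only [eval_cast, IdxExpr.eval, hv, m0, m1, natVec_val, Nat.cast_inj]
    split_ifs <;> simp
  · rw [← sum_edgeList_symm G (F := fun u v => I.freeInd u * I.freeInd v * |I'.J u v - I.J u v|)]
    · refine eval_sumE hg fun j p hj acc => ?_
      have hv : ((s.setNat 10 j).setReal 30 acc).nat 10 = j := by simp [State.setNat, State.setReal]
      rw [eval_mul, eval_mul, eval_freeIndExpr (h.set _ _ _ _) (v := p.1),
        eval_freeIndExpr (h.set _ _ _ _) (v := p.2), eval_abs, eval_sub,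
        eval_load_J (h.set _ _ _ _) hv hj, eval_load_J (h'.set _ _ _ _) hv hj]
      · rw [IdxExpr.eval, IdxExpr.eval, hv]
        exact hg.snd_eq hj
      · rw [IdxExpr.eval, IdxExpr.eval, hv]
        exact hg.fst_eq hj
    · intro u v
      rw [I.J_comm u v, I'.J_comm u v, mul_comm (I.freeInd u)]
    · intro u v huv
      simp only [J_eq_zero I huv, J_eq_zero I' huv, sub_zero, abs_zero, mul_zero]

variable {σ : Config n}

theorem eval_spinExpr (hσ : ∀ v : Fin n, s.natArr 4 v = (σ v).toNat) {j : IdxExpr} {v : Fin n}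
    (hj : j.eval s = v) : (spinExpr j).eval s = spin (σ v) := by
  rw [spinExpr, eval_sub, eval_mul, eval_two, eval_one, eval_cast, IdxExpr.eval, hj, hσ, spin]
  cases σ v <;> norm_num

theorem eval_violationsExpr_le (hg : HasGraph G s) (h' : HoldsIsing I' 1 s)
    (hσ : ∀ v : Fin n, s.natArr 4 v = (σ v).toNat) :
    violationsExpr.eval s ≤ 0 ↔ I'.Compat σ := by
  have hev : violationsExpr.eval s = ∑ v, if (I'.mark v = 1 → σ v = true) ∧
      (I'.mark v = 2 → σ v = false) then (0 : ℝ) else 1 := by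
    refine eval_sumV hg fun v acc => ?_
    have hv : ((s.setNat 10 v).setReal 30 acc).nat 10 = v := by simp [State.setNat, State.setReal]
    have m1 : ((s.setNat 10 v).setReal 30 acc).natArr 3 = natVec I'.mark := h'.mark
    have m4 : ((s.setNat 10 v).setReal 30 acc).natArr 4 = s.natArr 4 := rfl
    simp only [eval_add, eval_mul, eval_sub, eval_eqInd, eval_cast, IdxExpr.eval, hv, m1, m4, hσ,
      natVec_val, eval_one, eval_two]
    rcases I'.mark_cases v with h | h | h <;> cases σ v <;> simp [h]
  have hnn : ∀ v ∈ Finset.univ, (0 : ℝ) ≤ if (I'.mark v = 1 → σ v = true) ∧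
      (I'.mark v = 2 → σ v = false) then (0 : ℝ) else 1 := fun v _ => by split <;> norm_num
  rw [hev, (Finset.sum_nonneg hnn).ge_iff_eq', Finset.sum_eq_zero_iff_of_nonneg hnn]
  simp [IsingModel.Compat]

open Classical in
theorem eval_isingRatioExpr (hg : HasGraph G s) (h : HoldsIsing I 0 s) (h' : HoldsIsing I' 1 s)
    (hσ : ∀ v : Fin n, s.natArr 4 v = (σ v).toNat) :
    isingRatioExpr.eval s = if I'.Compat σ then Real.exp (I'.energy σ - I.energy σ) else 0 := by
  have e1 : (sumE 10 30 (mul (sub (load 3 (.var 10)) (load 2 (.var 10)))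
        (mul (spinExpr (.load 0 (.var 10))) (spinExpr (.load 1 (.var 10)))))).eval s =
      (1 / 2) * ∑ u, ∑ v, (I'.J u v - I.J u v) * (spin (σ u) * spin (σ v)) := by
    rw [← sum_edgeList_symm G
      (F := fun u v => (I'.J u v - I.J u v) * (spin (σ u) * spin (σ v)))]
    · refine eval_sumE hg fun j p hj acc => ?_
      have hv : ((s.setNat 10 j).setReal 30 acc).nat 10 = j := by simp [State.setNat, State.setReal]
      have hσ' : ∀ v : Fin n, ((s.setNat 10 j).setReal 30 acc).natArr 4 v = (σ v).toNat := hσ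
      rw [eval_mul, eval_mul, eval_spinExpr hσ' (v := p.1), eval_spinExpr hσ' (v := p.2), eval_sub,
        eval_load_J (h.set _ _ _ _) hv hj, eval_load_J (h'.set _ _ _ _) hv hj]
      · rw [IdxExpr.eval, IdxExpr.eval, hv]
        exact hg.snd_eq hj
      · rw [IdxExpr.eval, IdxExpr.eval, hv]
        exact hg.fst_eq hj
    · intro u v
      rw [I.J_comm u v, I'.J_comm u v, mul_comm (spin (σ u))]
    · intro u v huv
      simp only [J_eq_zero I huv, J_eq_zero I' huv, sub_zero, zero_mul]
  have e2 : (sumV 10 30 (mul (spinExpr (.var 10))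
      (sub (load 1 (.var 10)) (load 0 (.var 10))))).eval s =
      ∑ v, spin (σ v) * (I'.field v - I.field v) := by
    refine eval_sumV hg fun v acc => ?_
    have hv : ((s.setNat 10 v).setReal 30 acc).nat 10 = v := by simp [State.setNat, State.setReal]
    have hσ' : ∀ u : Fin n, ((s.setNat 10 v).setReal 30 acc).natArr 4 u = (σ u).toNat := hσ
    have f0 : ((s.setNat 10 v).setReal 30 acc).realArr 0 = realVec I.field := h.field
    have f1 : ((s.setNat 10 v).setReal 30 acc).realArr 1 = realVec I'.field := h'.field
    rw [eval_mul, eval_spinExpr hσ' (v := v) (by rw [IdxExpr.eval, hv]), eval_sub, eval_load,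
      eval_load, f0, f1, IdxExpr.eval, hv, realVec_val, realVec_val]
  rw [isingRatioExpr, eval_ite, eval_exp, eval_add, e1, e2, eval_zero,
    if_congr (eval_violationsExpr_le hg h' hσ) rfl rfl]
  have : (1 / 2) * ∑ u, ∑ v, (I'.J u v - I.J u v) * (spin (σ u) * spin (σ v)) +
      ∑ v, spin (σ v) * (I'.field v - I.field v) = I'.energy σ - I.energy σ := by
    simp only [IsingModel.energy, sub_mul, mul_sub, Finset.sum_sub_distrib, mul_assoc]
    ring
  rw [this]

theorem costBound_isingBoundExpr (n m K : ℕ) :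
    isingBoundExpr.costBound n m K = 17 + 282 * n + 1648 * (n * m) := by
  simp only [isingBoundExpr, marginalExpr, strengthExpr, effFieldExpr, freeIndExpr, pinSignExpr,
    sumAt, minV, minimum, eqInd, RealExpr.costBound, RealExpr.sumE, RealExpr.sum,
    RealExpr.add, RealExpr.mul, RealExpr.abs, RealExpr.sub, two, RealExpr.one,
    RealExpr.zero, IdxExpr.cost]
  ring

theorem costBound_isingDistExpr (n m K : ℕ) :
    isingDistExpr.costBound n m K = 19 + 137 * n + 642 * (n * m) + 57 * m := by
  simp only [isingDistExpr, effFieldExpr, freeIndExpr, pinSignExpr, sumAt, eqInd,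
    RealExpr.costBound, RealExpr.sumV, RealExpr.sumE, RealExpr.sum, RealExpr.add, RealExpr.mul,
    RealExpr.abs, RealExpr.sub, two, RealExpr.one, RealExpr.zero, IdxExpr.cost]
  ring

theorem costBound_isingRatioExpr (n m K : ℕ) :
    isingRatioExpr.costBound n m K = 32 + 62 * n + 29 * m := by
  simp only [isingRatioExpr, violationsExpr, spinExpr, eqInd, RealExpr.costBound, RealExpr.sumV,
    RealExpr.sumE, RealExpr.sum, RealExpr.add, RealExpr.mul, RealExpr.sub, two, RealExpr.one,
    RealExpr.zero, IdxExpr.cost]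
  ring

end RealExpr

/-! ### Ising models: programs -/

/-- Preprocessing for Ising models. -/
def isingPre : Prog :=
  .seq (.assign 1 isingBoundExpr) (.seq (.assign 2 isingDistExpr)
    (.assign 3 (add (cast (.var 0)) (cast (.var 1)))))

theorem ModelPair.holdsIsing_start (I : Side → IsingModel G) (ε : ℝ) :
    HoldsIsing (I .mu) 0 ((ModelPair.ising I).start ε) ∧
      HoldsIsing (I .nu) 1 ((ModelPair.ising I).start ε) :=
  ⟨⟨rfl, rfl, rfl⟩, ⟨rfl, rfl, rfl⟩⟩

theorem HoldsIsing.sameInput {I : IsingModel G} {a : ℕ} {s s' : State} (h : HoldsIsing I a s)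
    (ha : a < 2) (hs : SameInput s s') : HoldsIsing I a s' :=
  ⟨(hs.realArr a (by omega)).trans h.field, (hs.natArr _ (by omega)).trans h.mark,
    (hs.realArr _ (by omega)).trans h.J⟩

theorem ising_paramBounds {I I' : IsingModel G} {b : ℝ} (hb : 0 < b) (hb1 : b ≤ 1) (hn : 0 < n)
    (h : ∀ v, b ≤ Real.exp (-2 * I.strength v)) (h' : ∀ v, b ≤ Real.exp (-2 * I'.strength v)) :
    ParamBounds (isingWeight I) (isingWeight I') (n + numEdges G : ℕ) b (I.paramDist I') :=
  ⟨IsingModel.paramDist_mul_le hb hb1 h h' hn, fun hκ => (IsingModel.paramDist_ratio_close hκ).1,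
    fun hκ => (IsingModel.paramDist_ratio_close hκ).2⟩

theorem exists_exec_isingPre {I : Side → IsingModel G} {ε b : ℝ}
    (hb : 0 < b) (hb1 : b < 1) (hn : 0 < n)
    (h : ∀ x, MarginallyBounded b (gibbs (isingWeight (I x)))) :
    ∃ b' κ, b ≤ b' ∧ b' ≤ 1 ∧
      ParamBounds (isingWeight (I .mu)) (isingWeight (I .nu)) (n + numEdges G : ℕ) b' κ ∧
      ∀ (Tsp Tct : ℝ → ℕ) (ω : Tape n), ∃ t s,
        Exec Tsp Tct ω isingPre ((ModelPair.ising I).start ε) t s ∧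
        t ≤ 3000 * ((n + numEdges G) * (n + numEdges G)) ∧
        SameInput ((ModelPair.ising I).start ε) s ∧ s.calls = 0 ∧ s.real 0 = ε ∧
        s.real 1 = b' ∧ s.real 2 = κ ∧ s.real 3 = (n + numEdges G : ℕ) := by
  set s₀ := (ModelPair.ising I).start ε with hs₀
  have hg := (ModelPair.ising I).hasGraph_start ε
  have h3 := (ModelPair.ising I).start_three ε
  obtain ⟨hI, hI'⟩ := ModelPair.holdsIsing_start I ε
  rw [← hs₀] at hg h3 hI hI'
  have hall : ∀ x, x ≤ isingBoundExpr.eval s₀ ↔ _ := fun x => le_eval_isingBoundExpr hg hI hI'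
  have hb' : b ≤ isingBoundExpr.eval s₀ := (hall b).2 ⟨⟨hb1.le, (I .mu).le_exp_strength hb1 (h _)⟩,
    (I .nu).le_exp_strength hb1 (h _)⟩
  obtain ⟨⟨hle1, hle2⟩, hle3⟩ := (hall _).1 le_rfl
  refine ⟨isingBoundExpr.eval s₀, (I .mu).paramDist (I .nu), hb', hle1,
    ising_paramBounds (hb.trans_le hb') hle1 hn hle2 hle3, fun Tsp Tct ω => ?_⟩
  obtain ⟨t₁, s₁, he₁, ht₁, hk₁⟩ := exec_assign (Tsp := Tsp) (Tct := Tct) (ω := ω) 1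
    (e := isingBoundExpr) (s := s₀) rfl h3
  have hs₁ := ((SameInput.refl s₀).setReal 1 (isingBoundExpr.eval s₀)).keeps hk₁
  obtain ⟨t₂, s₂, he₂, ht₂, hk₂⟩ := exec_assign (Tsp := Tsp) (Tct := Tct) (ω := ω) 2
    (e := isingDistExpr) (s := s₁) rfl ((hs₁.nat 3 (by norm_num)).trans h3)
  have hs₂ := (hs₁.setReal 2 (isingDistExpr.eval s₁)).keeps hk₂
  obtain ⟨t₃, s₃, he₃, ht₃, hk₃⟩ := exec_assign (Tsp := Tsp) (Tct := Tct) (ω := ω) 3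
    (e := add (cast (.var 0)) (cast (.var 1))) (s := s₂) rfl ((hs₂.nat 3 (by norm_num)).trans h3)
  have hs₃ := (hs₂.setReal 3 ((add (cast (.var 0)) (cast (.var 1))).eval s₂)).keeps hk₃
  refine ⟨_, s₃, .seq he₁ (.seq he₂ he₃), ?_,
    hs₃, hk₃.calls.trans (hk₂.calls.trans hk₁.calls), ?_, ?_, ?_, ?_⟩
  · have hg₁ := hg.sameInput hs₁
    have c1 := RealExpr.cost_le_costBound le_rfl (l := []) isingBoundExpr
      hg.nat_zero hg.nat_one (by simp) rfl
    have c2 := RealExpr.cost_le_costBound le_rfl (l := []) isingDistExpr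
      hg₁.nat_zero hg₁.nat_one (by simp) rfl
    rw [costBound_isingBoundExpr] at c1
    rw [costBound_isingDistExpr] at c2
    simp only [RealExpr.cost, IdxExpr.cost, add] at ht₃
    set m := numEdges G
    have hA : n ≤ n * n := Nat.le_mul_self n
    have hB : m ≤ n * m := Nat.le_mul_of_pos_left m hn
    have hC : (n + m) * (n + m) = n * n + 2 * (n * m) + m * m := by ring
    omega
  · rw [hk₃.real 0 (by norm_num)]
    simp [State.setReal, hk₂.real 0, hk₁.real 0, hs₀, ModelPair.start, State.setNat,
      ModelPair.input]
  · rw [hk₃.real 1 (by norm_num)]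
    simp [State.setReal, hk₂.real 1, hk₁.real 1]
  · rw [hk₃.real 2 (by norm_num), ← eval_isingDistExpr (hg.sameInput hs₁)
      (hI.sameInput (by norm_num) hs₁) (hI'.sameInput (by norm_num) hs₁)]
    simp [State.setReal, hk₂.real 2]
  · rw [hk₃.real 3 (by norm_num)]
    simp [State.setReal, eval_add, eval_cast, IdxExpr.eval, (hg.sameInput hs₂).nat_zero,
      (hg.sameInput hs₂).nat_one]

end

/-! ### The algorithm -/

/-- The algorithm of the theorem. -/
def tvProg : Prog :=
  .seq (.op (.natConst 3 1)) (.branch (.natLT 2 3)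
    (.seq hardcorePre (mainProg hardcoreRatioExpr)) (.seq isingPre (mainProg RealExpr.isingRatioExpr)))

section

variable {n : ℕ} {G : SimpleGraph (Fin n)}

theorem ModelPair.weight_nonneg (M : ModelPair G) (x : Side) (σ : Config n) :
    0 ≤ M.weight x σ := by
  cases M with
  | hardcore lam => exact hardcoreWeight_nonneg _ σ
  | ising I => exact (I x).weight_nonneg σ

theorem ModelPair.partition_pos (M : ModelPair G) (x : Side) : 0 < partition (M.weight x) := by
  cases M with
  | hardcore lam => exact hardcore_partition_pos _
  | ising I => exact (I x).partition_pos

theorem ModelPair.le_size (M : ModelPair G) : n ≤ M.size := by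
  cases M with
  | hardcore lam => exact le_rfl
  | ising I => exact Nat.le_add_right _ _

open Classical in
theorem exists_exec_tvProg (M : ModelPair G) {ε b : ℝ} (h0 : 0 < ε) (h1 : ε < 1) (hb : 0 < b)
    (hb1 : b < 1) (hn : 0 < n) (h : ∀ x, MarginallyBounded b (gibbs (M.weight x))) :
    ∃ (b' κ : ℝ) (ρ : Config n → ℝ), b ≤ b' ∧ b' ≤ 1 ∧
      ParamBounds (M.weight .mu) (M.weight .nu) M.size b' κ ∧
      (∀ σ, M.weight .mu σ ≠ 0 → ρ σ = M.weight .nu σ / M.weight .mu σ) ∧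
      ∀ (Tsp Tct : ℝ → ℕ) (ω : Tape n), ∃ t s,
        Exec Tsp Tct ω tvProg (M.input ε) t s ∧
        t ≤ 3000 * (2 ^ ⌊1 / b ^ 3⌋₊ * (M.size * (M.size * (n + numEdges G)))) + 210 +
          ⌈sampleSize M.size ε (b' ^ 4 / 16)⌉₊ *
            (Tsp (sampleErr M.size ε (b' ^ 4 / 16)) + 100 * (n + numEdges G) + 100) +
          2 * Tct (countErr M.size ε (b' ^ 4 / 16)) ∧
        s.real 0 = mainOutput ω (sampleErr M.size ε (b' ^ 4 / 16))
          (countErr M.size ε (b' ^ 4 / 16)) κ ⌈sampleSize M.size ε (b' ^ 4 / 16)⌉₊ ρ := by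
  have hN : (1 : ℝ) ≤ M.size := by exact_mod_cast hn.trans_le M.le_size
  have hK1 : 1 ≤ 2 ^ ⌊1 / b ^ 3⌋₊ := Nat.one_le_two_pow
  have hg := M.hasGraph_start ε
  have h3 := M.start_three ε
  cases M with
  | hardcore lam =>
    obtain ⟨b', κ, hbb, hb1', hP, hpre⟩ := exists_exec_hardcorePre (ε := ε) hb hb1.le hn h
    refine ⟨b', κ, fun σ => ∏ v, if σ v = true then (lam .nu v : ℝ) / lam .mu v else 1, hbb, hb1',
      hP, fun σ hσ => hardcore_ratio_eq hσ, fun Tsp Tct ω => ?_⟩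
    obtain ⟨t, s, he, ht, hs, hc, r0, r1, r2, r3⟩ := hpre Tsp Tct ω
    obtain ⟨t', s', he', ht', hv⟩ := exec_mainProg (Tsp := Tsp) (Tct := Tct) (ω := ω)
      (ratio := hardcoreRatioExpr) rfl hs h3 hc (B := 100 * (n + numEdges G)) r0 r1 r2 r3 hN h0 h1
      (hb.trans_le hbb) hb1' (ρ := fun σ => ∏ v, if σ v = true then (lam .nu v : ℝ) / lam .mu v else 1)
      (fun σ s' hs' hσ => by
        have hg' := hg.sameInput hs'
        refine ⟨eval_hardcoreRatioExpr hg' (hs'.realArr 0 (by norm_num))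
          (hs'.realArr 1 (by norm_num)) hσ, ?_⟩
        have hcost := RealExpr.cost_le_costBound le_rfl (l := []) hardcoreRatioExpr
          hg'.nat_zero hg'.nat_one (by simp) rfl
        rw [costBound_hardcoreRatioExpr] at hcost
        omega)
    refine ⟨_, s', .seq (.op _ _) (.branch_true ?_ (.seq he he')), ?_, hv⟩
    · simp [Test.holds, Instr.apply, State.setNat, ModelPair.input]
    · change t ≤ 3000 * (2 ^ ⌊1 / b ^ 3⌋₊ * (n * (n * (n + numEdges G)))) at ht
      simp only [ModelPair.size] at ht' ⊢
      omega
  | ising I =>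
    obtain ⟨b', κ, hbb, hb1', hP, hpre⟩ := exists_exec_isingPre (ε := ε) hb hb1 hn h
    refine ⟨b', κ, fun σ => if (I .nu).Compat σ then
      Real.exp ((I .nu).energy σ - (I .mu).energy σ) else 0, hbb, hb1', hP,
      fun σ hσ => (IsingModel.ratio_eq hσ).symm, fun Tsp Tct ω => ?_⟩
    obtain ⟨t, s, he, ht, hs, hc, r0, r1, r2, r3⟩ := hpre Tsp Tct ω
    obtain ⟨hI, hI'⟩ := ModelPair.holdsIsing_start I ε
    obtain ⟨t', s', he', ht', hv⟩ := exec_mainProg (Tsp := Tsp) (Tct := Tct) (ω := ω)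
      (ratio := RealExpr.isingRatioExpr) rfl hs h3 hc (B := 100 * (n + numEdges G)) r0 r1 r2 r3 hN h0 h1
      (hb.trans_le hbb) hb1' (ρ := fun σ => if (I .nu).Compat σ then
        Real.exp ((I .nu).energy σ - (I .mu).energy σ) else 0)
      (fun σ s' hs' hσ => by
        have hg' := hg.sameInput hs'
        refine ⟨RealExpr.eval_isingRatioExpr hg' (hI.sameInput (by norm_num) hs')
          (hI'.sameInput (by norm_num) hs') hσ, ?_⟩
        have hcost := RealExpr.cost_le_costBound le_rfl (l := []) RealExpr.isingRatioExpr
          hg'.nat_zero hg'.nat_one (by simp) rfl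
        rw [RealExpr.costBound_isingRatioExpr] at hcost
        omega)
    refine ⟨_, s', .seq (.op _ _) (.branch_false ?_ (.seq he he')), ?_, hv⟩
    · simp [Test.holds, Instr.apply, State.setNat, ModelPair.input]
    · simp only [ModelPair.size] at ht' ⊢
      set N := n + numEdges G
      have hNpos : 1 ≤ N := by omega
      have e1 : N * N ≤ 2 ^ ⌊1 / b ^ 3⌋₊ * (N * (N * N)) :=
        (Nat.mul_le_mul_left N (Nat.le_mul_of_pos_left N hNpos)).trans
          (Nat.le_mul_of_pos_left _ hK1)
      omega

theorem tapeLaw_mainOutput_le {O : Oracles n} {w w' : Config n → ℝ} {N ε b κ : ℝ}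
    {ρ : Config n → ℝ} (hw : ∀ σ, 0 ≤ w σ) (hw' : ∀ σ, 0 ≤ w' σ) (hZ : 0 < partition w)
    (hZ' : 0 < partition w') (hO : IsSamplingOracle (gibbs w) (O.sample .mu))
    (hOc : IsCountingOracle (partition w) (O.count .mu))
    (hOc' : IsCountingOracle (partition w') (O.count .nu)) (hN : 1 ≤ N) (h0 : 0 < ε) (h1 : ε < 1)
    (hb : 0 < b) (hb1 : b ≤ 1) (hρ : ∀ σ, w σ ≠ 0 → ρ σ = w' σ / w σ)
    (hP : ParamBounds w w' N b κ) :
    O.tapeLaw {ω | ¬ |mainOutput ω (sampleErr N ε (b ^ 4 / 16)) (countErr N ε (b ^ 4 / 16)) κ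
      ⌈sampleSize N ε (b ^ 4 / 16)⌉₊ ρ - tvDist (gibbs w) (gibbs w')| ≤
        ε * tvDist (gibbs w) (gibbs w')} ≤ 1 / 3 := by
  have hβ : 0 < b ^ 4 / 16 := by positivity
  have hβ1 : b ^ 4 / 16 ≤ 1 := by
    have := pow_le_one₀ (n := 4) hb.le hb1
    linarith
  have hfar := hP.far
  by_cases hκ : κ ≤ 1 / 4
  · obtain ⟨C₀, hC, hclose⟩ := hP.close hκ
    simp only [mainOutput, hκ, if_true]
    rw [min_eq_left (by linarith)] at hfar
    exact tapeLaw_estimate_close_le hw hw' hZ hZ' hO hN h0 h1 hβ hβ1 hρ (hP.supp hκ) hC hκ hclose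
      hfar
  · simp only [mainOutput, hκ, if_false]
    refine tapeLaw_estimate_far_le hw hw' hZ hZ' hO hOc hOc' hN h0 h1 hβ hβ1 hρ ?_ _ _
    have : 1 / 4 ≤ min κ 1 := le_min (not_le.1 hκ).le (by norm_num)
    nlinarith

/-- The time bound of the algorithm in terms of the marginal bound `b`. -/
theorem time_le {N ε b b' : ℝ} {P L t : ℕ} {Tsp Tct : ℝ → ℕ} (hN : 1 ≤ N) (h0 : 0 < ε)
    (h1 : ε < 1) (hb : 0 < b) (hbb : b ≤ b') (hb1 : b' ≤ 1) (hL : 1 ≤ L)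
    (hsp : AntitoneOn Tsp (Set.Ioo 0 1)) (hct : AntitoneOn Tct (Set.Ioo 0 1))
    (hLsp : ∀ δ ∈ Set.Ioo (0 : ℝ) 1, L ≤ Tsp δ)
    (ht : (t : ℝ) ≤ 3000 * (P * (N * (N * L))) + 210 +
      ⌈sampleSize N ε (b' ^ 4 / 16)⌉₊ * (Tsp (sampleErr N ε (b' ^ 4 / 16)) + 100 * L + 100) +
      2 * Tct (countErr N ε (b' ^ 4 / 16))) :
    (t : ℝ) ≤ (3000 * P + 210 + 402 * (2 ^ 24 / b ^ 8)) *
      (N ^ 2 / ε ^ 2 * Tsp (1 / 2 ^ 30 * b ^ 8 * ε ^ 2 / N ^ 2) +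
        Tct (1 / 2 ^ 30 * b ^ 8 * ε / N)) := by
  have hb' : 0 < b' := hb.trans_le hbb
  have hβ : 0 < b' ^ 4 / 16 := by positivity
  have hβ1 : b' ^ 4 / 16 ≤ 1 := by
    have := pow_le_one₀ (n := 4) hb'.le hb1
    linarith
  have hδ := sampleErr_mem hN h0 h1 hβ hβ1
  have hδ' := countErr_mem hN h0 h1 hβ hβ1
  have hK := ceil_sampleSize_le hN h0 h1 hβ hβ1
  have hb8 : b ^ 8 ≤ b' ^ 8 := by gcongr
  have hb48 : b ^ 8 ≤ b' ^ 4 :=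
    hb8.trans (pow_le_pow_of_le_one hb'.le hb1 (by norm_num))
  have hle : 1 / 2 ^ 30 * b ^ 8 * ε ^ 2 / N ^ 2 ≤ sampleErr N ε (b' ^ 4 / 16) := by
    have e : sampleErr N ε (b' ^ 4 / 16) = 1 / 2 ^ 30 * b' ^ 8 * ε ^ 2 / N ^ 2 := by
      unfold sampleErr; field_simp; norm_num
    rw [e]; gcongr
  have hle' : 1 / 2 ^ 30 * b ^ 8 * ε / N ≤ countErr N ε (b' ^ 4 / 16) := by
    have e : countErr N ε (b' ^ 4 / 16) = 1 / 2 ^ 10 * b' ^ 4 * ε / N := by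
      unfold countErr; field_simp; norm_num
    rw [e]; gcongr <;> norm_num
  have hm : 1 / 2 ^ 30 * b ^ 8 * ε ^ 2 / N ^ 2 ∈ Set.Ioo (0 : ℝ) 1 :=
    ⟨by positivity, hle.trans_lt hδ.2⟩
  have hm' : 1 / 2 ^ 30 * b ^ 8 * ε / N ∈ Set.Ioo (0 : ℝ) 1 :=
    ⟨by positivity, hle'.trans_lt hδ'.2⟩
  have hS : (Tsp (sampleErr N ε (b' ^ 4 / 16)) : ℝ) ≤ Tsp (1 / 2 ^ 30 * b ^ 8 * ε ^ 2 / N ^ 2) := by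
    exact_mod_cast hsp hm hδ hle
  have hC : (Tct (countErr N ε (b' ^ 4 / 16)) : ℝ) ≤ Tct (1 / 2 ^ 30 * b ^ 8 * ε / N) := by
    exact_mod_cast hct hm' hδ' hle'
  have hLS : (L : ℝ) ≤ Tsp (1 / 2 ^ 30 * b ^ 8 * ε ^ 2 / N ^ 2) := by exact_mod_cast hLsp _ hm
  have hL1 : (1 : ℝ) ≤ L := by exact_mod_cast hL
  set S : ℝ := (Tsp (1 / 2 ^ 30 * b ^ 8 * ε ^ 2 / N ^ 2) : ℝ)
  set D : ℝ := (Tct (1 / 2 ^ 30 * b ^ 8 * ε / N) : ℝ)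
  set R := N ^ 2 / ε ^ 2 with hR
  have hNR : N ^ 2 ≤ R := by
    rw [hR, le_div_iff₀ (by positivity)]
    exact mul_le_of_le_one_right (by positivity) (pow_le_one₀ h0.le h1.le)
  have hR1 : 1 ≤ R := (one_le_pow₀ hN).trans hNR
  have hsize : sampleSize N ε (b' ^ 4 / 16) ≤ 2 ^ 24 / b ^ 8 * R := by
    have e : sampleSize N ε (b' ^ 4 / 16) = 2 ^ 24 / b' ^ 8 * R := by
      rw [hR]; unfold sampleSize; field_simp; norm_num
    rw [e]; gcongr
  set Q := 2 ^ 24 / b ^ 8 with hQ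
  have hQ0 : 0 < Q := by positivity
  have hQ1 : 1 ≤ Q := by
    rw [hQ, le_div_iff₀ (by positivity), one_mul]
    exact (hb48.trans (pow_le_one₀ hb'.le hb1)).trans (by norm_num)
  have hS1 : 1 ≤ S := hL1.trans hLS
  have hRS : 1 ≤ R * S := one_le_mul_of_one_le_of_one_le hR1 hS1
  have hD : 0 ≤ D := Nat.cast_nonneg _
  have hP0 : (0 : ℝ) ≤ P := Nat.cast_nonneg _
  have k1 : (P : ℝ) * (N * (N * L)) ≤ P * (R * S) := by
    rw [← mul_assoc N, ← sq]; gcongr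
  have k2 : (⌈sampleSize N ε (b' ^ 4 / 16)⌉₊ : ℝ) *
      (Tsp (sampleErr N ε (b' ^ 4 / 16)) + 100 * L + 100) ≤ 2 * (Q * R) * (201 * S) := by
    refine mul_le_mul (by linarith) (by linarith) (by positivity) (by positivity)
  have k3 : (3000 * (P : ℝ) + 210 + 402 * Q) * (R * S + D) =
      3000 * (P * (R * S)) + 210 * (R * S) + 2 * (Q * R) * (201 * S) +
        (3000 * P + 210 + 402 * Q) * D := by ring
  have k4 : 2 * D ≤ (3000 * P + 210 + 402 * Q) * D :=
    mul_le_mul_of_nonneg_right (by linarith) hD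
  rw [k3]
  linarith

end

end TVSpin

end

theorem theorem1p4 :
    ∃ (P : TVSpin.Prog) (c : ℝ) (k : ℕ), 0 < c ∧ c ≤ 1 ∧
      ∀ b : ℝ, 0 < b → b < 1 → ∃ C : ℝ, 0 < C ∧
        ∀ (n : ℕ) (G : SimpleGraph (Fin n)) (M : TVSpin.ModelPair G) (ε : ℝ)
          (Tsp Tct : ℝ → ℕ) (O : TVSpin.Oracles n),
          0 < n → 0 < ε → ε < 1 →
          (∀ x, TVSpin.MarginallyBounded b (TVSpin.gibbs (M.weight x))) →
          AntitoneOn Tsp (Set.Ioo 0 1) → AntitoneOn Tct (Set.Ioo 0 1) →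
          -- a sample takes at least the time to read the vertices and the edges
          (∀ δ ∈ Set.Ioo (0 : ℝ) 1, n + TVSpin.numEdges G ≤ Tsp δ) →
          (∀ x, TVSpin.IsSamplingOracle (TVSpin.gibbs (M.weight x)) (O.sample x)) →
          (∀ x, TVSpin.IsCountingOracle (TVSpin.partition (M.weight x)) (O.count x)) →
          (∀ ω, TVSpin.HaltsWithin P M ε Tsp Tct ω
            (C * ((M.size : ℝ) ^ 2 / ε ^ 2 * Tsp (c * b ^ k * ε ^ 2 / (M.size : ℝ) ^ 2)
              + Tct (c * b ^ k * ε / (M.size : ℝ))))) ∧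
          -- the failure probability is at most `1/3`
          O.tapeLaw {ω | ¬ TVSpin.Succeeds P M ε Tsp Tct ω} ≤ 1 / 3 := by
  open TVSpin in
  refine ⟨tvProg, 1 / 2 ^ 30, 8, by positivity, by norm_num, fun b hb hb1 =>
    ⟨3000 * (2 ^ ⌊1 / b ^ 3⌋₊ : ℕ) + 210 + 402 * (2 ^ 24 / b ^ 8), by positivity, ?_⟩⟩
  intro n G M ε Tsp Tct O hn h0 h1 hM hsp hct hL hO hOc
  have hN : (1 : ℝ) ≤ M.size := by exact_mod_cast hn.trans_le M.le_size
  obtain ⟨b', κ, ρ, hbb, hb1', hP, hρ, hrun⟩ := TVSpin.exists_exec_tvProg M h0 h1 hb hb1 hn hM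
  refine ⟨fun ω => ?_, (measure_mono (fun ω hω => ?_)).trans
    (TVSpin.tapeLaw_mainOutput_le (M.weight_nonneg .mu) (M.weight_nonneg .nu) (M.partition_pos .mu)
      (M.partition_pos .nu) (hO .mu) (hOc .mu) (hOc .nu) hN h0 h1 (hb.trans_le hbb) hb1' hρ hP)⟩
  · obtain ⟨t, s, he, ht, -⟩ := hrun Tsp Tct ω
    refine ⟨t, s, he, TVSpin.time_le (L := n + TVSpin.numEdges G) hN h0 h1 hb hbb hb1' (by omega)
      hsp hct hL ?_⟩
    exact_mod_cast ht
  · refine fun habs => hω ?_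
    obtain ⟨t, s, he, -, hv⟩ := hrun Tsp Tct ω
    rw [← hv] at habs
    obtain ⟨hl, hr⟩ := abs_le.1 habs
    change -(ε * M.tv) ≤ s.output - M.tv at hl
    change s.output - M.tv ≤ ε * M.tv at hr
    exact ⟨t, s, he, by linarith, by linarith⟩
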